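/- **Setting.** Let $J\in C^2(\mathbb R^n;\mathbb R)$, $x^*\in\mathbb R^n$, $0<\Delta\le+\infty$, $D=B_\Delta(x^*)$ (open Euclidean ball; $D=\mathbb R^n$ if $\Delta=+\infty$), $J^*=J(x^*)$, $\tilde J=J-J^*$. Let $F_{0i},F_{1i},F_{2i}:\mathbb R\to\mathbb R$ ($i=1,\dots,n$), with $F_{1i},F_{2i}$ continuous on $J(D)$. For $\varepsilon>0$ and pairwise distinct positive integers $k_1,\dots,k_n$ consider $$\dot x=\sum_{i=1}^n\big(F_{1i}(J(x))u_{1i}^\varepsilon(t)+F_{2i}(J(x))u_{2i}^\varepsilon(t)\big)e_i,\qquad(\ast)$$ $$u_{1i}^\varepsilon(t)=2\sqrt{\tfrac{\pi k_i}{\varepsilon}}\cos\tfrac{2\pi k_it}{\varepsilon},\qquad u_{2i}^\varepsilon(t)=2\sqrt{\tfrac{\pi k_i}{\varepsilon}}\sin\tfrac{2\pi k_it}{\varepsilon}.$$ The Lie derivative is $L_gf(x)=\lim_{s\to0}\frac{f(x+sg(x))-f(x)}{s}$; below, $F_{si}$ is read as the function $F_{si}(J(\cdot))$, and as a direction of differentiation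 $F_{pj}$ is read as the vector field $F_{pj}(J(\cdot))e_j$. **Assumptions.** - A1: $\nabla J(x^*)=0$, and $\nabla J(x)\ne0$, $J(x)>J^*$ for $x\in D\setminus\{x^*\}$. - A2: with constants $\gamma_1,\gamma_2,\kappa_1,\kappa_2,\mu>0$, $m_1\ge1$, for all $x\in D$: $\gamma_1\|x-x^*\|^{2m_1}\le\tilde J(x)\le\gamma_2\|x-x^*\|^{2m_1}$, $\ \kappa_1\tilde J(x)^{2-1/m_1}\le\|\nabla J(x)\|^2\le\kappa_2\tilde J(x)^{2-1/m_1}$, $\ \big\|\tfrac{\partial^2J}{\partial x^2}(x)\big\|\le\mu\tilde J(x)^{1-1/m_1}$. - A3: $F_{si}(J(\cdot))\in C^2(D\setminus\{x^*\})$, and $L_{F_{pj}}F_{si}$, $L_{F_{ql}}L_{F_{pj}}F_{si}$ exist and are continuous on $D$, for all $s,p,q\in\{1,2\}$, $i,j,l\in\{1,\dots,n\}$. - Relation: for each $i$, on $S=J(D\setminus\{x^*\})$ one has $F_{2i}=-F_{1i}\int\frac{F_{0i}}{F_{1i}^2}dz$; that is, the zeros of $F_{1i}$ in $S$ are isolated,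 there is an antiderivative $\Psi_i$ of $F_{0i}/F_{1i}^2$ off these zeros with $F_{2i}=-F_{1i}\Psi_i$ there, and $F_{2i}(z_0)=-\lim_{z\to z_0}F_{1i}(z)\Psi_i(z)$ at each zero $z_0\in S$. - A4 (used only in II): $F_{si}(J(\cdot))$ is Lipschitz on each compact subset of $D$, and for some $\alpha_1,\alpha_2,M>0$, $H\ge0$, $m_2\ge\frac1{m_1}-1$, for all indices: $\alpha_1\tilde J(x)^{m_2}\le F_{0i}(J(x))\le\alpha_2\tilde J(x)^{m_2}$ for $x\in D\setminus\{x^*\}$, and for $x\in D$: $|F_{si}(J(x))|\le M\tilde J(x)^{m_3}$, $\ |L_{F_{ql}}L_{F_{pj}}F_{si}(x)|\le H\tilde J(x)^{m_4}$, where $m_3=\frac12(m_2+1)$, $m_4=\frac32(1+m_2)-\frac1{m_1}$. **Notation.** $c=(\gamma_2/\gamma_1)^{1/(2m_1)}$, $\ \nu=2\sqrt{2\pi}\,\varepsilon^{-1/2}\sum_i\sqrt{k_i}$, and $$\varphi_{\tilde m}(s)=\begin{cases}e^{-s/(2m_1)},&\tilde m=0,\\ \big(1+\tilde m\,s\,\tilde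 J(x^0)^{\tilde m}\big)^{-\frac1{2m_1\tilde m}},&\tilde m>0.\end{cases}$$ **Stability notions.** All are uniform in the initial time $t_0\ge0$, and include that a solution of $(\ast)$ with $x(t_0)=x^0$ exists on $[t_0,\infty)$ for $x^0$ in the neighbourhood of $x^*$ in question. Exponential stability: for some $\hat\delta,C,\omega>0$, $\|x(t)-x^*\|\le C\|x^0-x^*\|e^{-\omega(t-t_0)}$ for all solutions with $x^0\in B_{\hat\delta}(x^*)$. Asymptotic stability: $x^*$ is stable (for every $r>0$ there is $\hat\delta>0$ such that solutions from $B_{\hat\delta}(x^*)$ stay in $B_r(x^*)$) and attractive (there is $\hat\delta>0$ such that for every $r>0$ there is $t_1\ge0$ with $x(t)\in B_r(x^*)$ for $t\ge t_0+t_1$ and all solutions from $B_{\hat\delta}(x^*)$). Practical asymptotic stability: the same two properties, each for all $\varepsilon\in(0,\varepsilon_0)$ with an $\varepsilon_0>0$ that may depend on $r$. Practical exponential stability: there are $\hat\delta,C,\omega>0$ such that for every $\rho>0$ there is $\varepsilon_0>0$ with $\|x(t)-x^*\|\le C\|x^0-x^*\|e^{-\omega(t-t_0)}+\rho$ for all $\varepsilon\in(0,\varepsilon_0)$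 and all solutions from $B_{\hat\delta}(x^*)$. **Theorem.** Assume A1–A3 and the relation above. **I.** Let $F_{0i}(J(x))=\alpha$ for all $x\in D$ and all $i$, with a constant $\alpha>0$, and let $\tilde m=1-\frac1{m_1}$. Then $x^*$ is practically exponentially stable for $(\ast)$ if $m_1=1$, and practically asymptotically stable if $m_1>1$. Namely, for any $\delta\in\big(0,(\gamma_1/\gamma_2)^{1/(2m_1)}\Delta\big)$, $\bar\lambda\in(0,\alpha\kappa_1)$, $\rho\in(0,\delta)$ there is an $\bar\varepsilon>0$ such that for all $\varepsilon\in(0,\bar\varepsilon]$, $\lambda\in(0,\bar\lambda]$, $x^0\in B_\delta(x^*)$, system $(\ast)$ with $x(0)=x^0$ has a solution on $[0,\infty)$, and every solution satisfies, for all $t\ge0$ in its interval of definition, $$\|x(t)-x^*\|\le c\,\|x^0-x^*\|\,\varphi_{\tilde m}(\lambda(t-\varepsilon))+\rho.$$ **II.** Let A4 hold, and let $\tilde m=1+m_2-\frac1{m_1}$ (so $\tilde m\ge0$). Then there is an $\bar\varepsilon>0$ such that for every $\varepsilon\in(0,\bar\varepsilon]$ the point $x^*$ is exponentially stable for $(\ast)$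 if $\tilde m=0$, and asymptotically stable if $\tilde m>0$. Namely, let $\delta\in\big(0,(\gamma_1/\gamma_2)^{1/(2m_1)}\Delta\big)$, $\bar\lambda\in(0,\alpha_1\kappa_1)$, $\delta_0\in(c\delta,\Delta)$, and let $L>0$ be a Lipschitz constant of all $F_{si}(J(\cdot))$ on $\overline{B_{\delta_0}(x^*)}$. Then there is an $\bar\varepsilon>0$ such that for all $\varepsilon\in(0,\bar\varepsilon]$, $\lambda\in(0,\bar\lambda]$, $x^0\in B_\delta(x^*)$, system $(\ast)$ with $x(0)=x^0$ has a solution on $[0,\infty)$, and for every solution there is a function $\sigma$ with, for all $t\ge0$ in its interval of definition, $$\|x(t)-x^*\|\le\sigma(t)\,c\,\|x^0-x^*\|\,\varphi_{\tilde m}(\lambda(t-\varepsilon)),$$ $$\sigma(t)\le1+\frac{M\gamma_2^{m_3}}{L}\Big(\frac{\gamma_2}{\gamma_1}\Big)^{\tilde m/2}\delta^{m_1\tilde m}\big(e^{\nu L\varepsilon}-1\big)\ \text{ for all } t\ge0,\qquad\sigma(t)\to1\ \text{ as } t\to\infty.$$ -/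

import Mathlib

open Set Filter Topology
open scoped NNReal ENNReal

noncomputable section

namespace ExtremumSeeking

/-- The state space `ℝⁿ` with the Euclidean norm. -/
abbrev State (n : ℕ) := EuclideanSpace ℝ (Fin n)

/-! ### Assumptions on the cost function and on the generating functions

The generating functions are indexed as `F s i`, where `s = 0` stands for `F_{1i}` and `s = 1`
for `F_{2i}`. -/

/-- `xs` is an isolated minimum of `J` in `D` and the only critical point of `J` in `D`. -/
structure AssumptionA1 {n : ℕ} (J : State n → ℝ) (D : Set (State n)) (xs : State n) : Prop where
  mem : xs ∈ D
  grad_eq_zero : gradient J xs = 0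
  grad_ne_zero : ∀ x ∈ D \ {xs}, gradient J x ≠ 0
  lt : ∀ x ∈ D \ {xs}, J xs < J x

/-- Power-type bounds on `J - J xs`, on its gradient and on its Hessian (operator norm). -/
structure AssumptionA2 {n : ℕ} (J : State n → ℝ) (D : Set (State n)) (xs : State n)
    (γ₁ γ₂ κ₁ κ₂ μ m₁ : ℝ) : Prop where
  γ₁_pos : 0 < γ₁
  γ₂_pos : 0 < γ₂
  κ₁_pos : 0 < κ₁
  κ₂_pos : 0 < κ₂
  μ_pos : 0 < μ
  one_le_m₁ : 1 ≤ m₁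
  lower : ∀ x ∈ D, γ₁ * ‖x - xs‖ ^ (2 * m₁) ≤ J x - J xs
  upper : ∀ x ∈ D, J x - J xs ≤ γ₂ * ‖x - xs‖ ^ (2 * m₁)
  grad_lower : ∀ x ∈ D, κ₁ * (J x - J xs) ^ (2 - 1 / m₁) ≤ ‖gradient J x‖ ^ 2
  grad_upper : ∀ x ∈ D, ‖gradient J x‖ ^ 2 ≤ κ₂ * (J x - J xs) ^ (2 - 1 / m₁)
  hess : ∀ x ∈ D, ‖fderiv ℝ (gradient J) x‖ ≤ μ * (J x - J xs) ^ (1 - 1 / m₁)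

/-- The vector field `x ↦ F (J x) e_j`. -/
def genField {n : ℕ} (J : State n → ℝ) (F : ℝ → ℝ) (j : Fin n) (x : State n) : State n :=
  F (J x) • EuclideanSpace.single j (1 : ℝ)

/-- The Lie derivative `L_g f (x) = lim_{s → 0} (f (x + s g(x)) - f x) / s`. -/
def lieDeriv {n : ℕ} (g : State n → State n) (f : State n → ℝ) (x : State n) : ℝ :=
  lineDeriv ℝ f x (g x)

/-- The limit defining `L_g f` exists at every point of `D`, and `L_g f` is continuous on `D`. -/
def HasContinuousLieDerivOn {n : ℕ} (g : State n → State n) (f : State n → ℝ)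
    (D : Set (State n)) : Prop :=
  (∀ x ∈ D, LineDifferentiableAt ℝ f x (g x)) ∧ ContinuousOn (lieDeriv g f) D

/-- The functions `F s i ∘ J` are `C²` in `D` away from `xs`, and their first and second Lie
derivatives along the fields `F p j (J x) e_j` exist and are continuous on the whole of `D`. -/
structure AssumptionA3 {n : ℕ} (J : State n → ℝ) (D : Set (State n)) (xs : State n)
    (F : Fin 2 → Fin n → ℝ → ℝ) : Prop where
  contDiffOn : ∀ s i, ContDiffOn ℝ 2 (fun x => F s i (J x)) (D \ {xs})
  lie_one : ∀ s p i j,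
    HasContinuousLieDerivOn (genField J (F p j) j) (fun x => F s i (J x)) D
  lie_two : ∀ s p q i j l,
    HasContinuousLieDerivOn (genField J (F q l) l)
      (lieDeriv (genField J (F p j) j) (fun x => F s i (J x))) D

/-- The controls vanish at the minimal value of `J`, with power-type bounds. -/
structure AssumptionA4 {n : ℕ} (J : State n → ℝ) (D : Set (State n)) (xs : State n)
    (F₀ : Fin n → ℝ → ℝ) (F : Fin 2 → Fin n → ℝ → ℝ)
    (m₁ m₂ α₁ α₂ M H : ℝ) : Prop where
  α₁_pos : 0 < α₁
  α₂_pos : 0 < α₂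
  M_pos : 0 < M
  H_nonneg : 0 ≤ H
  m₂_ge : 1 / m₁ - 1 ≤ m₂
  lipschitz : ∀ s i, ∀ K : Set (State n), IsCompact K → K ⊆ D →
    ∃ L : ℝ≥0, LipschitzOnWith L (fun x => F s i (J x)) K
  -- `m₂` may be negative, so that the powers below make sense only for `x ≠ xs`
  F₀_lower : ∀ i, ∀ x ∈ D \ {xs}, α₁ * (J x - J xs) ^ m₂ ≤ F₀ i (J x)
  F₀_upper : ∀ i, ∀ x ∈ D \ {xs}, F₀ i (J x) ≤ α₂ * (J x - J xs) ^ m₂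
  F_bound : ∀ s i, ∀ x ∈ D, |F s i (J x)| ≤ M * (J x - J xs) ^ ((m₂ + 1) / 2)
  lie_bound : ∀ s p q i j l, ∀ x ∈ D,
    |lieDeriv (genField J (F q l) l)
      (lieDeriv (genField J (F p j) j) (fun y => F s i (J y))) x|
      ≤ H * (J x - J xs) ^ (3 / 2 * (1 + m₂) - 1 / m₁)

/-- The relation `F₂ = - F₁ ∫ F₀ / F₁²` on a set `S` of real numbers: the zeros of `F₁` in `S` are
isolated, `Ψ` is an antiderivative of `F₀ / F₁²` off these zeros, `F₂ = - F₁ Ψ` there, and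
`F₂ = - lim F₁ Ψ` at the zeros. -/
def GeneratingRelation (F₀ F₁ F₂ : ℝ → ℝ) (S : Set ℝ) : Prop :=
  (∀ z ∈ S, F₁ z = 0 → ∀ᶠ w in 𝓝[≠] z, F₁ w ≠ 0) ∧
  ∃ Ψ : ℝ → ℝ,
    (∀ z ∈ S, F₁ z ≠ 0 → HasDerivAt Ψ (F₀ z / F₁ z ^ 2) z ∧ F₂ z = -(F₁ z * Ψ z)) ∧
    (∀ z ∈ S, F₁ z = 0 → Tendsto (fun w => -(F₁ w * Ψ w)) (𝓝[≠] z) (𝓝 (F₂ z)))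

/-! ### The control system -/

/-- The trigonometric dithers with frequency number `k` and period parameter `ε`;
component `0` is `u_{1i}^ε(t)` and component `1` is `u_{2i}^ε(t)`. -/
def dither (k : ℕ) (ε t : ℝ) : Fin 2 → ℝ :=
  ![2 * √(Real.pi * k / ε) * Real.cos (2 * Real.pi * k * t / ε),
    2 * √(Real.pi * k / ε) * Real.sin (2 * Real.pi * k * t / ε)]

/-- Right-hand side of the extremum seeking system with parameter `ε`. -/
def esField {n : ℕ} (J : State n → ℝ) (F : Fin 2 → Fin n → ℝ → ℝ) (k : Fin n → ℕ)
    (ε t : ℝ) (x : State n) : State n :=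
  ∑ i, (F 0 i (J x) * dither (k i) ε t 0 + F 1 i (J x) * dither (k i) ε t 1) •
    EuclideanSpace.single i (1 : ℝ)

/-- `x` is a solution of `ẋ = f(t, x)`, `x(t₀) = x₀`, on `I`, where `I` is an interval with left
end point `t₀ ∈ I`, such as `[t₀, T]`, `[t₀, T)` or `[t₀, ∞)`. -/
structure IsSolution {n : ℕ} (f : ℝ → State n → State n) (t₀ : ℝ) (x₀ : State n) (I : Set ℝ)
    (x : ℝ → State n) : Prop where
  mem : t₀ ∈ I
  ordConnected : I.OrdConnected
  subset : I ⊆ Ici t₀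
  init : x t₀ = x₀
  deriv : ∀ t ∈ I, HasDerivWithinAt x (f t (x t)) I t

/-- The initial value problem has a solution on `[t₀, ∞)`. -/
def HasGlobalSolution {n : ℕ} (f : ℝ → State n → State n) (t₀ : ℝ) (x₀ : State n) : Prop :=
  ∃ x, IsSolution f t₀ x₀ (Ici t₀) x

/-! ### Stability in the sense of Lyapunov (uniform in the initial time) -/

/-- `xs` is asymptotically stable for `ẋ = f(t, x)`: it is stable and attractive. -/
def AsymptoticallyStable {n : ℕ} (f : ℝ → State n → State n) (xs : State n) : Prop :=
  (∀ r > 0, ∃ δ > 0, ∀ t₀ ≥ 0, ∀ x₀ ∈ Metric.ball xs δ,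
    HasGlobalSolution f t₀ x₀ ∧
    ∀ I x, IsSolution f t₀ x₀ I x → ∀ t ∈ I, x t ∈ Metric.ball xs r) ∧
  (∃ δ > 0, ∀ r > 0, ∃ t₁ ≥ 0, ∀ t₀ ≥ 0, ∀ x₀ ∈ Metric.ball xs δ,
    ∀ I x, IsSolution f t₀ x₀ I x → ∀ t ∈ I, t₀ + t₁ ≤ t → x t ∈ Metric.ball xs r)

/-- `xs` is exponentially stable for `ẋ = f(t, x)`. -/
def ExponentiallyStable {n : ℕ} (f : ℝ → State n → State n) (xs : State n) : Prop :=
  ∃ δ > 0, ∃ C > 0, ∃ ω > 0, ∀ t₀ ≥ 0, ∀ x₀ ∈ Metric.ball xs δ,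
    HasGlobalSolution f t₀ x₀ ∧
    ∀ I x, IsSolution f t₀ x₀ I x → ∀ t ∈ I,
      ‖x t - xs‖ ≤ C * ‖x₀ - xs‖ * Real.exp (-ω * (t - t₀))

/-! ### Practical stability of families of systems as the parameter `ε` tends to `0` -/

/-- `xs` is practically (uniformly) asymptotically stable for the family `ẋ = f_ε(t, x)`: it is
practically uniformly stable and practically uniformly attractive. -/
def PracticallyAsymptoticallyStable {n : ℕ} (f : ℝ → ℝ → State n → State n)
    (xs : State n) : Prop :=
  (∀ r > 0, ∃ δ > 0, ∃ ε₀ > 0, ∀ t₀ ≥ 0, ∀ ε, 0 < ε → ε < ε₀ → ∀ x₀ ∈ Metric.ball xs δ,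
    HasGlobalSolution (f ε) t₀ x₀ ∧
    ∀ I x, IsSolution (f ε) t₀ x₀ I x → ∀ t ∈ I, x t ∈ Metric.ball xs r) ∧
  (∃ δ > 0, ∀ r > 0, ∃ t₁ ≥ 0, ∃ ε₀ > 0, ∀ t₀ ≥ 0, ∀ ε, 0 < ε → ε < ε₀ →
    ∀ x₀ ∈ Metric.ball xs δ,
    HasGlobalSolution (f ε) t₀ x₀ ∧
    ∀ I x, IsSolution (f ε) t₀ x₀ I x → ∀ t ∈ I, t₀ + t₁ ≤ t → x t ∈ Metric.ball xs r)

/-- `xs` is practically exponentially stable for the family `ẋ = f_ε(t, x)`: solutions obey an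
exponential estimate up to an offset that is arbitrarily small for small `ε`. -/
def PracticallyExponentiallyStable {n : ℕ} (f : ℝ → ℝ → State n → State n)
    (xs : State n) : Prop :=
  ∃ δ > 0, ∃ C > 0, ∃ ω > 0, ∀ ρ > 0, ∃ ε₀ > 0, ∀ t₀ ≥ 0, ∀ ε, 0 < ε → ε < ε₀ →
    ∀ x₀ ∈ Metric.ball xs δ,
    HasGlobalSolution (f ε) t₀ x₀ ∧
    ∀ I x, IsSolution (f ε) t₀ x₀ I x → ∀ t ∈ I,
      ‖x t - xs‖ ≤ C * ‖x₀ - xs‖ * Real.exp (-ω * (t - t₀)) + ρ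

/-! ### The decay estimate -/

/-- The decay function: `exp (-s / (2 m₁))` if `m = 0`, and
`(1 + m s j ^ m) ^ (-1 / (2 m₁ m))` otherwise; `j` is the initial value of `J - J xs`. -/
def decayFun (m₁ m j s : ℝ) : ℝ :=
  if m = 0 then Real.exp (-s / (2 * m₁))
  else (1 + m * s * j ^ m) ^ (-1 / (2 * m₁ * m))

/-- The bound `2 √(2π) ε^(-1/2) ∑ √k_i` for the sum of the absolute values of all inputs. -/
def inputBound {n : ℕ} (k : Fin n → ℕ) (ε : ℝ) : ℝ :=
  2 * √(2 * Real.pi) * ε ^ (-(1 / 2) : ℝ) * ∑ i, √(k i : ℝ)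

end ExtremumSeeking

end

/-!
The proof compares the extremum seeking system with its average over one period of length `ε`.

Over a period the dithers have mean zero, and their second iterated integrals are `± ε` for the two
phases of one frequency and vanish otherwise (`integral_dither_mul_integral_dither`; this is where
the frequencies have to be distinct). Hence a second-order expansion gives
`x (a + ε) = x a + ε B (x a) + R`, where `B` is the sum of the Lie brackets of the fields
`F_{1i}(J) e_i` and `F_{2i}(J) e_i`, and `R` is of order `ε ^ (3/2)` times a bound for the second
Lie derivatives along the path (`abs_period_expansion_le`). The relation between the generating
functions says that `B` has the components `- F_{0i}(J) ∂_i J` (`bracket_eq_of_ne_zero`); at the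
zeros of `F_{1i}` the two-sided bounds that follow from this are obtained by continuity
(`bracket_bounds`). A Taylor expansion of `J` and the power bounds on its gradient and Hessian then
yield, for `V = J - J xs` and `m = m̃`, the one-step estimate

  `V (x (a + ε)) ≤ max (V (x a) - ε λ V (x a) ^ (1 + m)) θ`   (`PeriodDecrease`).

For constant `F₀` the remainders are bounded by a constant times `ε ^ (3/2)`, so that `θ > 0` can be
chosen arbitrarily small at the expense of `ε`. For vanishing controls all the remainders are bounded
by a constant times `ε ^ (3/2) V (x a) ^ (1 + m)`, since `V` at most doubles within a period
(`sub_le_two_mul_of_vanishing`), and `θ = 0` is admissible.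

An Euler step for `v' = - v ^ (1 + m)` stays below the exact solution (`sub_mul_rpow_le_comparison`),
so `V` at the starts of periods is dominated by the explicit solution `comparison` of that equation,
which is the source of the decay function. Within a period, a solution deviates from its value at
the start of the period by `O(√ε)`; with vanishing Lipschitz controls, Grönwall's inequality turns
this into a relative deviation, which is the factor `σ` (`norm_sub_le_of_lipschitz`,
`exists_amplitude`). For `m > 0` the relative deviation decays with `V`; for `m = 0` it does not, and
`σ` tends to `1` because the comparison is run with a rate strictly between the prescribed rate `λ̄`
and `α₁ κ₁`.

Two points need care because the generating functions are merely continuous on the range of `J`.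
Solutions need not be unique, and their existence is Peano's theorem, proved here by delayed
equations (`exists_forward_solution_of_bounded`) and applied to a continuous bounded extension of the
field from a closed ball that solutions do not leave. The functions `F_{si}(J)` and their Lie
derivatives need not be differentiable at `xs`, and solutions may visit `xs`; the chain rule along
solutions persists because at an accumulation point of such visits the velocity is zero
(`hasDerivWithinAt_comp_solution`).
-/

namespace ExtremumSeeking

/-! ### Peano's existence theorem -/

section Peano

variable {E : Type*} [NormedAddCommGroup E] [NormedSpace ℝ E]

/-- Picard iterates for the delayed equation `x'(t) = f (t, x (t - h))` with the constant history
`x₀` before `t₀`. They become stationary on `[t₀, t₀ + k h]` after `k` steps, hence solve the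
delayed equation there. -/
noncomputable def delayedPicard (f : ℝ → E → E) (t₀ : ℝ) (x₀ : E) (h : ℝ) : ℕ → ℝ → E
  | 0 => fun _ => x₀
  | k + 1 => fun t => x₀ + ∫ s in t₀..max t₀ t, f s (delayedPicard f t₀ x₀ h k (s - h))

variable {f : ℝ → E → E} {t₀ : ℝ} {x₀ : E} {h B : ℝ}

theorem continuous_delayedPicard (hf : Continuous (Function.uncurry f)) (k : ℕ) :
    Continuous (delayedPicard f t₀ x₀ h k) := by
  induction k with
  | zero => exact continuous_const
  | succ k ih =>
    have h1 : Continuous fun s => f s (delayedPicard f t₀ x₀ h k (s - h)) :=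
      hf.comp (continuous_id.prodMk (ih.comp (continuous_id.sub continuous_const)))
    have h2 := intervalIntegral.continuous_primitive (μ := MeasureTheory.volume)
      (fun a b => h1.intervalIntegrable a b) t₀
    exact continuous_const.add (h2.comp (continuous_const.max continuous_id))

theorem continuous_delayedPicard_rhs (hf : Continuous (Function.uncurry f)) (k : ℕ) :
    Continuous fun s => f s (delayedPicard f t₀ x₀ h k (s - h)) :=
  hf.comp (continuous_id.prodMk
    ((continuous_delayedPicard hf k).comp (continuous_id.sub continuous_const)))

theorem hasDerivWithinAt_delayedPicard [CompleteSpace E]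
    (hf : Continuous (Function.uncurry f)) (k : ℕ) {t : ℝ}
    (ht : t₀ ≤ t) :
    HasDerivWithinAt (delayedPicard f t₀ x₀ h (k + 1))
      (f t (delayedPicard f t₀ x₀ h k (t - h))) (Ici t₀) t := by
  have h1 := continuous_delayedPicard_rhs (t₀ := t₀) (x₀ := x₀) (h := h) hf k
  have h2 := (intervalIntegral.integral_hasDerivAt_right (h1.intervalIntegrable t₀ t)
    (h1.stronglyMeasurableAtFilter _ _) h1.continuousAt).const_add x₀
  refine h2.hasDerivWithinAt.congr (fun s hs => ?_) ?_
  · simp only [delayedPicard]; rw [max_eq_right hs]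
  · simp only [delayedPicard]; rw [max_eq_right ht]

theorem delayedPicard_succ_eq (f : ℝ → E → E) (t₀ : ℝ) (x₀ : E) {h : ℝ} (hh : 0 ≤ h) (k : ℕ)
    {t : ℝ} (ht : t ≤ t₀ + k * h) :
    delayedPicard f t₀ x₀ h (k + 1) t = delayedPicard f t₀ x₀ h k t := by
  induction k generalizing t with
  | zero =>
    have : max t₀ t = t₀ := max_eq_left (by simpa using ht)
    simp [delayedPicard, this]
  | succ k ih =>
    rw [delayedPicard.eq_2 f t₀ x₀ h (k + 1), delayedPicard.eq_2 f t₀ x₀ h k]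
    refine congrArg (x₀ + ·) ?_
    refine intervalIntegral.integral_congr fun s hs => ?_
    rw [uIcc_of_le (le_max_left _ _)] at hs
    have h1 : s ≤ t₀ + (k + 1 : ℕ) * h :=
      hs.2.trans (max_le (by have : 0 ≤ ((k + 1 : ℕ) : ℝ) * h := by positivity
                             linarith) ht)
    have h2 : s - h ≤ t₀ + k * h := by push_cast at h1; linarith
    exact congrArg (f s) (ih h2)

theorem norm_delayedPicard_sub_le (hf : Continuous (Function.uncurry f))
    (hB : ∀ t y, ‖f t y‖ ≤ B) (k : ℕ) (s t : ℝ) :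
    ‖delayedPicard f t₀ x₀ h k t - delayedPicard f t₀ x₀ h k s‖ ≤ B * |t - s| := by
  have hB0 : 0 ≤ B := (norm_nonneg _).trans (hB 0 x₀)
  cases k with
  | zero => simp only [delayedPicard, sub_self, norm_zero]; positivity
  | succ k =>
    have h1 := continuous_delayedPicard_rhs (t₀ := t₀) (x₀ := x₀) (h := h) hf k
    simp only [delayedPicard, add_sub_add_left_eq_sub]
    rw [intervalIntegral.integral_interval_sub_left (h1.intervalIntegrable _ _)
      (h1.intervalIntegrable _ _)]
    refine (intervalIntegral.norm_integral_le_of_norm_le_const (fun u _ => hB u _)).trans ?_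
    have := abs_max_sub_max_le_abs t s t₀
    rw [max_comm t, max_comm s] at this
    gcongr

/-- **Peano's theorem**: a bounded continuous time-dependent vector field on a finite-dimensional
space has global forward solutions. The solution is a pointwise limit, along a nonprincipal
ultrafilter, of solutions of delayed equations; equicontinuity makes the limit a solution. -/
theorem exists_forward_solution_of_bounded [FiniteDimensional ℝ E]
    (hf : Continuous (Function.uncurry f))
    (hB : ∀ t y, ‖f t y‖ ≤ B) (t₀ : ℝ) (x₀ : E) :
    ∃ x : ℝ → E, x t₀ = x₀ ∧ ∀ t ∈ Ici t₀, HasDerivWithinAt x (f t (x t)) (Ici t₀) t := by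
  have : CompleteSpace E := FiniteDimensional.complete ℝ E
  have hB0 : 0 ≤ B := (norm_nonneg _).trans (hB 0 x₀)
  set d : ℕ → ℝ := fun n => 1 / ((n : ℝ) + 1) with hd
  set y : ℕ → ℝ → E := fun n => delayedPicard f t₀ x₀ (d n) ((n + 1) ^ 2 + 1) with hy
  have hylip : ∀ n s t, ‖y n t - y n s‖ ≤ B * |t - s| := fun n s t =>
    norm_delayedPicard_sub_le hf hB _ s t
  have hy0 : ∀ n, y n t₀ = x₀ := fun n => by simp [hy, delayedPicard]
  have hder : ∀ (n : ℕ) (t : ℝ), t₀ ≤ t → t ≤ t₀ + n →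
      HasDerivWithinAt (y n) (f t (y n (t - d n))) (Ici t₀) t := by
    intro n t h1 h2
    have h3 := hasDerivWithinAt_delayedPicard (x₀ := x₀) (h := d n) hf ((n + 1) ^ 2) h1
    have hdn : 0 < d n := by positivity
    have h4 : t - d n ≤ t₀ + ((n + 1) ^ 2 : ℕ) * d n := by
      have : (((n + 1) ^ 2 : ℕ) : ℝ) * d n = n + 1 := by
        simp only [hd]; push_cast; field_simp
      rw [this]; linarith
    rw [← delayedPicard_succ_eq f t₀ x₀ hdn.le _ h4] at h3
    exact h3
  -- pointwise limits along a nonprincipal ultrafilter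
  have hlim : ∀ t, ∃ z, Tendsto (fun n => y n t) (hyperfilter ℕ) (𝓝 z) := by
    intro t
    have hmem : ∀ n, y n t ∈ Metric.closedBall x₀ (B * |t - t₀|) := fun n => by
      rw [mem_closedBall_iff_norm, ← hy0 n]; exact hylip n t₀ t
    obtain ⟨z, -, hz⟩ := (isCompact_closedBall x₀ (B * |t - t₀|)).ultrafilter_le_nhds
      ((hyperfilter ℕ).map fun n => y n t)
      (by rw [le_principal_iff]; exact Filter.mem_map.2 (Eventually.of_forall hmem))
    exact ⟨z, hz⟩
  choose x hx using hlim
  refine ⟨x, tendsto_nhds_unique (hx t₀) (by simp only [hy0]; exact tendsto_const_nhds), ?_⟩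
  intro s hs
  rw [hasDerivWithinAt_iff_isLittleO, Asymptotics.isLittleO_iff]
  intro η hη
  obtain ⟨r, hr, hcont⟩ := Metric.continuousAt_iff.1 (hf.continuousAt (x := (s, x s))) η hη
  have hr' : 0 < min r (r / (4 * (B + 1))) := lt_min hr (by positivity)
  filter_upwards [self_mem_nhdsWithin, mem_nhdsWithin_of_mem_nhds (Metric.ball_mem_nhds s hr')]
    with t ht htr
  rw [Metric.mem_ball, Real.dist_eq] at htr
  have hup : ∀ᶠ n in (hyperfilter ℕ : Filter ℕ),
      ‖y n t - y n s - (t - s) • f s (x s)‖ ≤ η * ‖t - s‖ := by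
    have e1 : ∀ᶠ n in (hyperfilter ℕ : Filter ℕ), dist (y n s) (x s) < r / 4 :=
      (hx s) (Metric.ball_mem_nhds _ (by positivity))
    have e2 : ∀ᶠ n in (hyperfilter ℕ : Filter ℕ), B * d n < r / 4 := by
      have : Tendsto (fun n => B * d n) atTop (𝓝 (B * 0)) :=
        tendsto_one_div_add_atTop_nhds_zero_nat.const_mul B
      rw [mul_zero] at this
      exact Nat.hyperfilter_le_atTop (this.eventually_lt_const (by positivity))
    have e3 : ∀ᶠ n : ℕ in (hyperfilter ℕ : Filter ℕ), max s t ≤ t₀ + (n : ℝ) := by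
      have : ∀ᶠ n : ℕ in atTop, max s t - t₀ ≤ n :=
        tendsto_natCast_atTop_atTop.eventually_ge_atTop _
      filter_upwards [Nat.hyperfilter_le_atTop this] with n hn
      linarith
    filter_upwards [e1, e2, e3] with n h1 h2 h3
    have hsub : uIcc s t ⊆ Ici t₀ := fun u hu => (le_min hs ht).trans hu.1
    have hD : ∀ u ∈ uIcc s t, HasDerivWithinAt (fun u => y n u - u • f s (x s))
        (f u (y n (u - d n)) - f s (x s)) (uIcc s t) u := by
      intro u hu
      have := ((hder n u (hsub hu) (hu.2.trans h3)).mono hsub).sub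
        ((hasDerivWithinAt_id u (uIcc s t)).smul_const (f s (x s)))
      rw [one_smul] at this
      exact this
    have hbd : ∀ u ∈ uIcc s t, ‖f u (y n (u - d n)) - f s (x s)‖ ≤ η := by
      intro u hu
      have hus : |u - s| ≤ |t - s| := abs_sub_left_of_mem_uIcc hu
      have hdn : 0 < d n := by positivity
      rw [← dist_eq_norm]
      refine (hcont (x := (u, y n (u - d n))) ?_).le
      rw [Prod.dist_eq]
      refine max_lt ?_ ?_
      · rw [Real.dist_eq]
        exact hus.trans_lt (htr.trans_le (min_le_left _ _))
      · have h4 : dist (y n (u - d n)) (y n s) ≤ B * (|u - s| + d n) := by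
          rw [dist_eq_norm]
          refine (hylip n s (u - d n)).trans ?_
          gcongr
          rw [show u - d n - s = (u - s) + -d n by ring]
          refine (abs_add_le _ _).trans ?_
          rw [abs_neg, abs_of_pos hdn]
        have h5 : B * |u - s| ≤ r / 4 := by
          have : |u - s| ≤ r / (4 * (B + 1)) := hus.trans (htr.le.trans (min_le_right _ _))
          calc B * |u - s| ≤ (B + 1) * (r / (4 * (B + 1))) := by gcongr; linarith
            _ = r / 4 := by field_simp
        calc dist (y n (u - d n)) (x s) ≤ dist (y n (u - d n)) (y n s) + dist (y n s) (x s) :=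
              dist_triangle _ _ _
          _ < r := by linarith
    have := (convex_uIcc s t).norm_image_sub_le_of_norm_hasDerivWithin_le hD hbd
      left_mem_uIcc right_mem_uIcc
    convert this using 2
    rw [sub_smul]; abel
  have hlim2 : Tendsto (fun n => ‖y n t - y n s - (t - s) • f s (x s)‖) (hyperfilter ℕ)
      (𝓝 ‖x t - x s - (t - s) • f s (x s)‖) :=
    (((hx t).sub (hx s)).sub tendsto_const_nhds).norm
  exact le_of_tendsto hlim2 hup

end Peano

end ExtremumSeeking

namespace ExtremumSeeking

/-! ### Differentiation across a set where a function is constant -/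

/-- One-sided core of `hasDerivWithinAt_of_eq_const_on`: a continuous function that equals `c` on
a closed set `Z ∋ t` and has derivative `w` off `Z` has the right derivative `w t` at `t`, provided
that `w t = 0` whenever `Z` accumulates at `t` from the right. -/
theorem hasDerivWithinAt_right_of_eq_const_on {h w : ℝ → ℝ} {Z : Set ℝ} {t b c : ℝ}
    (hh : ContinuousOn h (Icc t b)) (hw : ContinuousWithinAt w (Icc t b) t)
    (hZ : IsClosed (Icc t b ∩ Z)) (hc : ∀ s ∈ Icc t b, s ∈ Z → h s = c) (ht : t ∈ Z)
    (hd : ∀ s ∈ Ioo t b, s ∉ Z → HasDerivAt h (w s) s)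
    (hacc : (∃ᶠ s in 𝓝[>] t, s ∈ Z) → w t = 0) :
    HasDerivWithinAt h (w t) (Icc t b) t := by
  rw [hasDerivWithinAt_iff_isLittleO, Asymptotics.isLittleO_iff]
  intro η hη
  obtain ⟨r, hr, hwr⟩ := Metric.continuousWithinAt_iff.1 hw η hη
  -- either `t` is isolated in `Z` from the right, or `w t = 0`
  have hiso : ∀ᶠ τ in 𝓝[Icc t b] t, (∀ s ∈ Ioc t τ, s ∉ Z) ∨ w t = 0 := by
    by_cases hf : ∃ᶠ s in 𝓝[>] t, s ∈ Z
    · exact Eventually.of_forall fun _ => Or.inr (hacc hf)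
    · rw [not_frequently, eventually_nhdsWithin_iff, Metric.eventually_nhds_iff] at hf
      obtain ⟨r₁, hr₁, hf⟩ := hf
      filter_upwards [mem_nhdsWithin_of_mem_nhds (Metric.ball_mem_nhds t hr₁)] with τ hτ
      refine Or.inl fun s hs => hf ?_ hs.1
      rw [Metric.mem_ball, Real.dist_eq, abs_lt] at hτ
      rw [Real.dist_eq, abs_lt]
      constructor <;> linarith [hs.1, hs.2]
  filter_upwards [hiso, self_mem_nhdsWithin, mem_nhdsWithin_of_mem_nhds (Metric.ball_mem_nhds t hr)]
    with τ h1 hτ hτr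
  rw [Metric.mem_ball, Real.dist_eq] at hτr
  have htb : t ∈ Icc t b := ⟨le_rfl, hτ.1.trans hτ.2⟩
  -- the last point of `Z` before `τ`
  have hcl : IsClosed (Icc t τ ∩ Z) := by
    have : Icc t τ ∩ Z = Icc t τ ∩ (Icc t b ∩ Z) := by
      rw [← inter_assoc, inter_eq_left.2 (Icc_subset_Icc_right hτ.2)]
    rw [this]; exact isClosed_Icc.inter hZ
  have hne : (Icc t τ ∩ Z).Nonempty := ⟨t, ⟨le_rfl, hτ.1⟩, ht⟩
  have hbdd : BddAbove (Icc t τ ∩ Z) := ⟨τ, fun s hs => hs.1.2⟩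
  set z := sSup (Icc t τ ∩ Z) with hz
  have hzmem : z ∈ Icc t τ ∩ Z := hcl.csSup_mem hne hbdd
  have hoff : ∀ s ∈ Ioc z τ, s ∉ Z := fun s hs hsZ =>
    (not_le.2 hs.1) (le_csSup hbdd ⟨⟨hzmem.1.1.trans hs.1.le, hs.2⟩, hsZ⟩)
  have hzt : z = t ∨ w t = 0 := by
    refine h1.imp_left fun h2 => ?_
    by_contra hne
    exact h2 z ⟨lt_of_le_of_ne hzmem.1.1 (Ne.symm hne), hzmem.1.2⟩ hzmem.2
  have hkey : h τ - h t - (τ - t) * w t = h τ - h z - (τ - z) * w t := by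
    rcases hzt with h2 | h2
    · rw [h2]
    · rw [hc z ⟨hzmem.1.1, hzmem.1.2.trans hτ.2⟩ hzmem.2, hc t htb ht, h2]; ring
  rw [smul_eq_mul, hkey, Real.norm_eq_abs, Real.norm_eq_abs]
  rcases eq_or_lt_of_le hzmem.1.2 with h2 | h2
  · rw [h2]; simp only [sub_self, zero_mul, abs_zero]; positivity
  · obtain ⟨ξ, hξ, hslope⟩ := exists_hasDerivAt_eq_slope h w h2
      (hh.mono (Icc_subset_Icc hzmem.1.1 hτ.2)) fun s hs =>
        hd s ⟨hzmem.1.1.trans_lt hs.1, hs.2.trans_le hτ.2⟩ (hoff s ⟨hs.1, hs.2.le⟩)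
    have h3 : 0 < τ - z := sub_pos.2 h2
    have h4 : h τ - h z - (τ - z) * w t = (w ξ - w t) * (τ - z) := by
      rw [hslope]; field_simp
    have h5 : t ≤ ξ := hzmem.1.1.trans hξ.1.le
    have h6 : |w ξ - w t| ≤ η := by
      rw [← Real.dist_eq]
      refine (hwr ⟨h5, hξ.2.le.trans hτ.2⟩ ?_).le
      rw [Real.dist_eq, abs_of_nonneg (sub_nonneg.2 h5)]
      exact lt_of_le_of_lt (by linarith [hξ.2]) ((le_abs_self _).trans_lt hτr)
    rw [h4, abs_mul, abs_of_pos h3, abs_of_nonneg (sub_nonneg.2 hτ.1)]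
    exact mul_le_mul h6 (by linarith [hzmem.1.1]) h3.le hη.le

/-- A continuous function that is constant on a closed set `Z` and has derivative `w` off `Z` has
derivative `w` everywhere, provided that `w` is continuous and vanishes at the accumulation points
of `Z`. -/
theorem hasDerivWithinAt_of_eq_const_on {h w : ℝ → ℝ} {Z : Set ℝ} {a b c : ℝ}
    (hh : ContinuousOn h (Icc a b)) (hw : ContinuousOn w (Icc a b))
    (hZ : IsClosed (Icc a b ∩ Z)) (hc : ∀ s ∈ Icc a b, s ∈ Z → h s = c)
    (hd : ∀ s ∈ Icc a b, s ∉ Z → HasDerivWithinAt h (w s) (Icc a b) s)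
    (hacc : ∀ t ∈ Icc a b, t ∈ Z → (∃ᶠ s in 𝓝[Icc a b \ {t}] t, s ∈ Z) → w t = 0) :
    ∀ t ∈ Icc a b, HasDerivWithinAt h (w t) (Icc a b) t := by
  intro t ht
  by_cases htZ : t ∈ Z
  swap
  · exact hd t ht htZ
  have hright : HasDerivWithinAt h (w t) (Icc t b) t := by
    have hsub : Icc t b ⊆ Icc a b := Icc_subset_Icc_left ht.1
    rcases eq_or_lt_of_le ht.2 with h0 | h0
    · rw [h0, Icc_self]; exact HasFDerivWithinAt.singleton
    refine hasDerivWithinAt_right_of_eq_const_on (hh.mono hsub) ((hw t ht).mono hsub) ?_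
      (fun s hs => hc s (hsub hs)) htZ (fun s hs hsZ => ?_) fun hf => hacc t ht htZ ?_
    · have : Icc t b ∩ Z = Icc t b ∩ (Icc a b ∩ Z) := by
        rw [← inter_assoc, inter_eq_left.2 hsub]
      rw [this]; exact isClosed_Icc.inter hZ
    · exact (hd s (hsub ⟨hs.1.le, hs.2.le⟩) hsZ).hasDerivAt
        (Icc_mem_nhds (ht.1.trans_lt hs.1) hs.2)
    · rw [← nhdsWithin_Ioc_eq_nhdsGT h0] at hf
      exact hf.filter_mono (nhdsWithin_mono t fun s hs =>
        ⟨hsub ⟨hs.1.le, hs.2⟩, ne_of_gt hs.1⟩)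
  have hleft : HasDerivWithinAt h (w t) (Icc a t) t := by
    have hsub : Icc a t ⊆ Icc a b := Icc_subset_Icc_right ht.2
    rcases eq_or_lt_of_le ht.1 with h0 | h0
    · rw [← h0, Icc_self]; exact HasFDerivWithinAt.singleton
    -- reflect time
    have hmaps : MapsTo (fun s : ℝ => -s) (Icc (-t) (-a)) (Icc a t) := fun s hs =>
      ⟨by linarith [hs.2], by linarith [hs.1]⟩
    have hneg : ∀ s, HasDerivAt (fun s : ℝ => -s) (-1) s := hasDerivAt_neg
    have key : HasDerivWithinAt (fun s => h (-s)) (-w (- -t)) (Icc (-t) (-a)) (-t) := by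
      refine hasDerivWithinAt_right_of_eq_const_on (w := fun s => -w (-s))
        (Z := (fun s : ℝ => -s) ⁻¹' Z) (c := c) ?_ ?_ ?_ ?_ ?_ ?_ ?_
      · exact (hh.mono hsub).comp continuous_neg.continuousOn hmaps
      · refine ContinuousWithinAt.neg ?_
        refine ContinuousWithinAt.comp (t := Icc a t) ?_ continuous_neg.continuousWithinAt hmaps
        rw [neg_neg]; exact (hw t ht).mono hsub
      · have : Icc (-t) (-a) ∩ (fun s : ℝ => -s) ⁻¹' Z
            = (fun s : ℝ => -s) ⁻¹' (Icc a t ∩ (Icc a b ∩ Z)) := by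
          rw [← inter_assoc, inter_eq_left.2 hsub]
          ext s; simp only [mem_inter_iff, mem_Icc, mem_preimage]
          constructor <;> rintro ⟨⟨h1, h2⟩, h3⟩ <;> exact ⟨⟨by linarith, by linarith⟩, h3⟩
        rw [this]
        exact (isClosed_Icc.inter hZ).preimage continuous_neg
      · exact fun s hs hsZ => hc _ (hsub (hmaps hs)) hsZ
      · simpa using htZ
      · intro s hs hsZ
        have h1 : HasDerivAt h (w (-s)) (-s) :=
          (hd (-s) (hsub (hmaps ⟨hs.1.le, hs.2.le⟩)) hsZ).hasDerivAt
            (Icc_mem_nhds (by linarith [hs.2]) (by linarith [hs.1, ht.2]))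
        have := h1.comp s (hneg s)
        rw [mul_neg_one] at this
        exact this
      · intro hf
        rw [neg_neg, neg_eq_zero]
        refine hacc t ht htZ ?_
        rw [← nhdsWithin_Ioc_eq_nhdsGT (neg_lt_neg h0)] at hf
        have ht2 : Tendsto (fun s : ℝ => -s) (𝓝[Ioc (-t) (-a)] (-t)) (𝓝[Icc a b \ {t}] t) := by
          refine tendsto_nhdsWithin_of_tendsto_nhds_of_eventually_within _ ?_ ?_
          · have := (continuous_neg (G := ℝ)).tendsto (-t)
            rw [neg_neg] at this
            exact this.mono_left nhdsWithin_le_nhds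
          · filter_upwards [self_mem_nhdsWithin] with s hs
            exact ⟨hsub (hmaps ⟨hs.1.le, hs.2⟩), by
              intro h1; rw [mem_singleton_iff] at h1; linarith [hs.1]⟩
        exact ht2.frequently hf
    have hmaps' : MapsTo (fun s : ℝ => -s) (Icc a t) (Icc (-t) (-a)) := fun s hs =>
      ⟨by linarith [hs.2], by linarith [hs.1]⟩
    have := key.scomp (h := fun s : ℝ => -s) t (hasDerivAt_neg t).hasDerivWithinAt hmaps'
    simpa [Function.comp_def] using this
  have := hleft.union hright
  rwa [Icc_union_Icc_eq_Icc ht.1 ht.2] at this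

/-! ### Lie derivatives along solutions -/

variable {n : ℕ} {J : State n → ℝ} {F : Fin 2 → Fin n → ℝ → ℝ} {k : Fin n → ℕ}

theorem continuous_dither (m : ℕ) (ε : ℝ) (s : Fin 2) : Continuous fun t => dither m ε t s := by
  fin_cases s <;> simp only [dither, Fin.zero_eta, Fin.mk_one, Matrix.cons_val_zero,
    Matrix.cons_val_one] <;> fun_prop

theorem esField_apply (ε t : ℝ) (x : State n) (i : Fin n) :
    esField J F k ε t x i = F 0 i (J x) * dither (k i) ε t 0 + F 1 i (J x) * dither (k i) ε t 1 := by
  simp [esField, WithLp.ofLp_sum, Finset.sum_apply, Pi.single_apply]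

theorem lieDeriv_genField (F₁ : ℝ → ℝ) (j : Fin n) (f : State n → ℝ) (x : State n) :
    lieDeriv (genField J F₁ j) f x
      = F₁ (J x) * lineDeriv ℝ f x (EuclideanSpace.single j (1 : ℝ)) := by
  rw [lieDeriv, genField, lineDeriv_smul, smul_eq_mul]

/-- The derivative of a function along solutions of the extremum seeking system. -/
noncomputable def lieAlong (J : State n → ℝ) (F : Fin 2 → Fin n → ℝ → ℝ) (k : Fin n → ℕ) (ε t : ℝ)
    (f : State n → ℝ) (x : State n) : ℝ :=
  ∑ j, ∑ p, dither (k j) ε t p * lieDeriv (genField J (F p j) j) f x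

theorem lieAlong_eq_sum_lineDeriv (ε t : ℝ) (f : State n → ℝ) (x : State n) :
    lieAlong J F k ε t f x
      = ∑ j, esField J F k ε t x j * lineDeriv ℝ f x (EuclideanSpace.single j (1 : ℝ)) := by
  simp only [lieAlong, lieDeriv_genField, esField_apply, Fin.sum_univ_two]
  exact Finset.sum_congr rfl fun j _ => by ring

/-- The chain rule along solutions of the extremum seeking system, for a function `f` that need not
be differentiable at `xs`. If a solution visits `xs` at an accumulation point `t` of visiting
times, then its velocity vanishes there, hence so does the sum of Lie derivatives. -/
theorem hasDerivWithinAt_comp_solution {D : Set (State n)} {xs : State n} {ε a b : ℝ}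
    {f : State n → ℝ} {x : ℝ → State n} (hf : ContinuousOn f D)
    (hfd : ∀ y ∈ D \ {xs}, DifferentiableAt ℝ f y)
    (hL : ∀ p j, ContinuousOn (lieDeriv (genField J (F p j) j) f) D)
    (hxD : ∀ t ∈ Icc a b, x t ∈ D)
    (hx : ∀ t ∈ Icc a b, HasDerivWithinAt x (esField J F k ε t (x t)) (Icc a b) t) :
    ∀ t ∈ Icc a b,
      HasDerivWithinAt (fun t => f (x t)) (lieAlong J F k ε t f (x t)) (Icc a b) t := by
  have hxc : ContinuousOn x (Icc a b) := fun t ht => (hx t ht).continuousWithinAt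
  refine hasDerivWithinAt_of_eq_const_on (Z := x ⁻¹' {xs}) (c := f xs) (hf.comp hxc hxD) ?_
    (hxc.preimage_isClosed_of_isClosed isClosed_Icc isClosed_singleton) ?_ ?_ ?_
  · refine continuousOn_finsetSum _ fun j _ => continuousOn_finsetSum _ fun p _ => ?_
    exact (continuous_dither _ _ _).continuousOn.mul ((hL p j).comp hxc hxD)
  · intro s _ hs
    rw [show x s = xs from hs]
  · intro s hs hsZ
    have h1 := (hfd (x s) ⟨hxD s hs, hsZ⟩).hasFDerivAt
    have h2 := h1.comp_hasDerivWithinAt s (hx s hs)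
    have h3 : lieAlong J F k ε s f (x s) = fderiv ℝ f (x s) (esField J F k ε s (x s)) := by
      rw [lieAlong_eq_sum_lineDeriv]
      conv_rhs => rw [← (EuclideanSpace.basisFun (Fin n) ℝ).sum_repr (esField J F k ε s (x s))]
      rw [map_sum]
      refine Finset.sum_congr rfl fun j _ => ?_
      rw [map_smul, EuclideanSpace.basisFun_repr, EuclideanSpace.basisFun_apply, smul_eq_mul,
        (h1.hasLineDerivAt _).lineDeriv]
    rw [h3]
    exact h2
  · intro t ht htZ hacc
    have h1 := hasDerivWithinAt_iff_tendsto_slope.1 (hx t ht)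
    have h2 : esField J F k ε t (x t) = 0 := by
      refine isClosed_singleton.mem_of_frequently_of_tendsto (hacc.mono fun s hs => ?_) h1
      rw [mem_singleton_iff, slope_def_module, show x s = xs from hs, show x t = xs from htZ,
        sub_self, smul_zero]
    rw [lieAlong_eq_sum_lineDeriv, h2]
    simp

end ExtremumSeeking

namespace ExtremumSeeking

/-! ### Integrals of the dithers over one period -/

theorem integral_cos_period {ε : ℝ} (hε : 0 < ε) (a : ℝ) {z : ℤ} (hz : z ≠ 0) :
    ∫ t in a..a + ε, Real.cos (2 * Real.pi * z * t / ε) = 0 := by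
  have hw : (2 * Real.pi * z / ε) ≠ 0 := by
    have : (z : ℝ) ≠ 0 := by exact_mod_cast hz
    have := Real.pi_ne_zero
    positivity
  have hd : ∀ t ∈ uIcc a (a + ε), HasDerivAt
      (fun t => Real.sin (2 * Real.pi * z * t / ε) / (2 * Real.pi * z / ε))
      (Real.cos (2 * Real.pi * z * t / ε)) t := by
    intro t _
    have h1 : HasDerivAt (fun t : ℝ => 2 * Real.pi * z * t / ε) (2 * Real.pi * z / ε) t := by
      have := ((hasDerivAt_id t).const_mul (2 * Real.pi * z)).div_const ε
      simpa using this
    have h2 := (h1.sin).div_const (2 * Real.pi * z / ε)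
    rwa [mul_div_cancel_right₀ _ hw] at h2
  rw [intervalIntegral.integral_eq_sub_of_hasDerivAt hd
    (by apply Continuous.intervalIntegrable; fun_prop)]
  have : 2 * Real.pi * z * (a + ε) / ε = 2 * Real.pi * z * a / ε + z * (2 * Real.pi) := by
    field_simp
  rw [this, Real.sin_add_int_mul_two_pi, sub_self]

theorem integral_sin_period {ε : ℝ} (hε : 0 < ε) (a : ℝ) (z : ℤ) :
    ∫ t in a..a + ε, Real.sin (2 * Real.pi * z * t / ε) = 0 := by
  rcases eq_or_ne z 0 with hz | hz
  · simp [hz]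
  have hw : (2 * Real.pi * z / ε) ≠ 0 := by
    have : (z : ℝ) ≠ 0 := by exact_mod_cast hz
    have := Real.pi_ne_zero
    positivity
  have hd : ∀ t ∈ uIcc a (a + ε), HasDerivAt
      (fun t => -Real.cos (2 * Real.pi * z * t / ε) / (2 * Real.pi * z / ε))
      (Real.sin (2 * Real.pi * z * t / ε)) t := by
    intro t _
    have h1 : HasDerivAt (fun t : ℝ => 2 * Real.pi * z * t / ε) (2 * Real.pi * z / ε) t := by
      have := ((hasDerivAt_id t).const_mul (2 * Real.pi * z)).div_const ε
      simpa using this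
    have h2 := (h1.cos.neg).div_const (2 * Real.pi * z / ε)
    rwa [neg_mul, neg_neg, mul_div_cancel_right₀ _ hw] at h2
  rw [intervalIntegral.integral_eq_sub_of_hasDerivAt hd
    (by apply Continuous.intervalIntegrable; fun_prop)]
  have : 2 * Real.pi * z * (a + ε) / ε = 2 * Real.pi * z * a / ε + z * (2 * Real.pi) := by
    field_simp
  rw [this, Real.cos_add_int_mul_two_pi, sub_self]

theorem integral_cos_mul_cos_period {ε : ℝ} (hε : 0 < ε) (a : ℝ) {m m' : ℕ} (hm : 0 < m) :
    ∫ t in a..a + ε, Real.cos (2 * Real.pi * m * t / ε) * Real.cos (2 * Real.pi * m' * t / ε)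
      = if m = m' then ε / 2 else 0 := by
  have h1 : ∀ t, Real.cos (2 * Real.pi * m * t / ε) * Real.cos (2 * Real.pi * m' * t / ε)
      = (1 / 2) * Real.cos (2 * Real.pi * ((m - m' : ℤ) : ℝ) * t / ε)
        + (1 / 2) * Real.cos (2 * Real.pi * ((m + m' : ℤ) : ℝ) * t / ε) := by
    intro t
    have e1 : 2 * Real.pi * ((m - m' : ℤ) : ℝ) * t / ε
        = 2 * Real.pi * m * t / ε - 2 * Real.pi * m' * t / ε := by push_cast; ring
    have e2 : 2 * Real.pi * ((m + m' : ℤ) : ℝ) * t / ε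
        = 2 * Real.pi * m * t / ε + 2 * Real.pi * m' * t / ε := by push_cast; ring
    rw [e1, e2, Real.cos_sub, Real.cos_add]; ring
  simp_rw [h1]
  rw [intervalIntegral.integral_add (by apply Continuous.intervalIntegrable; fun_prop)
    (by apply Continuous.intervalIntegrable; fun_prop), intervalIntegral.integral_const_mul,
    intervalIntegral.integral_const_mul, integral_cos_period hε a (z := m + m') (by omega)]
  split_ifs with h
  · subst h
    simp; ring
  · rw [integral_cos_period hε a (by omega)]; simp

theorem integral_sin_mul_sin_period {ε : ℝ} (hε : 0 < ε) (a : ℝ) {m m' : ℕ} (hm : 0 < m) :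
    ∫ t in a..a + ε, Real.sin (2 * Real.pi * m * t / ε) * Real.sin (2 * Real.pi * m' * t / ε)
      = if m = m' then ε / 2 else 0 := by
  have h1 : ∀ t, Real.sin (2 * Real.pi * m * t / ε) * Real.sin (2 * Real.pi * m' * t / ε)
      = (1 / 2) * Real.cos (2 * Real.pi * ((m - m' : ℤ) : ℝ) * t / ε)
        - (1 / 2) * Real.cos (2 * Real.pi * ((m + m' : ℤ) : ℝ) * t / ε) := by
    intro t
    have e1 : 2 * Real.pi * ((m - m' : ℤ) : ℝ) * t / ε
        = 2 * Real.pi * m * t / ε - 2 * Real.pi * m' * t / ε := by push_cast; ring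
    have e2 : 2 * Real.pi * ((m + m' : ℤ) : ℝ) * t / ε
        = 2 * Real.pi * m * t / ε + 2 * Real.pi * m' * t / ε := by push_cast; ring
    rw [e1, e2, Real.cos_sub, Real.cos_add]; ring
  simp_rw [h1]
  rw [intervalIntegral.integral_sub (by apply Continuous.intervalIntegrable; fun_prop)
    (by apply Continuous.intervalIntegrable; fun_prop), intervalIntegral.integral_const_mul,
    intervalIntegral.integral_const_mul, integral_cos_period hε a (z := m + m') (by omega)]
  split_ifs with h
  · subst h
    simp; ring
  · rw [integral_cos_period hε a (by omega)]; simp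

theorem integral_sin_mul_cos_period {ε : ℝ} (hε : 0 < ε) (a : ℝ) (m m' : ℕ) :
    ∫ t in a..a + ε, Real.sin (2 * Real.pi * m * t / ε) * Real.cos (2 * Real.pi * m' * t / ε)
      = 0 := by
  have h1 : ∀ t, Real.sin (2 * Real.pi * m * t / ε) * Real.cos (2 * Real.pi * m' * t / ε)
      = (1 / 2) * Real.sin (2 * Real.pi * ((m - m' : ℤ) : ℝ) * t / ε)
        + (1 / 2) * Real.sin (2 * Real.pi * ((m + m' : ℤ) : ℝ) * t / ε) := by
    intro t
    have e1 : 2 * Real.pi * ((m - m' : ℤ) : ℝ) * t / ε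
        = 2 * Real.pi * m * t / ε - 2 * Real.pi * m' * t / ε := by push_cast; ring
    have e2 : 2 * Real.pi * ((m + m' : ℤ) : ℝ) * t / ε
        = 2 * Real.pi * m * t / ε + 2 * Real.pi * m' * t / ε := by push_cast; ring
    rw [e1, e2, Real.sin_sub, Real.sin_add]; ring
  simp_rw [h1]
  rw [intervalIntegral.integral_add (by apply Continuous.intervalIntegrable; fun_prop)
    (by apply Continuous.intervalIntegrable; fun_prop), intervalIntegral.integral_const_mul,
    intervalIntegral.integral_const_mul, integral_sin_period hε, integral_sin_period hε]
  simp

theorem integral_dither_period {ε : ℝ} (hε : 0 < ε) (a : ℝ) {m : ℕ} (hm : 0 < m) (s : Fin 2) :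
    ∫ t in a..a + ε, dither m ε t s = 0 := by
  have hc := integral_cos_period hε a (z := m) (by omega)
  have hs := integral_sin_period hε a m
  push_cast at hc hs
  fin_cases s <;> simp [dither, hc, hs]

theorem integral_dither_zero {ε : ℝ} (hε : 0 < ε) (a t : ℝ) {m : ℕ} (hm : 0 < m) :
    ∫ τ in a..t, dither m ε τ 0 = 2 * √(Real.pi * m / ε) / (2 * Real.pi * m / ε) *
      (Real.sin (2 * Real.pi * m * t / ε) - Real.sin (2 * Real.pi * m * a / ε)) := by
  have hw : (2 * Real.pi * m / ε) ≠ 0 := by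
    have := Real.pi_ne_zero
    positivity
  have hd : ∀ τ ∈ uIcc a t, HasDerivAt (fun t => 2 * √(Real.pi * m / ε) / (2 * Real.pi * m / ε) *
      Real.sin (2 * Real.pi * m * t / ε)) (dither m ε τ 0) τ := by
    intro τ _
    have h1 : HasDerivAt (fun t : ℝ => 2 * Real.pi * m * t / ε) (2 * Real.pi * m / ε) τ := by
      have := ((hasDerivAt_id τ).const_mul (2 * Real.pi * m)).div_const ε
      simpa using this
    have h2 := (h1.sin).const_mul (2 * √(Real.pi * m / ε) / (2 * Real.pi * m / ε))
    have h3 : dither m ε τ 0 = (2 * √(Real.pi * m / ε) / (2 * Real.pi * m / ε)) *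
        (Real.cos (2 * Real.pi * m * τ / ε) * (2 * Real.pi * m / ε)) := by
      simp only [dither, Matrix.cons_val_zero]
      field_simp
    rw [h3]
    exact h2
  rw [intervalIntegral.integral_eq_sub_of_hasDerivAt hd
    ((continuous_dither _ _ _).intervalIntegrable _ _)]
  ring

theorem integral_dither_one {ε : ℝ} (hε : 0 < ε) (a t : ℝ) {m : ℕ} (hm : 0 < m) :
    ∫ τ in a..t, dither m ε τ 1 = -(2 * √(Real.pi * m / ε) / (2 * Real.pi * m / ε)) *
      (Real.cos (2 * Real.pi * m * t / ε) - Real.cos (2 * Real.pi * m * a / ε)) := by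
  have hw : (2 * Real.pi * m / ε) ≠ 0 := by
    have := Real.pi_ne_zero
    positivity
  have hd : ∀ τ ∈ uIcc a t, HasDerivAt (fun t => -(2 * √(Real.pi * m / ε) / (2 * Real.pi * m / ε)) *
      Real.cos (2 * Real.pi * m * t / ε)) (dither m ε τ 1) τ := by
    intro τ _
    have h1 : HasDerivAt (fun t : ℝ => 2 * Real.pi * m * t / ε) (2 * Real.pi * m / ε) τ := by
      have := ((hasDerivAt_id τ).const_mul (2 * Real.pi * m)).div_const ε
      simpa using this
    have h2 := (h1.cos).const_mul (-(2 * √(Real.pi * m / ε) / (2 * Real.pi * m / ε)))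
    have h3 : dither m ε τ 1 = -(2 * √(Real.pi * m / ε) / (2 * Real.pi * m / ε)) *
        (-Real.sin (2 * Real.pi * m * τ / ε) * (2 * Real.pi * m / ε)) := by
      simp only [dither, Matrix.cons_val_one, Matrix.cons_val_fin_one]
      field_simp
    rw [h3]
    exact h2
  rw [intervalIntegral.integral_eq_sub_of_hasDerivAt hd
    ((continuous_dither _ _ _).intervalIntegrable _ _)]
  ring

/-- The antisymmetric form `e₁ ⊗ e₀ - e₀ ⊗ e₁` on the two phases of a dither. -/
def phaseForm (s p : Fin 2) : ℝ := !![0, -1; 1, 0] s p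

/-- The second iterated integrals of the dithers over one period: only the two phases of one and
the same frequency interact, and they sweep the signed area `ε`. -/
theorem integral_dither_mul_integral_dither {ε : ℝ} (hε : 0 < ε) (a : ℝ) {m m' : ℕ} (hm : 0 < m)
    (hm' : 0 < m') (s p : Fin 2) :
    ∫ t in a..a + ε, dither m ε t s * ∫ τ in a..t, dither m' ε τ p
      = if m = m' then ε * phaseForm s p else 0 := by
  have hw : (2 * Real.pi * m' / ε) ≠ 0 := by
    have := Real.pi_ne_zero
    positivity
  have hA : ∀ c : ℝ, 2 * √(Real.pi * m' / ε) * (2 * √(Real.pi * m' / ε) / (2 * Real.pi * m' / ε)) * c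
      = 2 * c := by
    intro c
    have h1 : √(Real.pi * m' / ε) * √(Real.pi * m' / ε) = Real.pi * m' / ε :=
      Real.mul_self_sqrt (by positivity)
    have h2 : 2 * √(Real.pi * m' / ε) * (2 * √(Real.pi * m' / ε) / (2 * Real.pi * m' / ε))
        = 4 * (√(Real.pi * m' / ε) * √(Real.pi * m' / ε)) / (2 * Real.pi * m' / ε) := by ring
    rw [h2, h1]
    have := Real.pi_ne_zero
    field_simp
    ring
  -- the constant of integration does not matter, since the dithers have mean zero
  have key : ∀ (φ : ℝ → ℝ) (B φa : ℝ), Continuous φ → (∀ t, ∫ τ in a..t, dither m' ε τ p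
      = B * (φ t - φa)) → ∫ t in a..a + ε, dither m ε t s * ∫ τ in a..t, dither m' ε τ p
        = B * ∫ t in a..a + ε, dither m ε t s * φ t := by
    intro φ B φa hφ h
    have hc := continuous_dither m ε s
    have h1 : ∀ t, dither m ε t s * ∫ τ in a..t, dither m' ε τ p
        = B * (dither m ε t s * φ t) - (B * φa) * dither m ε t s := fun t => by rw [h t]; ring
    simp_rw [h1]
    have hcφ : Continuous fun t => dither m ε t s * φ t := hc.mul hφ
    rw [intervalIntegral.integral_sub ((hcφ.const_mul B).intervalIntegrable _ _)
      ((hc.const_mul _).intervalIntegrable _ _), intervalIntegral.integral_const_mul,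
      intervalIntegral.integral_const_mul, integral_dither_period hε a hm, mul_zero, sub_zero]
  have hsub : ∀ (A : ℝ) (f g : ℝ → ℝ), ∫ t in a..a + ε, A * f t * g t
      = A * ∫ t in a..a + ε, f t * g t := by
    intro A f g
    rw [← intervalIntegral.integral_const_mul]
    exact intervalIntegral.integral_congr fun t _ => mul_assoc _ _ _
  have hsc := integral_sin_mul_cos_period hε a m m'
  have hcs : ∫ t in a..a + ε, Real.cos (2 * Real.pi * m * t / ε) *
      Real.sin (2 * Real.pi * m' * t / ε) = 0 := by
    rw [← integral_sin_mul_cos_period hε a m' m]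
    exact intervalIntegral.integral_congr fun t _ => mul_comm _ _
  have hcc := integral_cos_mul_cos_period hε a (m' := m') hm
  have hss := integral_sin_mul_sin_period hε a (m' := m') hm
  match p with
  | 0 =>
    rw [key (fun t => Real.sin (2 * Real.pi * m' * t / ε)) _ _ (by fun_prop)
      fun t => integral_dither_zero hε a t hm']
    match s with
    | 0 => simp [dither, hsub, hcs, phaseForm]
    | 1 =>
      simp only [dither, Matrix.cons_val_one, Matrix.cons_val_fin_one, hsub, hss]
      split_ifs with h
      · subst h
        rw [mul_left_comm, ← mul_assoc, hA]; simp [phaseForm]; ring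
      · simp
  | 1 =>
    rw [key (fun t => Real.cos (2 * Real.pi * m' * t / ε)) _ _ (by fun_prop)
      fun t => integral_dither_one hε a t hm']
    match s with
    | 0 =>
      simp only [dither, Matrix.cons_val_zero, hsub, hcc]
      split_ifs with h
      · subst h
        rw [neg_mul, mul_left_comm, ← mul_assoc, hA]; simp [phaseForm]; ring
      · simp
    | 1 => simp [dither, hsub, hsc, phaseForm]

/-! ### Bounds for the dithers -/

variable {n : ℕ} {J : State n → ℝ} {F : Fin 2 → Fin n → ℝ → ℝ} {k : Fin n → ℕ}

theorem inputBound_nonneg (k : Fin n → ℕ) {ε : ℝ} (hε : 0 < ε) : 0 ≤ inputBound k ε := by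
  unfold inputBound
  have := Finset.sum_nonneg fun i (_ : i ∈ Finset.univ) => Real.sqrt_nonneg (k i : ℝ)
  positivity

theorem inputBound_eq (k : Fin n → ℕ) {ε : ℝ} (hε : 0 < ε) :
    inputBound k ε = inputBound k 1 / √ε := by
  unfold inputBound
  rw [Real.rpow_neg hε.le, ← Real.sqrt_eq_rpow, Real.one_rpow]
  ring

theorem inputBound_mul (k : Fin n → ℕ) {ε : ℝ} (hε : 0 < ε) :
    inputBound k ε * ε = inputBound k 1 * √ε := by
  rw [inputBound_eq k hε, div_mul_eq_mul_div, div_eq_iff (Real.sqrt_pos.2 hε).ne', mul_assoc,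
    Real.mul_self_sqrt hε.le]

theorem abs_cos_add_abs_sin_le (θ : ℝ) : |Real.cos θ| + |Real.sin θ| ≤ √2 := by
  refine Real.le_sqrt_of_sq_le ?_
  nlinarith [sq_nonneg (|Real.cos θ| - |Real.sin θ|), sq_abs (Real.cos θ), sq_abs (Real.sin θ),
    Real.sin_sq_add_cos_sq θ]

theorem sum_abs_dither_le (k : Fin n → ℕ) {ε : ℝ} (hε : 0 < ε) (t : ℝ) :
    ∑ j, ∑ p, |dither (k j) ε t p| ≤ inputBound k ε := by
  rw [inputBound_eq k hε, inputBound, Finset.mul_sum, Finset.sum_div]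
  refine Finset.sum_le_sum fun j _ => ?_
  rw [Fin.sum_univ_two]
  simp only [dither, Matrix.cons_val_zero, Matrix.cons_val_one, abs_mul, Nat.abs_ofNat,
    abs_of_nonneg (Real.sqrt_nonneg _), Real.one_rpow, mul_one]
  rw [← mul_add]
  refine (mul_le_mul_of_nonneg_left (abs_cos_add_abs_sin_le _) (by positivity)).trans (le_of_eq ?_)
  rw [Real.sqrt_div (by positivity), Real.sqrt_mul Real.pi_pos.le, Real.sqrt_mul (by norm_num)]
  ring

theorem abs_sum_dither_mul_le (k : Fin n → ℕ) {ε : ℝ} (hε : 0 < ε) (t : ℝ) {C : ℝ}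
    {c : Fin n → Fin 2 → ℝ} (hc : ∀ j p, |c j p| ≤ C) (hC : 0 ≤ C) :
    |∑ j, ∑ p, dither (k j) ε t p * c j p| ≤ inputBound k ε * C := by
  calc |∑ j, ∑ p, dither (k j) ε t p * c j p| ≤ ∑ j, ∑ p, |dither (k j) ε t p| * C := by
        refine (Finset.abs_sum_le_sum_abs _ _).trans (Finset.sum_le_sum fun j _ => ?_)
        refine (Finset.abs_sum_le_sum_abs _ _).trans (Finset.sum_le_sum fun p _ => ?_)
        rw [abs_mul]
        exact mul_le_mul_of_nonneg_left (hc j p) (abs_nonneg _)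
    _ = (∑ j, ∑ p, |dither (k j) ε t p|) * C := by simp only [Finset.sum_mul]
    _ ≤ _ := mul_le_mul_of_nonneg_right (sum_abs_dither_le k hε t) hC

theorem abs_lieAlong_le {ε : ℝ} (hε : 0 < ε) (t : ℝ) {C : ℝ} {f : State n → ℝ} {x : State n}
    (hc : ∀ j p, |lieDeriv (genField J (F p j) j) f x| ≤ C) (hC : 0 ≤ C) :
    |lieAlong J F k ε t f x| ≤ inputBound k ε * C :=
  abs_sum_dither_mul_le k hε t hc hC

theorem norm_sum_dither_smul_le (k : Fin n → ℕ) {ε : ℝ} (hε : 0 < ε) (t : ℝ) {C : ℝ}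
    {c : Fin 2 → Fin n → ℝ} (hc : ∀ s i, |c s i| ≤ C) (hC : 0 ≤ C) :
    ‖∑ i, (c 0 i * dither (k i) ε t 0 + c 1 i * dither (k i) ε t 1) •
      EuclideanSpace.single i (1 : ℝ)‖ ≤ inputBound k ε * C := by
  calc _ ≤ ∑ j, ∑ p, |dither (k j) ε t p| * C := by
        refine (norm_sum_le _ _).trans (Finset.sum_le_sum fun j _ => ?_)
        rw [norm_smul, PiLp.norm_single, norm_one, mul_one, Fin.sum_univ_two,
          Real.norm_eq_abs]
        refine (abs_add_le _ _).trans (add_le_add ?_ ?_) <;>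
        · rw [abs_mul, mul_comm]
          exact mul_le_mul_of_nonneg_left (hc _ j) (abs_nonneg _)
    _ = (∑ j, ∑ p, |dither (k j) ε t p|) * C := by simp only [Finset.sum_mul]
    _ ≤ _ := mul_le_mul_of_nonneg_right (sum_abs_dither_le k hε t) hC

theorem norm_esField_le {ε : ℝ} (hε : 0 < ε) (t : ℝ) {C : ℝ} {x : State n}
    (hc : ∀ s i, |F s i (J x)| ≤ C) (hC : 0 ≤ C) :
    ‖esField J F k ε t x‖ ≤ inputBound k ε * C := by
  unfold esField
  exact norm_sum_dither_smul_le k hε t (c := fun s i => F s i (J x)) hc hC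

end ExtremumSeeking

namespace ExtremumSeeking

/-! ### Expansion of solutions over one period -/

variable {n : ℕ} {J : State n → ℝ} {F : Fin 2 → Fin n → ℝ → ℝ} {k : Fin n → ℕ}
  {D : Set (State n)} {xs : State n}

/-- The `i`-th component of the sum of the Lie brackets `[F_{1j} e_j, F_{2j} e_j]`. Only `j = i`
contributes. -/
noncomputable def bracket (J : State n → ℝ) (F : Fin 2 → Fin n → ℝ → ℝ) (i : Fin n) (x : State n) :
    ℝ :=
  lieDeriv (genField J (F 0 i) i) (fun y => F 1 i (J y)) x
    - lieDeriv (genField J (F 1 i) i) (fun y => F 0 i (J y)) x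

/-- The vector field `x ↦ ∑ i, [F_{1i} e_i, F_{2i} e_i] (x)` that governs the averaged motion. -/
noncomputable def bracketField (J : State n → ℝ) (F : Fin 2 → Fin n → ℝ → ℝ) (x : State n) :
    State n :=
  WithLp.toLp 2 fun i => bracket J F i x

theorem continuousOn_generator (hJ : Continuous J) (hF : ∀ s i, ContinuousOn (F s i) (J '' D))
    (s : Fin 2) (i : Fin n) : ContinuousOn (fun x => F s i (J x)) D :=
  (hF s i).comp hJ.continuousOn (mapsTo_image J D)

theorem AssumptionA3.contDiffAt (h : AssumptionA3 J D xs F) (hD : IsOpen D) (s : Fin 2) (i : Fin n)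
    {x : State n} (hx : x ∈ D \ {xs}) : ContDiffAt ℝ 2 (fun x => F s i (J x)) x :=
  (h.contDiffOn s i).contDiffAt ((hD.sdiff isClosed_singleton).mem_nhds hx)

theorem AssumptionA3.differentiableAt_lieDeriv (h : AssumptionA3 J D xs F) (hD : IsOpen D)
    (s p : Fin 2) (i j : Fin n) {x : State n} (hx : x ∈ D \ {xs}) :
    DifferentiableAt ℝ (lieDeriv (genField J (F p j) j) (fun x => F s i (J x))) x := by
  have h1 := h.contDiffAt hD s i hx
  have h2 : DifferentiableAt ℝ (fderiv ℝ (fun x => F s i (J x))) x :=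
    (h1.fderiv_right (m := 1) (by norm_num)).differentiableAt (by norm_num)
  have h3 : DifferentiableAt ℝ (fun y => F p j (J y) *
      fderiv ℝ (fun x => F s i (J x)) y (EuclideanSpace.single j (1 : ℝ))) x :=
    ((h.contDiffAt hD p j hx).differentiableAt (by norm_num)).mul
      (h2.clm_apply (differentiableAt_const _))
  refine h3.congr_of_eventuallyEq ?_
  filter_upwards [(hD.sdiff isClosed_singleton).mem_nhds hx] with y hy
  rw [lieDeriv_genField,
    (((h.contDiffAt hD s i hy).differentiableAt (by norm_num)).hasFDerivAt.hasLineDerivAt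
      _).lineDeriv]

theorem abs_le_of_hasDerivWithinAt {φ φ' : ℝ → ℝ} {a b C : ℝ} (h0 : φ a = 0)
    (hd : ∀ t ∈ Icc a b, HasDerivWithinAt φ (φ' t) (Icc a b) t) (hC : ∀ t ∈ Icc a b, |φ' t| ≤ C)
    (hC0 : 0 ≤ C) :
    ∀ t ∈ Icc a b, |φ t| ≤ C * (b - a) := by
  intro t ht
  have := norm_image_sub_le_of_norm_deriv_le_segment' hd
    (fun s hs => hC s (Ico_subset_Icc_self hs)) t ht
  rw [h0, sub_zero, Real.norm_eq_abs] at this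
  exact this.trans (mul_le_mul_of_nonneg_left (by linarith [ht.2]) hC0)

/-- Second-order expansion over one period: up to a remainder that is controlled by the third-order
terms along the path, a solution moves by `ε` times the Lie bracket field. -/
theorem abs_period_expansion_le (hD : IsOpen D) (hJ : Continuous J)
    (hF : ∀ s i, ContinuousOn (F s i) (J '' D)) (hA3 : AssumptionA3 J D xs F)
    (hk : ∀ i, 0 < k i) (hk_inj : Function.Injective k) {ε a Q : ℝ} (hε : 0 < ε)
    {x : ℝ → State n} (hxD : ∀ t ∈ Icc a (a + ε), x t ∈ D)
    (hx : ∀ t ∈ Icc a (a + ε), HasDerivWithinAt x (esField J F k ε t (x t)) (Icc a (a + ε)) t)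
    (hQ0 : 0 ≤ Q)
    (hQ : ∀ s p q i j l, ∀ t ∈ Icc a (a + ε), |lieDeriv (genField J (F q l) l)
      (lieDeriv (genField J (F p j) j) (fun y => F s i (J y))) (x t)| ≤ Q) (i : Fin n) :
    |x (a + ε) i - x a i - ε * bracket J F i (x a)| ≤ (inputBound k ε * ε) ^ 3 * Q := by
  set ν := inputBound k ε with hν
  have hν0 : 0 ≤ ν := inputBound_nonneg k hε
  have haa : a ∈ Icc a (a + ε) := ⟨le_rfl, by linarith⟩
  have hbb : a + ε ∈ Icc a (a + ε) := ⟨by linarith, le_rfl⟩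
  set f : Fin 2 → State n → ℝ := fun s y => F s i (J y) with hf
  set Lf : Fin 2 → Fin n → Fin 2 → State n → ℝ := fun s j p =>
    lieDeriv (genField J (F p j) j) (f s) with hLf
  -- first and second iterated integrals of the dithers
  set U : Fin n → Fin 2 → ℝ → ℝ := fun j p t => ∫ τ in a..t, dither (k j) ε τ p with hU
  set W : Fin 2 → Fin n → Fin 2 → ℝ → ℝ := fun s j p t =>
    ∫ τ in a..t, dither (k i) ε τ s * U j p τ with hW
  have hUd : ∀ j p t, HasDerivAt (U j p) (dither (k j) ε t p) t := fun j p t =>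
    intervalIntegral.integral_hasDerivAt_right ((continuous_dither _ _ _).intervalIntegrable _ _)
      ((continuous_dither _ _ _).stronglyMeasurableAtFilter _ _)
      (continuous_dither _ _ _).continuousAt
  have hUc : ∀ j p, Continuous (U j p) := fun j p =>
    continuous_iff_continuousAt.2 fun t => (hUd j p t).continuousAt
  have hWd : ∀ s j p t, HasDerivAt (W s j p) (dither (k i) ε t s * U j p t) t := fun s j p t => by
    have hc : Continuous fun τ => dither (k i) ε τ s * U j p τ :=
      (continuous_dither _ _ _).mul (hUc j p)
    exact intervalIntegral.integral_hasDerivAt_right (hc.intervalIntegrable _ _)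
      (hc.stronglyMeasurableAtFilter _ _) hc.continuousAt
  -- the deviation of the first Lie derivatives from their initial values
  have hq : ∀ s j p, ∀ t ∈ Icc a (a + ε), |Lf s j p (x t) - Lf s j p (x a)| ≤ ν * Q * ε := by
    intro s j p t ht
    have h1 := hasDerivWithinAt_comp_solution (k := k) (hA3.lie_one s p i j).2
      (fun y hy => hA3.differentiableAt_lieDeriv hD s p i j hy)
      (fun q l => (hA3.lie_two s p q i j l).2) hxD hx
    have h2 := abs_le_of_hasDerivWithinAt (φ := fun t => Lf s j p (x t) - Lf s j p (x a))
      (C := ν * Q) (by simp) (fun t ht => (h1 t ht).sub_const _)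
      (fun t ht => abs_lieAlong_le hε t (fun l q => hQ s p q i j l t ht) hQ0) (by positivity) t ht
    rwa [add_sub_cancel_left] at h2
  -- the deviation of the coefficients from their first-order expansions
  have hp : ∀ s, ∀ t ∈ Icc a (a + ε), |f s (x t) - f s (x a)
      - ∑ j, ∑ p, Lf s j p (x a) * U j p t| ≤ ν * (ν * Q * ε) * ε := by
    intro s t ht
    have h1 := hasDerivWithinAt_comp_solution (k := k) (continuousOn_generator hJ hF s i)
      (fun y hy => (hA3.contDiffAt hD s i hy).differentiableAt (by norm_num))
      (fun p j => (hA3.lie_one s p i j).2) hxD hx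
    have h2 := abs_le_of_hasDerivWithinAt
      (φ := fun t => f s (x t) - f s (x a) - ∑ j, ∑ p, Lf s j p (x a) * U j p t)
      (φ' := fun t => ∑ j, ∑ p, dither (k j) ε t p * (Lf s j p (x t) - Lf s j p (x a)))
      (C := ν * (ν * Q * ε)) (by simp [hU]) (fun t ht => ?_)
      (fun t ht => abs_sum_dither_mul_le k hε t (fun j p => hq s j p t ht) (by positivity))
      (by positivity) t ht
    · rwa [add_sub_cancel_left] at h2
    · have h3 : HasDerivAt (fun t => ∑ j, ∑ p, Lf s j p (x a) * U j p t)
          (∑ j, ∑ p, Lf s j p (x a) * dither (k j) ε t p) t :=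
        HasDerivAt.fun_sum fun j _ => HasDerivAt.fun_sum fun p _ => (hUd j p t).const_mul _
      refine (((h1 t ht).sub_const (f s (x a))).sub h3.hasDerivWithinAt).congr_deriv ?_
      simp only [lieAlong, ← Finset.sum_sub_distrib]
      exact Finset.sum_congr rfl fun j _ => Finset.sum_congr rfl fun p _ => by
        simp only [hLf, hf]; ring
  have hy := abs_le_of_hasDerivWithinAt
    (φ := fun t => x t i - x a i - ∑ s, (f s (x a) * U i s t
      + ∑ j, ∑ p, Lf s j p (x a) * W s j p t))
    (φ' := fun t => ∑ s, dither (k i) ε t s * (f s (x t) - f s (x a)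
      - ∑ j, ∑ p, Lf s j p (x a) * U j p t))
    (C := ν * (ν * (ν * Q * ε) * ε)) (by simp [hU, hW]) (fun t ht => ?_) (fun t ht => ?_)
    (by positivity) (a + ε) hbb
  · have hUT : ∀ j p, U j p (a + ε) = 0 := fun j p => integral_dither_period hε a (hk j) p
    have hWT : ∀ s j p, W s j p (a + ε) = if i = j then ε * phaseForm s p else 0 := by
      intro s j p
      rw [hW]
      simp only [hU]
      rw [integral_dither_mul_integral_dither hε a (hk i) (hk j)]
      simp only [hk_inj.eq_iff]
    have hsum : ∑ s, (f s (x a) * U i s (a + ε) + ∑ j, ∑ p, Lf s j p (x a) * W s j p (a + ε))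
        = ε * bracket J F i (x a) := by
      simp only [hUT, hWT, mul_zero, zero_add, mul_ite, Fin.sum_univ_two, bracket, phaseForm]
      simp [hLf, hf]
      ring
    simp only [hsum, add_sub_cancel_left] at hy
    refine hy.trans (le_of_eq ?_)
    ring
  · have h1 : HasDerivWithinAt (fun t => x t i) (esField J F k ε t (x t) i) (Icc a (a + ε)) t :=
      (EuclideanSpace.proj (𝕜 := ℝ) i).hasFDerivAt.comp_hasDerivWithinAt t (hx t ht)
    have h3 : HasDerivAt (fun t => ∑ s, (f s (x a) * U i s t
        + ∑ j, ∑ p, Lf s j p (x a) * W s j p t))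
        (∑ s, (f s (x a) * dither (k i) ε t s
          + ∑ j, ∑ p, Lf s j p (x a) * (dither (k i) ε t s * U j p t))) t :=
      HasDerivAt.fun_sum fun s _ => ((hUd i s t).const_mul _).add
        (HasDerivAt.fun_sum fun j _ => HasDerivAt.fun_sum fun p _ => (hWd s j p t).const_mul _)
    refine ((h1.sub_const (x a i)).sub h3.hasDerivWithinAt).congr_deriv ?_
    have h4 : esField J F k ε t (x t) i = ∑ s, dither (k i) ε t s * f s (x t) := by
      rw [esField_apply, Fin.sum_univ_two]; simp only [hf]; ring
    rw [h4, ← Finset.sum_sub_distrib]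
    refine Finset.sum_congr rfl fun s _ => ?_
    rw [mul_sub, mul_sub, Finset.mul_sum]
    simp only [Finset.mul_sum]
    rw [sub_sub]
    congr 1
    rw [mul_comm (f s (x a))]
    congr 1
    exact Finset.sum_congr rfl fun j _ => Finset.sum_congr rfl fun p _ => by ring
  · have h1 := abs_sum_dither_mul_le k hε t (C := ν * (ν * Q * ε) * ε)
      (c := fun j p => if j = i then f p (x t) - f p (x a)
        - ∑ j, ∑ q, Lf p j q (x a) * U j q t else 0) (fun j p => ?_) (by positivity)
    · simpa using h1
    · split_ifs
      · exact hp p t ht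
      · rw [abs_zero]; positivity

end ExtremumSeeking

namespace ExtremumSeeking

/-! ### The Lie brackets generate a scaled gradient field -/

variable {n : ℕ} {J : State n → ℝ} {F : Fin 2 → Fin n → ℝ → ℝ} {F₀ : Fin n → ℝ → ℝ}
  {k : Fin n → ℕ} {D : Set (State n)} {xs : State n}

theorem gradient_apply {x : State n} (hJ : DifferentiableAt ℝ J x) (i : Fin n) :
    gradient J x i = fderiv ℝ J x (EuclideanSpace.single i (1 : ℝ)) := by
  have h := hJ.hasGradientAt.hasFDerivAt
  rw [h.fderiv, InnerProductSpace.toDual_apply_apply, EuclideanSpace.inner_single_right]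
  simp

theorem fderiv_apply_gradient {x : State n} (hJ : DifferentiableAt ℝ J x) :
    fderiv ℝ J x (gradient J x) = ‖gradient J x‖ ^ 2 := by
  have h := hJ.hasGradientAt.hasFDerivAt
  rw [h.fderiv, InnerProductSpace.toDual_apply_apply, real_inner_self_eq_norm_sq]

theorem continuous_gradient (hJ : ContDiff ℝ 2 J) : Continuous (gradient J) :=
  (InnerProductSpace.toDual ℝ (State n)).symm.continuous.comp (hJ.continuous_fderiv (by norm_num))

theorem differentiable_gradient (hJ : ContDiff ℝ 2 J) : Differentiable ℝ (gradient J) := by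
  have h1 : Differentiable ℝ (fderiv ℝ J) :=
    (hJ.fderiv_right (m := 1) (by norm_num)).differentiable (by norm_num)
  exact (InnerProductSpace.toDual ℝ (State n)).symm.toContinuousLinearEquiv.differentiable.comp h1

theorem continuous_fderiv_gradient (hJ : ContDiff ℝ 2 J) :
    Continuous (fderiv ℝ (gradient J)) := by
  have h1 : ContDiff ℝ 1 (fderiv ℝ J) := hJ.fderiv_right (m := 1) (by norm_num)
  have h2 : ContDiff ℝ 1 (gradient J) :=
    (InnerProductSpace.toDual ℝ (State n)).symm.toContinuousLinearEquiv.contDiff.comp h1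
  exact h2.continuous_fderiv (by norm_num)

theorem AssumptionA3.continuousOn_bracket (h : AssumptionA3 J D xs F) (i : Fin n) :
    ContinuousOn (bracket J F i) D :=
  (h.lie_one 1 0 i i).2.sub (h.lie_one 0 1 i i).2

/-- Off the zeros of `F_{1i}`, the relation `F_{2i} = - F_{1i} Ψ` with `Ψ' = F_{0i} / F_{1i}²`
turns the Lie bracket into a multiple of the gradient. -/
theorem bracket_eq_of_ne_zero (hD : IsOpen D) (hJ : ContDiff ℝ 2 J) (hA3 : AssumptionA3 J D xs F)
    {i : Fin n} (hrel : GeneratingRelation (F₀ i) (F 0 i) (F 1 i) (J '' (D \ {xs})))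
    {x : State n} (hx : x ∈ D \ {xs}) (hne : F 0 i (J x) ≠ 0) :
    bracket J F i x = -(F₀ i (J x) * gradient J x i) := by
  obtain ⟨-, Ψ, hΨ, -⟩ := hrel
  have hopen : IsOpen (D \ {xs}) := hD.sdiff isClosed_singleton
  have hJx : DifferentiableAt ℝ J x := hJ.differentiable (by norm_num) x
  have h0 := ((hA3.contDiffAt hD 0 i hx).differentiableAt (by norm_num)).hasFDerivAt
  have h1 := ((hA3.contDiffAt hD 1 i hx).differentiableAt (by norm_num)).hasFDerivAt
  have hev : (fun y => F 1 i (J y)) =ᶠ[𝓝 x] fun y => -(F 0 i (J y) * Ψ (J y)) := by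
    filter_upwards [hopen.mem_nhds hx, h0.continuousAt.eventually_ne hne] with y hy hy0
    exact (hΨ _ (mem_image_of_mem J hy) hy0).2
  obtain ⟨hΨd, hΨx⟩ := hΨ _ (mem_image_of_mem J hx) hne
  have h2 := (h0.mul (hΨd.comp_hasFDerivAt x hJx.hasFDerivAt)).neg
  have h3 := congrArg (fun T => T (EuclideanSpace.single i (1 : ℝ)))
    (h1.unique (h2.congr_of_eventuallyEq hev))
  simp only [Function.comp_apply, neg_apply, add_apply,
    smul_apply, smul_eq_mul] at h3
  rw [bracket, lieDeriv_genField, lieDeriv_genField, (h1.hasLineDerivAt _).lineDeriv,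
    (h0.hasLineDerivAt _).lineDeriv, h3, hΨx, gradient_apply hJx]
  field_simp
  ring

/-- Two-sided comparison of the Lie brackets with the gradient. At the zeros of `F_{1i}` it follows
by continuity from nearby points on the gradient direction, where `F_{1i}` does not vanish;
`F_{0i}` itself may be discontinuous there. -/
theorem bracket_bounds (hD : IsOpen D) (hJ : ContDiff ℝ 2 J) (hA1 : AssumptionA1 J D xs)
    (hA3 : AssumptionA3 J D xs F) {i : Fin n}
    (hrel : GeneratingRelation (F₀ i) (F 0 i) (F 1 i) (J '' (D \ {xs}))) {m₂ α₁ α₂ : ℝ}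
    (hlow : ∀ x ∈ D \ {xs}, α₁ * (J x - J xs) ^ m₂ ≤ F₀ i (J x))
    (hup : ∀ x ∈ D \ {xs}, F₀ i (J x) ≤ α₂ * (J x - J xs) ^ m₂) (hα₁ : 0 < α₁)
    {x : State n} (hx : x ∈ D \ {xs}) :
    bracket J F i x * gradient J x i ≤ -(α₁ * (J x - J xs) ^ m₂ * gradient J x i ^ 2) ∧
      |bracket J F i x| ≤ α₂ * (J x - J xs) ^ m₂ * |gradient J x i| := by
  have hopen : IsOpen (D \ {xs}) := hD.sdiff isClosed_singleton
  have hoff : ∀ y ∈ D \ {xs}, F 0 i (J y) ≠ 0 →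
      bracket J F i y * gradient J y i ≤ -(α₁ * (J y - J xs) ^ m₂ * gradient J y i ^ 2) ∧
      |bracket J F i y| ≤ α₂ * (J y - J xs) ^ m₂ * |gradient J y i| := by
    intro y hy hne
    have hV : 0 < J y - J xs := sub_pos.2 (hA1.lt y hy)
    have hpos : 0 ≤ F₀ i (J y) := le_trans (by positivity) (hlow y hy)
    rw [bracket_eq_of_ne_zero hD hJ hA3 hrel hy hne]
    constructor
    · have := mul_le_mul_of_nonneg_right (hlow y hy) (sq_nonneg (gradient J y i))
      linarith
    · rw [abs_neg, abs_mul, abs_of_nonneg hpos]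
      exact mul_le_mul_of_nonneg_right (hup y hy) (abs_nonneg _)
  by_cases hz : F 0 i (J x) = 0
  swap
  · exact hoff x hx hz
  set g := gradient J x with hg
  have hg0 : g ≠ 0 := hA1.grad_ne_zero x hx
  have hline : Tendsto (fun s : ℝ => x + s • g) (𝓝[≠] 0) (𝓝 x) := by
    have : Continuous fun s : ℝ => x + s • g := by fun_prop
    have := this.tendsto 0
    simp only [zero_smul, add_zero] at this
    exact this.mono_left nhdsWithin_le_nhds
  have hJd : HasDerivAt (fun s : ℝ => J (x + s • g)) (‖g‖ ^ 2) 0 := by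
    have h1 := (hJ.differentiable (by norm_num) x)
    have h2 := h1.hasFDerivAt.hasLineDerivAt g
    rw [hg, fderiv_apply_gradient h1] at h2
    exact h2
  have hJne : Tendsto (fun s : ℝ => J (x + s • g)) (𝓝[≠] 0) (𝓝[≠] (J x)) := by
    refine tendsto_nhdsWithin_of_tendsto_nhds_of_eventually_within _
      ((hJ.continuous.tendsto x).comp hline) ?_
    exact hJd.eventually_ne (by positivity)
  have hev : ∀ᶠ s : ℝ in 𝓝[≠] 0, x + s • g ∈ D \ {xs} ∧ F 0 i (J (x + s • g)) ≠ 0 :=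
    (hline.eventually (hopen.mem_nhds hx)).and
      (hJne.eventually (hrel.1 (J x) (mem_image_of_mem J hx) hz))
  have hB : Tendsto (fun s : ℝ => bracket J F i (x + s • g)) (𝓝[≠] 0) (𝓝 (bracket J F i x)) :=
    ((hA3.continuousOn_bracket i).continuousAt (hD.mem_nhds hx.1)).tendsto.comp hline
  have hG : Tendsto (fun s : ℝ => gradient J (x + s • g) i) (𝓝[≠] 0) (𝓝 (gradient J x i)) :=
    (((EuclideanSpace.proj (𝕜 := ℝ) i).continuous.comp (continuous_gradient hJ)).tendsto x).comp
      hline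
  have hP : Tendsto (fun s : ℝ => (J (x + s • g) - J xs) ^ m₂) (𝓝[≠] 0)
      (𝓝 ((J x - J xs) ^ m₂)) :=
    (((hJ.continuous.tendsto x).comp hline).sub_const (J xs)).rpow_const
      (Or.inl (sub_pos.2 (hA1.lt x hx)).ne')
  constructor
  · refine le_of_tendsto_of_tendsto (hB.mul hG) ((hP.const_mul α₁).mul (hG.pow 2)).neg ?_
    filter_upwards [hev] with s hs
    exact (hoff _ hs.1 hs.2).1
  · refine le_of_tendsto_of_tendsto hB.abs ((hP.const_mul α₂).mul hG.abs) ?_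
    filter_upwards [hev] with s hs
    exact (hoff _ hs.1 hs.2).2

theorem bracketField_bounds {x : State n} {A₁ A₂ : ℝ} (hA₂ : 0 ≤ A₂)
    (h : ∀ i, bracket J F i x * gradient J x i ≤ -(A₁ * gradient J x i ^ 2) ∧
      |bracket J F i x| ≤ A₂ * |gradient J x i|) :
    inner ℝ (gradient J x) (bracketField J F x) ≤ -(A₁ * ‖gradient J x‖ ^ 2) ∧
      ‖bracketField J F x‖ ≤ A₂ * ‖gradient J x‖ := by
  constructor
  · rw [PiLp.inner_apply, EuclideanSpace.real_norm_sq_eq, Finset.mul_sum, ← Finset.sum_neg_distrib]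
    refine Finset.sum_le_sum fun i _ => ?_
    simpa [bracketField] using (h i).1
  · refine le_of_sq_le_sq ?_ (by positivity)
    rw [mul_pow, EuclideanSpace.real_norm_sq_eq, EuclideanSpace.real_norm_sq_eq, Finset.mul_sum]
    refine Finset.sum_le_sum fun i _ => ?_
    have := pow_le_pow_left₀ (abs_nonneg _) (h i).2 2
    rw [mul_pow, sq_abs, sq_abs] at this
    exact this

/-! ### One-step estimate for the cost function -/

theorem le_add_inner_gradient_add (hJ : ContDiff ℝ 2 J) {x y : State n} {Λ : ℝ}
    (hΛ : ∀ z ∈ segment ℝ x y, ‖fderiv ℝ (gradient J) z‖ ≤ Λ) :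
    J y ≤ J x + inner ℝ (gradient J x) (y - x) + Λ * ‖y - x‖ ^ 2 := by
  have hΛ0 : 0 ≤ Λ := (norm_nonneg _).trans (hΛ x (left_mem_segment ℝ x y))
  have hg : ∀ z ∈ segment ℝ x y, ‖gradient J z - gradient J x‖ ≤ Λ * ‖y - x‖ := by
    intro z hz
    have h1 := (convex_segment x y).norm_image_sub_le_of_norm_fderiv_le (f := gradient J)
      (fun w _ => differentiable_gradient hJ w) hΛ (left_mem_segment ℝ x y) hz
    refine h1.trans (mul_le_mul_of_nonneg_left ?_ hΛ0)
    obtain ⟨θ, hθ, rfl⟩ := (segment_eq_image' ℝ x y ▸ hz)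
    rw [add_sub_cancel_left, norm_smul, Real.norm_eq_abs, abs_of_nonneg hθ.1]
    exact mul_le_of_le_one_left (norm_nonneg _) hθ.2
  have hd : ∀ z ∈ segment ℝ x y, HasFDerivWithinAt
      (fun z => J z - inner ℝ (gradient J x) z)
      (InnerProductSpace.toDual ℝ (State n) (gradient J z - gradient J x)) (segment ℝ x y) z := by
    intro z _
    have h1 := (hJ.differentiable (by norm_num) z).hasGradientAt.hasFDerivAt
    have h2 := (InnerProductSpace.toDual ℝ (State n) (gradient J x)).hasFDerivAt (x := z)
    have h3 := (h1.sub h2).hasFDerivWithinAt (s := segment ℝ x y)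
    rw [← map_sub] at h3
    exact h3
  have h := (convex_segment x y).norm_image_sub_le_of_norm_hasFDerivWithin_le hd
    (fun z hz => by rw [LinearIsometryEquiv.norm_map]; exact hg z hz)
    (left_mem_segment ℝ x y) (right_mem_segment ℝ x y)
  have h4 := (le_abs_self _).trans h
  rw [inner_sub_right]
  nlinarith [h4]

/-- Decrease of the cost function over one period, in terms of bounds `A₁`, `A₂` for the averaged
field, `Q` for the third-order terms along the path and `Λ` for the Hessian. -/
theorem period_decrease (hD : IsOpen D) (hJ : ContDiff ℝ 2 J)
    (hF : ∀ s i, ContinuousOn (F s i) (J '' D)) (hA3 : AssumptionA3 J D xs F)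
    (hk : ∀ i, 0 < k i) (hk_inj : Function.Injective k) {ε a Q Λ A₁ A₂ : ℝ} (hε : 0 < ε)
    {x : ℝ → State n} (hxD : ∀ t ∈ Icc a (a + ε), x t ∈ D)
    (hx : ∀ t ∈ Icc a (a + ε), HasDerivWithinAt x (esField J F k ε t (x t)) (Icc a (a + ε)) t)
    (hQ0 : 0 ≤ Q)
    (hQ : ∀ s p q i j l, ∀ t ∈ Icc a (a + ε), |lieDeriv (genField J (F q l) l)
      (lieDeriv (genField J (F p j) j) (fun y => F s i (J y))) (x t)| ≤ Q)
    (hΛ : ∀ z ∈ segment ℝ (x a) (x (a + ε)), ‖fderiv ℝ (gradient J) z‖ ≤ Λ) (hA₂ : 0 ≤ A₂)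
    (hB : ∀ i, bracket J F i (x a) * gradient J (x a) i ≤ -(A₁ * gradient J (x a) i ^ 2) ∧
      |bracket J F i (x a)| ≤ A₂ * |gradient J (x a) i|) :
    J (x (a + ε)) ≤ J (x a) - ε * (A₁ * ‖gradient J (x a)‖ ^ 2)
      + ‖gradient J (x a)‖ * (n * ((inputBound k 1 * √ε) ^ 3 * Q))
      + Λ * (ε * (A₂ * ‖gradient J (x a)‖) + n * ((inputBound k 1 * √ε) ^ 3 * Q)) ^ 2 := by
  have hΛ0 : 0 ≤ Λ := (norm_nonneg _).trans (hΛ _ (left_mem_segment ℝ _ _))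
  obtain ⟨hB1, hB2⟩ := bracketField_bounds hA₂ hB
  set R : State n := x (a + ε) - x a - ε • bracketField J F (x a) with hR
  have hRn : ‖R‖ ≤ n * ((inputBound k 1 * √ε) ^ 3 * Q) := by
    have h1 : ∀ i, |R i| ≤ (inputBound k 1 * √ε) ^ 3 * Q := by
      intro i
      rw [← inputBound_mul k hε]
      have := abs_period_expansion_le hD hJ.continuous hF hA3 hk hk_inj hε hxD hx hQ0 hQ i
      simpa [hR, bracketField] using this
    rw [← (EuclideanSpace.basisFun (Fin n) ℝ).sum_repr R]
    refine (norm_sum_le _ _).trans ?_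
    refine (Finset.sum_le_sum fun i _ => ?_).trans (by
      rw [Finset.sum_const, Finset.card_univ, Fintype.card_fin, nsmul_eq_mul])
    rw [norm_smul, EuclideanSpace.basisFun_repr, EuclideanSpace.basisFun_apply,
      PiLp.norm_single, norm_one, mul_one, Real.norm_eq_abs]
    exact h1 i
  have hdiff : x (a + ε) - x a = ε • bracketField J F (x a) + R := by rw [hR]; abel
  have h1 := le_add_inner_gradient_add hJ hΛ
  have h2 : inner ℝ (gradient J (x a)) (x (a + ε) - x a)
      ≤ - (ε * (A₁ * ‖gradient J (x a)‖ ^ 2))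
        + ‖gradient J (x a)‖ * (n * ((inputBound k 1 * √ε) ^ 3 * Q)) := by
    rw [hdiff, inner_add_right, inner_smul_right]
    refine add_le_add ?_ ?_
    · have := mul_le_mul_of_nonneg_left hB1 hε.le
      linarith
    · exact (real_inner_le_norm _ _).trans (mul_le_mul_of_nonneg_left hRn (norm_nonneg _))
  have h3 : ‖x (a + ε) - x a‖
      ≤ ε * (A₂ * ‖gradient J (x a)‖) + n * ((inputBound k 1 * √ε) ^ 3 * Q) := by
    rw [hdiff]
    refine (norm_add_le _ _).trans (add_le_add ?_ hRn)
    rw [norm_smul, Real.norm_eq_abs, abs_of_pos hε]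
    exact mul_le_mul_of_nonneg_left hB2 hε.le
  have h4 := mul_le_mul_of_nonneg_left (pow_le_pow_left₀ (norm_nonneg _) h3 2) hΛ0
  linarith

end ExtremumSeeking

namespace ExtremumSeeking

/-! ### The scalar comparison equation -/

/-- The solution at time `s` of the comparison equation `v' = - v ^ (1 + m)` starting from `v`. -/
noncomputable def comparison (m v s : ℝ) : ℝ :=
  if m = 0 then v * Real.exp (-s) else v * (1 + m * s * v ^ m) ^ (-1 / m)

variable {m v v₀ s τ : ℝ}

theorem comparison_nonneg (hm : 0 ≤ m) (hv : 0 ≤ v) (hs : 0 ≤ s) : 0 ≤ comparison m v s := by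
  unfold comparison
  split_ifs <;> positivity

theorem comparison_zero_right (m v : ℝ) : comparison m v 0 = v := by
  unfold comparison
  split_ifs <;> simp

theorem comparison_antitone (hm : 0 ≤ m) (hv : 0 ≤ v) (hs : 0 ≤ s) (hst : s ≤ τ) :
    comparison m v τ ≤ comparison m v s := by
  unfold comparison
  split_ifs with h
  · gcongr
  · have hm' : 0 < m := lt_of_le_of_ne hm (Ne.symm h)
    refine mul_le_mul_of_nonneg_left ?_ hv
    refine Real.rpow_le_rpow_of_nonpos (by positivity) (by gcongr) ?_
    exact div_nonpos_of_nonpos_of_nonneg (by norm_num) hm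

theorem comparison_le (hm : 0 ≤ m) (hv : 0 ≤ v) (hs : 0 ≤ s) : comparison m v s ≤ v := by
  have := comparison_antitone hm hv le_rfl hs
  rwa [comparison_zero_right] at this

/-- The substitution `v ↦ v ^ (-m)` makes the comparison equation linear in time. -/
theorem comparison_rpow_neg (hm : 0 < m) (hv : 0 < v) (hs : 0 ≤ s) :
    comparison m v s ^ (-m) = v ^ (-m) + m * s := by
  have h1 : 0 < 1 + m * s * v ^ m := by positivity
  rw [comparison, if_neg hm.ne', Real.mul_rpow hv.le (by positivity), ← Real.rpow_mul h1.le,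
    show -1 / m * -m = 1 by field_simp, Real.rpow_one, mul_add, mul_one, Real.rpow_neg hv.le]
  field_simp

/-- A bound for the comparison solution that does not depend on its initial value. -/
theorem comparison_le_rpow (hm : 0 < m) (hv : 0 ≤ v) (hs : 0 < s) :
    comparison m v s ≤ (m * s) ^ (-1 / m) := by
  rcases hv.eq_or_lt with h | h
  · rw [← h, comparison, if_neg hm.ne', zero_mul]; positivity
  have h0 : 0 < comparison m v s := by rw [comparison, if_neg hm.ne']; positivity
  rw [← Real.rpow_le_rpow_iff_of_neg (z := -m) (by positivity) h0 (by linarith),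
    comparison_rpow_neg hm h hs.le, ← Real.rpow_mul (by positivity),
    show -1 / m * -m = 1 by field_simp, Real.rpow_one]
  have : 0 < v ^ (-m) := by positivity
  linarith

/-- An Euler step of size `τ` for the comparison equation stays below its solution. -/
theorem sub_mul_rpow_le_comparison (hm : 0 ≤ m) (hv₀ : 0 ≤ v₀) (hs : 0 ≤ s) (hτ : 0 ≤ τ)
    (hv : 0 ≤ v) (hle : v ≤ comparison m v₀ s) :
    v - τ * v ^ (1 + m) ≤ comparison m v₀ (s + τ) := by
  have hnn := comparison_nonneg hm hv₀ (add_nonneg hs hτ)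
  rcases hv.eq_or_lt with hv0 | hvpos
  · rw [← hv0, Real.zero_rpow (by linarith)]; simpa using hnn
  rcases hm.eq_or_lt with hm0 | hmpos
  · subst hm0
    simp only [comparison, if_true, add_zero, Real.rpow_one] at hle ⊢
    rw [neg_add, Real.exp_add, ← mul_assoc]
    calc v - τ * v = v * (1 - τ) := by ring
      _ ≤ v * Real.exp (-τ) := by
          gcongr
          have := Real.add_one_le_exp (-τ)
          linarith
      _ ≤ _ := by gcongr
  rcases hv₀.eq_or_lt with hv00 | hv0pos
  · rw [← hv00, comparison, if_neg hmpos.ne', zero_mul] at hle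
    exact absurd hle (not_le.2 hvpos)
  rcases le_or_gt (v - τ * v ^ (1 + m)) 0 with hw | hw
  · exact hw.trans hnn
  have hΦ : 0 < comparison m v₀ s := hvpos.trans_le hle
  have hΦ' : 0 < comparison m v₀ (s + τ) := by
    rw [comparison, if_neg hmpos.ne']; positivity
  rw [← Real.rpow_le_rpow_iff_of_neg (z := -m) hΦ' hw (by linarith),
    comparison_rpow_neg hmpos hv0pos (add_nonneg hs hτ)]
  have h1 : v₀ ^ (-m) + m * s ≤ v ^ (-m) := by
    rw [← comparison_rpow_neg hmpos hv0pos hs]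
    exact (Real.rpow_le_rpow_iff_of_neg hΦ hvpos (by linarith)).2 hle
  have hfac : v - τ * v ^ (1 + m) = v * (1 - τ * v ^ m) := by
    rw [Real.rpow_add hvpos, Real.rpow_one]; ring
  have ha : 0 < 1 - τ * v ^ m := by
    rw [hfac] at hw
    exact (mul_pos_iff_of_pos_left hvpos).1 hw
  have h2 : 1 + m * (τ * v ^ m) ≤ (1 - τ * v ^ m) ^ (-m) := by
    rw [Real.rpow_def_of_pos ha]
    have hlog : Real.log (1 - τ * v ^ m) ≤ -(τ * v ^ m) := by
      have := Real.log_le_sub_one_of_pos ha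
      linarith
    have := Real.add_one_le_exp (Real.log (1 - τ * v ^ m) * -m)
    nlinarith
  have h3 : v ^ (-m) * (m * (τ * v ^ m)) = m * τ := by
    rw [Real.rpow_neg hvpos.le]; field_simp
  rw [hfac, Real.mul_rpow hvpos.le ha.le]
  have h4 := mul_le_mul_of_nonneg_left h2 (by positivity : 0 ≤ v ^ (-m))
  rw [mul_add, mul_one, h3] at h4
  linarith

/-- The comparison solution gives the decay function, after the power bound on the cost function has
been inverted. -/
theorem comparison_div_rpow {m₁ γ : ℝ} (hm₁ : 0 < m₁) (hγ : 0 < γ) (hm : 0 ≤ m) (hv : 0 ≤ v)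
    (hs : 0 ≤ s) : (comparison m v s / γ) ^ (1 / (2 * m₁))
      = (v / γ) ^ (1 / (2 * m₁)) * decayFun m₁ m v s := by
  unfold comparison decayFun
  split_ifs with h
  · rw [mul_div_right_comm, Real.mul_rpow (by positivity) (Real.exp_pos _).le, ← Real.exp_mul]
    congr 2
    ring
  · have hm' : 0 < m := lt_of_le_of_ne hm (Ne.symm h)
    have h1 : 0 < 1 + m * s * v ^ m := by positivity
    rw [mul_div_right_comm, Real.mul_rpow (by positivity) (by positivity), ← Real.rpow_mul h1.le]
    congr 2
    field_simp

/-! ### Solutions stay in a ball over one period -/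

variable {n : ℕ} {J : State n → ℝ} {F : Fin 2 → Fin n → ℝ → ℝ} {k : Fin n → ℕ} {xs : State n}

/-- A solution that starts at distance `r` from `xs` cannot leave `closedBall xs δ₀` within a time in
which the bound `G` on the speed in that ball does not allow it to travel the distance `δ₀ - r`. -/
theorem mem_closedBall_of_norm_lt {g : ℝ → State n → State n} {x : ℝ → State n}
    {a b r δ₀ G : ℝ} (hg : ∀ t, ∀ y ∈ Metric.closedBall xs δ₀, ‖g t y‖ < G)
    (hG : G * (b - a) ≤ δ₀ - r) (hG0 : 0 < G) (hr : ‖x a - xs‖ ≤ r)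
    (hx : ∀ t ∈ Icc a b, HasDerivWithinAt x (g t (x t)) (Icc a b) t) :
    ∀ t ∈ Icc a b, ‖x t - x a‖ ≤ G * (t - a) ∧ x t ∈ Metric.closedBall xs δ₀ := by
  have hball : ∀ t ∈ Icc a b, ‖x t - x a‖ ≤ G * (t - a) → x t ∈ Metric.closedBall xs δ₀ := by
    intro t ht h
    rw [mem_closedBall_iff_norm]
    have h1 : ‖x t - xs‖ ≤ ‖x t - x a‖ + ‖x a - xs‖ := norm_sub_le_norm_sub_add_norm_sub _ _ _
    have h2 : G * (t - a) ≤ G * (b - a) := by gcongr; exact ht.2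
    linarith
  have key : ∀ ⦃t⦄, t ∈ Icc a b → ‖x t - x a‖ ≤ G * (t - a) := by
    refine image_norm_le_of_norm_deriv_right_lt_deriv_boundary' (f := fun t => x t - x a)
      (f' := fun t => g t (x t)) (B' := fun _ => G)
      (fun t ht => ((hx t ht).continuousWithinAt).sub continuousWithinAt_const)
      (fun t ht => ?_) (by simp) (by fun_prop) (fun t _ => ?_) (fun t ht heq => ?_)
    · exact ((hx t (Ico_subset_Icc_self ht)).sub_const _).mono_of_mem_nhdsWithin
        (Icc_mem_nhdsGE_of_mem ht)
    · have := (((hasDerivAt_id t).sub_const a).const_mul G)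
      rw [mul_one] at this
      exact this.hasDerivWithinAt
    · exact hg t _ (hball t (Ico_subset_Icc_self ht) heq.le)
  exact fun t ht => ⟨key ht, hball t ht (key ht)⟩

/-! ### Iteration over periods -/

/-- Over each period that a solution spends in `closedBall xs δ₀`, the cost function decreases at
least as in an Euler step of size `ε` for `v' = - lam v ^ (1 + m)`, or ends below the level `θ`. -/
def PeriodDecrease (J : State n → ℝ) (F : Fin 2 → Fin n → ℝ → ℝ) (k : Fin n → ℕ) (xs : State n)
    (δ₀ ε lam m θ : ℝ) : Prop :=
  ∀ (a : ℝ) (x : ℝ → State n), (∀ t ∈ Icc a (a + ε), x t ∈ Metric.closedBall xs δ₀) →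
    (∀ t ∈ Icc a (a + ε), HasDerivWithinAt x (esField J F k ε t (x t)) (Icc a (a + ε)) t) →
    J (x (a + ε)) - J xs
      ≤ max ((J (x a) - J xs) - ε * lam * (J (x a) - J xs) ^ (1 + m)) θ

/-- Iteration of `PeriodDecrease` along a solution of a vector field `g` that agrees with the
extremum seeking field on `closedBall xs δ₀`. The time `a` is the start of the period of `t`. -/
theorem exists_period_start {g : ℝ → State n → State n} {ε lam θ δ₀ r G vr t₀ T : ℝ} (hε : 0 < ε)
    (hlam : 0 ≤ lam) (hm : 0 ≤ m) (hG0 : 0 < G)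
    (hgeq : ∀ t, ∀ y ∈ Metric.closedBall xs δ₀, g t y = esField J F k ε t y)
    (hg : ∀ t, ∀ y ∈ Metric.closedBall xs δ₀, ‖g t y‖ < G) (hG : G * ε ≤ δ₀ - r)
    (hstep : PeriodDecrease J F k xs δ₀ ε lam m θ)
    (hV0 : ∀ y ∈ Metric.closedBall xs δ₀, 0 ≤ J y - J xs)
    (hVr : ∀ y ∈ Metric.closedBall xs δ₀, J y - J xs ≤ vr → ‖y - xs‖ ≤ r) (hθ : θ ≤ vr)
    {x : ℝ → State n} (hx0 : x t₀ ∈ Metric.closedBall xs δ₀) (hxv : J (x t₀) - J xs ≤ vr)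
    (hx : ∀ t ∈ Icc t₀ T, HasDerivWithinAt x (g t (x t)) (Icc t₀ T) t) :
    ∀ t ∈ Icc t₀ T, ∃ a ∈ Icc t₀ t, t ≤ a + ε ∧ x a ∈ Metric.closedBall xs δ₀ ∧
      J (x a) - J xs
        ≤ max (comparison m (J (x t₀) - J xs) (lam * max (t - t₀ - ε) 0)) θ ∧
      (∀ s ∈ Icc a t, x s ∈ Metric.closedBall xs δ₀) ∧ ‖x t - x a‖ ≤ G * ε := by
  set V0 := J (x t₀) - J xs with hV0def
  have hV00 : 0 ≤ V0 := hV0 _ hx0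
  have hcmp_vr : ∀ s, 0 ≤ s → max (comparison m V0 s) θ ≤ vr := fun s hs =>
    max_le ((comparison_le hm hV00 hs).trans hxv) hθ
  have htrap : ∀ a b, t₀ ≤ a → b ≤ T → b ≤ a + ε → x a ∈ Metric.closedBall xs δ₀ →
      J (x a) - J xs ≤ vr → ∀ t ∈ Icc a b, ‖x t - x a‖ ≤ G * (t - a) ∧
        x t ∈ Metric.closedBall xs δ₀ := by
    intro a b ha hb hab hxa hva
    rcases le_or_gt a b with h | h
    · refine mem_closedBall_of_norm_lt hg (le_trans ?_ hG) hG0 (hVr _ hxa hva)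
        fun t ht => (hx t ⟨ha.trans ht.1, ht.2.trans hb⟩).mono (Icc_subset_Icc ha hb)
      gcongr; linarith
    · intro t ht; exact absurd (ht.1.trans ht.2) (not_le.2 h)
  have hind : ∀ j : ℕ, t₀ + j * ε ≤ T → x (t₀ + j * ε) ∈ Metric.closedBall xs δ₀ ∧
      J (x (t₀ + j * ε)) - J xs ≤ max (comparison m V0 (lam * (j * ε))) θ := by
    intro j
    induction j with
    | zero =>
      intro _
      simp only [Nat.cast_zero, zero_mul, add_zero, mul_zero, comparison_zero_right]
      exact ⟨hx0, le_max_left _ _⟩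
    | succ j ih =>
      intro hj
      have hjε : 0 ≤ (j : ℝ) * ε := by positivity
      have hnext : t₀ + (j + 1 : ℕ) * ε = t₀ + j * ε + ε := by push_cast; ring
      rw [hnext] at hj ⊢
      obtain ⟨h1, h2⟩ := ih (by linarith)
      have h3 := htrap (t₀ + j * ε) (t₀ + j * ε + ε) (by linarith) hj le_rfl h1
        (h2.trans (hcmp_vr _ (by positivity)))
      have hK : ∀ t ∈ Icc (t₀ + j * ε) (t₀ + j * ε + ε), x t ∈ Metric.closedBall xs δ₀ :=
        fun t ht => (h3 t ht).2
      refine ⟨hK _ ⟨by linarith, le_rfl⟩, ?_⟩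
      have h4 := hstep (t₀ + j * ε) x hK fun t ht => by
        rw [← hgeq t _ (hK t ht)]
        exact (hx t ⟨by linarith [ht.1], ht.2.trans hj⟩).mono
          (Icc_subset_Icc (by linarith) hj)
      refine h4.trans (max_le ?_ (le_max_right _ _))
      rcases le_max_iff.1 h2 with h5 | h5
      · refine le_trans ?_ (le_max_left _ _)
        have := sub_mul_rpow_le_comparison hm hV00 (by positivity) (by positivity : 0 ≤ ε * lam)
          (hV0 _ h1) h5
        refine this.trans (le_of_eq ?_)
        congr 1; push_cast; ring
      · refine le_trans ?_ (le_max_right _ _)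
        have : 0 ≤ ε * lam * (J (x (t₀ + j * ε)) - J xs) ^ (1 + m) :=
          mul_nonneg (by positivity) (Real.rpow_nonneg (hV0 _ h1) _)
        linarith
  intro t ht
  set j := ⌊(t - t₀) / ε⌋₊ with hj
  have htt : 0 ≤ (t - t₀) / ε := div_nonneg (sub_nonneg.2 ht.1) hε.le
  have hj1 : j * ε ≤ t - t₀ := (le_div_iff₀ hε).1 (Nat.floor_le htt)
  have hj2 : t - t₀ < (j + 1) * ε := (div_lt_iff₀ hε).1 (Nat.lt_floor_add_one _)
  have hjε : 0 ≤ (j : ℝ) * ε := by positivity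
  obtain ⟨h1, h2⟩ := hind j (by linarith [ht.2])
  have h3 := htrap (t₀ + j * ε) t (by linarith) ht.2 (by linarith) h1
    (h2.trans (hcmp_vr _ (by positivity)))
  refine ⟨t₀ + j * ε, ⟨by linarith, by linarith⟩, by linarith, h1, ?_, fun s hs => (h3 s hs).2, ?_⟩
  · refine h2.trans (max_le_max ?_ le_rfl)
    refine comparison_antitone hm hV00 (by positivity) ?_
    refine mul_le_mul_of_nonneg_left (max_le (by linarith) hjε) hlam
  · refine (h3 t ⟨by linarith, le_rfl⟩).1.trans ?_
    gcongr; linarith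

end ExtremumSeeking

namespace ExtremumSeeking

/-! ### Existence of solutions and their values at the starts of periods -/

variable {n : ℕ} {J : State n → ℝ} {F : Fin 2 → Fin n → ℝ → ℝ} {k : Fin n → ℕ} {xs : State n}
  {F₀ : Fin n → ℝ → ℝ} {D : Set (State n)}

/-- If the cost function decreases over periods, then solutions starting in a sublevel set are
global, and at time `t` a solution is close to its value at the start `a` of the period of `t`,
which obeys the comparison estimate. -/
theorem hasGlobalSolution_and_exists_period_start {ε lam m θ δ₀ r C vr : ℝ} (hε : 0 < ε)
    (hlam : 0 ≤ lam) (hm : 0 ≤ m) (hC0 : 0 ≤ C)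
    (hFc : ∀ s i, ContinuousOn (fun y => F s i (J y)) (Metric.closedBall xs δ₀))
    (hC : ∀ s i, ∀ y ∈ Metric.closedBall xs δ₀, |F s i (J y)| ≤ C)
    (hG : (inputBound k 1 * C + 1) * √ε ≤ δ₀ - r)
    (hstep : PeriodDecrease J F k xs δ₀ ε lam m θ)
    (hV0 : ∀ y ∈ Metric.closedBall xs δ₀, 0 ≤ J y - J xs)
    (hVr : ∀ y ∈ Metric.closedBall xs δ₀, J y - J xs ≤ vr → ‖y - xs‖ ≤ r) (hθ : θ ≤ vr)
    (t₀ : ℝ) {x₀ : State n} (hx0 : x₀ ∈ Metric.closedBall xs δ₀) (hxv : J x₀ - J xs ≤ vr) :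
    HasGlobalSolution (esField J F k ε) t₀ x₀ ∧
    ∀ I x, IsSolution (esField J F k ε) t₀ x₀ I x → ∀ t ∈ I, ∃ a ∈ Icc t₀ t, t ≤ a + ε ∧
      x a ∈ Metric.closedBall xs δ₀ ∧
      J (x a) - J xs ≤ max (comparison m (J x₀ - J xs) (lam * max (t - t₀ - ε) 0)) θ ∧
      (∀ s ∈ Icc a t, x s ∈ Metric.closedBall xs δ₀) ∧
      ‖x t - x a‖ ≤ (inputBound k 1 * C + 1) * √ε ∧
      ∀ s ∈ Icc a t, HasDerivWithinAt x (esField J F k ε s (x s)) (Icc a t) s := by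
  -- the summand `1 / √ε` makes the speed bound strict, and `G * ε` is of order `√ε`
  set G := inputBound k ε * C + 1 / √ε with hGdef
  have hsq : 0 < √ε := Real.sqrt_pos.2 hε
  have hν := inputBound_nonneg k hε
  have hGpos : 0 < G := by positivity
  have hGε : G * ε = (inputBound k 1 * C + 1) * √ε := by
    have h1 := inputBound_mul k hε
    have h2 : 1 / √ε * ε = √ε := by
      rw [one_div, inv_mul_eq_div, Real.div_sqrt]
    rw [hGdef, add_mul, h2, mul_right_comm, h1]; ring
  have hlt : inputBound k ε * C < G := by
    have : 0 < 1 / √ε := by positivity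
    linarith
  constructor
  · -- extend the coefficients continuously to the whole space and apply Peano's theorem
    have hext : ∀ s i, ∃ h : C(State n, ℝ), (∀ y, h y ∈ Icc (-C) C) ∧
        ∀ y ∈ Metric.closedBall xs δ₀, h y = F s i (J y) := by
      intro s i
      obtain ⟨h, h1, h2⟩ := ContinuousMap.exists_restrict_eq_forall_mem_of_closed
        (⟨_, (hFc s i).domRestrict⟩ : C(Metric.closedBall xs δ₀, ℝ)) (t := Icc (-C) C)
        (fun y => abs_le.1 (hC s i y y.2)) ⟨0, by linarith, hC0⟩ Metric.isClosed_closedBall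
      exact ⟨h, h1, fun y hy => DFunLike.congr_fun h2 ⟨y, hy⟩⟩
    choose h hb heq using hext
    set g : ℝ → State n → State n := fun t y => ∑ i, (h 0 i y * dither (k i) ε t 0
      + h 1 i y * dither (k i) ε t 1) • EuclideanSpace.single i (1 : ℝ) with hg
    have hgeq : ∀ t, ∀ y ∈ Metric.closedBall xs δ₀, g t y = esField J F k ε t y := by
      intro t y hy
      simp only [hg, esField, heq _ _ y hy]
    have hgb : ∀ t y, ‖g t y‖ ≤ inputBound k ε * C := fun t y =>
      norm_sum_dither_smul_le k hε t (c := fun s i => h s i y) (fun s i => abs_le.2 (hb s i y)) hC0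
    have hgc : Continuous (Function.uncurry g) := by
      refine continuous_finsetSum _ fun i _ => Continuous.fun_smul (Continuous.fun_add ?_ ?_)
        continuous_const
      · exact ((h 0 i).continuous.comp continuous_snd).mul
          ((continuous_dither _ _ _).comp continuous_fst)
      · exact ((h 1 i).continuous.comp continuous_snd).mul
          ((continuous_dither _ _ _).comp continuous_fst)
    obtain ⟨x, hx1, hx2⟩ := exists_forward_solution_of_bounded hgc hgb t₀ x₀
    refine ⟨x, self_mem_Ici, ordConnected_Ici, subset_rfl, hx1, fun t ht => ?_⟩
    obtain ⟨a, ha, -, -, -, hK, -⟩ := exists_period_start hε hlam hm hGpos hgeq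
      (fun t y _ => (hgb t y).trans_lt hlt) (by rw [hGε]; exact hG) hstep hV0 hVr hθ
      (x := x) (t₀ := t₀) (T := t) (by rwa [hx1]) (by rwa [hx1])
      (fun s hs => (hx2 s hs.1).mono Icc_subset_Ici_self) t ⟨ht, le_rfl⟩
    rw [← hgeq t _ (hK t ⟨ha.2, le_rfl⟩)]
    exact hx2 t ht
  · intro I x hx t ht
    have hsub : Icc t₀ t ⊆ I := hx.ordConnected.out hx.mem ht
    have h1 := hx.init
    obtain ⟨a, ha, h2, h3, h4, h5, h6⟩ := exists_period_start hε hlam hm hGpos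
      (fun _ _ _ => rfl)
      (fun t y hy => (norm_esField_le hε t (fun s i => hC s i y hy) hC0).trans_lt hlt)
      (by rw [hGε]; exact hG) hstep hV0 hVr hθ
      (x := x) (t₀ := t₀) (T := t) (by rwa [h1]) (by rwa [h1])
      (fun s hs => (hx.deriv s (hsub hs)).mono hsub) t ⟨hx.subset ht, le_rfl⟩
    rw [h1] at h4
    rw [hGε] at h6
    exact ⟨a, ha, h2, h3, h4, h5, h6, fun s hs =>
      (hx.deriv s (hsub ⟨ha.1.trans hs.1, hs.2⟩)).mono
        ((Icc_subset_Icc_left ha.1).trans hsub)⟩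

theorem exists_forall_abs_le {ι X : Type*} [Finite ι] [TopologicalSpace X] {K : Set X}
    (hK : IsCompact K) {f : ι → X → ℝ} (hf : ∀ i, ContinuousOn (f i) K) :
    ∃ C, 0 ≤ C ∧ ∀ i, ∀ y ∈ K, |f i y| ≤ C := by
  cases nonempty_fintype ι
  choose C hC using fun i => hK.exists_bound_of_continuousOn (hf i)
  refine ⟨∑ i, |C i|, Finset.sum_nonneg fun i _ => abs_nonneg _, fun i y hy => ?_⟩
  exact ((hC i y hy).trans (le_abs_self _)).trans
    (Finset.single_le_sum (f := fun i => |C i|) (fun i _ => abs_nonneg _) (Finset.mem_univ i))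

/-! ### Consequences of the power bounds on the cost function -/

section PowerBounds

variable {γ₁ γ₂ κ₁ κ₂ μ m₁ : ℝ}

theorem AssumptionA1.sub_nonneg (h : AssumptionA1 J D xs) {x : State n} (hx : x ∈ D) :
    0 ≤ J x - J xs := by
  rcases eq_or_ne x xs with rfl | hne
  · simp
  · exact (_root_.sub_pos.2 (h.lt x ⟨hx, hne⟩)).le

theorem AssumptionA2.norm_sub_le (h : AssumptionA2 J D xs γ₁ γ₂ κ₁ κ₂ μ m₁) {x : State n}
    (hx : x ∈ D) {v : ℝ} (hv : J x - J xs ≤ v) : ‖x - xs‖ ≤ (v / γ₁) ^ (1 / (2 * m₁)) := by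
  have hm := h.one_le_m₁
  have h1 : ‖x - xs‖ ^ (2 * m₁) ≤ v / γ₁ := by
    rw [le_div_iff₀ h.γ₁_pos]
    linarith [h.lower x hx]
  have h2 := Real.rpow_le_rpow (by positivity) h1 (by positivity : 0 ≤ 1 / (2 * m₁))
  rwa [← Real.rpow_mul (norm_nonneg _), mul_one_div_cancel (by positivity), Real.rpow_one] at h2

theorem AssumptionA2.rpow_le (h : AssumptionA2 J D xs γ₁ γ₂ κ₁ κ₂ μ m₁) {x : State n}
    (hx : x ∈ D) (hV : 0 ≤ J x - J xs) : ((J x - J xs) / γ₁) ^ (1 / (2 * m₁))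
      ≤ (γ₂ / γ₁) ^ (1 / (2 * m₁)) * ‖x - xs‖ := by
  have hm := h.one_le_m₁
  have hγ := h.γ₁_pos
  have hγ₂ := h.γ₂_pos
  have h1 : (J x - J xs) / γ₁ ≤ γ₂ / γ₁ * ‖x - xs‖ ^ (2 * m₁) := by
    rw [div_mul_eq_mul_div]
    gcongr
    exact h.upper x hx
  have h2 := Real.rpow_le_rpow (by positivity) h1 (by positivity : 0 ≤ 1 / (2 * m₁))
  rwa [Real.mul_rpow (by positivity) (by positivity), ← Real.rpow_mul (norm_nonneg _),
    mul_one_div_cancel (by positivity), Real.rpow_one] at h2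

theorem AssumptionA2.norm_gradient_le (h : AssumptionA2 J D xs γ₁ γ₂ κ₁ κ₂ μ m₁) {x : State n}
    (hx : x ∈ D) (hV : 0 ≤ J x - J xs) :
    ‖gradient J x‖ ≤ √κ₂ * (J x - J xs) ^ (1 - 1 / (2 * m₁)) := by
  have hm := h.one_le_m₁
  refine le_of_sq_le_sq ?_ (by positivity)
  rw [mul_pow, Real.sq_sqrt h.κ₂_pos.le, ← Real.rpow_mul_natCast hV,
    show (1 - 1 / (2 * m₁)) * (2 : ℕ) = 2 - 1 / m₁ by push_cast; field_simp]
  exact h.grad_upper x hx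

end PowerBounds

/-! ### Constant `F₀`: decrease over one period up to a small error -/

/-- For constant `F₀` the comparison of Lie brackets and gradient extends to `xs` by continuity. -/
theorem bracket_bounds_const (hD : IsOpen D) (hJ : ContDiff ℝ 2 J) (hA1 : AssumptionA1 J D xs)
    (hA3 : AssumptionA3 J D xs F)
    (hrel : ∀ i, GeneratingRelation (F₀ i) (F 0 i) (F 1 i) (J '' (D \ {xs}))) {α : ℝ}
    (hα : 0 < α) (hF₀ : ∀ i, ∀ x ∈ D, F₀ i (J x) = α) {x : State n} (hx : x ∈ D) (i : Fin n) :
    bracket J F i x * gradient J x i ≤ -(α * gradient J x i ^ 2) ∧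
      |bracket J F i x| ≤ α * |gradient J x i| := by
  have hoff : ∀ y ∈ D \ {xs}, bracket J F i y * gradient J y i ≤ -(α * gradient J y i ^ 2) ∧
      |bracket J F i y| ≤ α * |gradient J y i| := by
    intro y hy
    have := bracket_bounds hD hJ hA1 hA3 (hrel i) (m₂ := 0) (α₁ := α) (α₂ := α)
      (fun z hz => by rw [Real.rpow_zero, mul_one, hF₀ i z hz.1])
      (fun z hz => by rw [Real.rpow_zero, mul_one, hF₀ i z hz.1]) hα hy
    simpa using this
  by_cases hxs : x = xs
  swap
  · exact hoff x ⟨hx, hxs⟩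
  subst hxs
  have hg0 : gradient J x i = 0 := by rw [hA1.grad_eq_zero]; rfl
  have hline : Tendsto (fun s : ℝ => x + s • EuclideanSpace.single i (1 : ℝ)) (𝓝[≠] 0) (𝓝 x) := by
    have : Continuous fun s : ℝ => x + s • EuclideanSpace.single i (1 : ℝ) := by fun_prop
    have := this.tendsto 0
    simp only [zero_smul, add_zero] at this
    exact this.mono_left nhdsWithin_le_nhds
  have hev : ∀ᶠ s : ℝ in 𝓝[≠] 0, x + s • EuclideanSpace.single i (1 : ℝ) ∈ D \ {x} := by
    filter_upwards [hline.eventually (hD.mem_nhds hx), self_mem_nhdsWithin] with s h1 h2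
    refine ⟨h1, fun h3 => h2 ?_⟩
    rw [mem_singleton_iff, add_eq_left] at h3
    simpa using h3
  have h1 : |bracket J F i x| ≤ α * |gradient J x i| := by
    refine le_of_tendsto_of_tendsto
      (((hA3.continuousOn_bracket i).continuousAt (hD.mem_nhds hx)).tendsto.comp hline).abs
      (((((EuclideanSpace.proj (𝕜 := ℝ) i).continuous.comp
        (continuous_gradient hJ)).tendsto x).comp hline).abs.const_mul α) ?_
    filter_upwards [hev] with s hs
    exact (hoff _ hs).2
  exact ⟨by simp [hg0], h1⟩

/-- For constant `F₀` the one-step estimate holds with any rate below `α κ₁` and any level `θ > 0`. -/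
theorem exists_forall_periodDecrease_const (hD : IsOpen D) (hJ : ContDiff ℝ 2 J)
    (hF : ∀ s i, ContinuousOn (F s i) (J '' D)) (hA1 : AssumptionA1 J D xs)
    {γ₁ γ₂ κ₁ κ₂ μ m₁ : ℝ} (hA2 : AssumptionA2 J D xs γ₁ γ₂ κ₁ κ₂ μ m₁)
    (hA3 : AssumptionA3 J D xs F) (hk : ∀ i, 0 < k i) (hk_inj : Function.Injective k)
    (hrel : ∀ i, GeneratingRelation (F₀ i) (F 0 i) (F 1 i) (J '' (D \ {xs}))) {α : ℝ}
    (hα : 0 < α) (hF₀ : ∀ i, ∀ x ∈ D, F₀ i (J x) = α) {δ₀ : ℝ}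
    (hδ₀ : Metric.closedBall xs δ₀ ⊆ D) {lam θ : ℝ} (hlam : lam < α * κ₁) (hθ : 0 < θ) :
    ∃ ε₁ > 0, ∀ ε, 0 < ε → ε ≤ ε₁ → PeriodDecrease J F k xs δ₀ ε lam (1 - 1 / m₁) θ := by
  have hK : IsCompact (Metric.closedBall xs δ₀) := isCompact_closedBall _ _
  obtain ⟨Q, hQ0, hQ⟩ := exists_forall_abs_le hK
    (f := fun (w : Fin 2 × Fin 2 × Fin 2 × Fin n × Fin n × Fin n) =>
      lieDeriv (genField J (F w.2.2.1 w.2.2.2.2.2) w.2.2.2.2.2)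
        (lieDeriv (genField J (F w.2.1 w.2.2.2.2.1) w.2.2.2.2.1)
          (fun y => F w.1 w.2.2.2.1 (J y))))
    (fun w => (hA3.lie_two w.1 w.2.1 w.2.2.1 w.2.2.2.1 w.2.2.2.2.1 w.2.2.2.2.2).2.mono hδ₀)
  obtain ⟨Cg, hCg⟩ := hK.exists_bound_of_continuousOn (continuous_gradient hJ).continuousOn
  obtain ⟨Λ, hΛ⟩ := hK.exists_bound_of_continuousOn (continuous_fderiv_gradient hJ).continuousOn
  set N := inputBound k 1 with hN
  have hN0 : 0 ≤ N := inputBound_nonneg k one_pos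
  -- the remainders amount to at most `ε * (√ε * C₁)`
  set C₁ : ℝ := |Cg| * (n * (N ^ 3 * Q)) + |Λ| * (α * |Cg| + n * (N ^ 3 * Q)) ^ 2 with hC₁
  have hC₁0 : 0 ≤ C₁ := by positivity
  set b : ℝ := min ((α * κ₁ - lam) * (θ / 2) ^ (1 + (1 - 1 / m₁))) (θ / 2) with hb
  have hb0 : 0 < b := lt_min (mul_pos (sub_pos.2 hlam) (by positivity)) (by positivity)
  set e₀ : ℝ := min 1 (b / (C₁ + 1)) with he₀
  have he₀0 : 0 < e₀ := lt_min one_pos (by positivity)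
  refine ⟨e₀ ^ 2, by positivity, fun ε hε hεle a x hxK hx => ?_⟩
  set e := √ε with he
  have he0 : 0 < e := Real.sqrt_pos.2 hε
  have hee : e ^ 2 = ε := Real.sq_sqrt hε.le
  have hele : e ≤ e₀ := Real.sqrt_le_iff.2 ⟨he₀0.le, hεle⟩
  have he1 : e ≤ 1 := hele.trans (min_le_left _ _)
  have heb : e * C₁ ≤ b := by
    have h1 : e ≤ b / (C₁ + 1) := hele.trans (min_le_right _ _)
    rw [le_div_iff₀ (by positivity)] at h1
    linarith
  have haa : a ∈ Icc a (a + ε) := ⟨le_rfl, by linarith⟩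
  have hbb : a + ε ∈ Icc a (a + ε) := ⟨by linarith, le_rfl⟩
  have hxa : x a ∈ D := hδ₀ (hxK a haa)
  have hmain := period_decrease hD hJ hF hA3 hk hk_inj (Λ := |Λ|) hε (fun t ht => hδ₀ (hxK t ht)) hx
    hQ0 (fun s p q i j l t ht => hQ (s, p, q, i, j, l) _ (hxK t ht))
    (fun z hz => (hΛ z ((convex_closedBall xs δ₀).segment_subset (hxK a haa) (hxK _ hbb) hz)).trans
      (le_abs_self _)) hα.le
    (fun i => bracket_bounds_const hD hJ hA1 hA3 hrel hα hF₀ hxa i)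
  rw [← hN, ← he] at hmain
  set V := J (x a) - J xs with hV
  have hV0 : 0 ≤ V := hA1.sub_nonneg hxa
  set g := ‖gradient J (x a)‖ with hg
  have hg0 : 0 ≤ g := norm_nonneg _
  have hgC : g ≤ |Cg| := (hCg _ (hxK a haa)).trans (le_abs_self _)
  have hglow : κ₁ * V ^ (1 + (1 - 1 / m₁)) ≤ g ^ 2 := by
    have := hA2.grad_lower (x a) hxa
    rwa [show (2 : ℝ) - 1 / m₁ = 1 + (1 - 1 / m₁) by ring] at this
  set X := V ^ (1 + (1 - 1 / m₁)) with hX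
  have hX0 : 0 ≤ X := Real.rpow_nonneg hV0 _
  have hR : n * ((N * e) ^ 3 * Q) = e ^ 3 * (n * (N ^ 3 * Q)) := by ring
  rw [hR] at hmain
  set R := (n : ℝ) * (N ^ 3 * Q) with hRdef
  have hR0 : 0 ≤ R := by positivity
  have t1 : g * (e ^ 3 * R) ≤ ε * e * (|Cg| * R) := by
    rw [← hee]
    calc g * (e ^ 3 * R) ≤ |Cg| * (e ^ 3 * R) := by gcongr
      _ = _ := by ring
  have t2 : |Λ| * (ε * (α * g) + e ^ 3 * R) ^ 2 ≤ ε * e * (|Λ| * (α * |Cg| + R) ^ 2) := by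
    rw [← hee]
    have h1 : e ^ 2 * (α * g) + e ^ 3 * R ≤ e ^ 2 * (α * |Cg| + R) := by
      have h2 : e ^ 3 * R ≤ e ^ 2 * R := by
        gcongr ?_ * R
        exact pow_le_pow_of_le_one he0.le he1 (by norm_num)
      have h3 : e ^ 2 * (α * g) ≤ e ^ 2 * (α * |Cg|) := by gcongr
      linarith
    calc |Λ| * (e ^ 2 * (α * g) + e ^ 3 * R) ^ 2 ≤ |Λ| * (e ^ 2 * (α * |Cg| + R)) ^ 2 := by gcongr
      _ = e ^ 4 * (|Λ| * (α * |Cg| + R) ^ 2) := by ring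
      _ ≤ e ^ 3 * (|Λ| * (α * |Cg| + R) ^ 2) := by
          gcongr ?_ * _
          exact pow_le_pow_of_le_one he0.le he1 (by norm_num)
      _ = _ := by ring
  have t3 : ε * (α * (κ₁ * X)) ≤ ε * (α * g ^ 2) := by gcongr
  have hdec : J (x (a + ε)) - J xs ≤ V - ε * (α * (κ₁ * X)) + ε * (e * C₁) := by
    have : ε * (e * C₁) = ε * e * (|Cg| * R) + ε * e * (|Λ| * (α * |Cg| + R) ^ 2) := by
      rw [hC₁]; ring
    rw [this]; linarith
  -- above the level `θ / 2` the gap between the rates absorbs the remainders; below it, they do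
  -- not lift `V` beyond `θ`
  rcases le_or_gt (θ / 2) V with hcase | hcase
  · refine le_max_of_le_left (hdec.trans ?_)
    have h1 : e * C₁ ≤ (α * κ₁ - lam) * X := by
      refine heb.trans ((min_le_left _ _).trans ?_)
      refine mul_le_mul_of_nonneg_left ?_ (sub_pos.2 hlam).le
      have hm := hA2.one_le_m₁
      have : 1 / m₁ ≤ 1 := (div_le_one (by linarith)).2 hm
      exact Real.rpow_le_rpow (by positivity) hcase (by linarith)
    have h2 := mul_le_mul_of_nonneg_left h1 hε.le
    linarith
  · refine le_max_of_le_right (hdec.trans ?_)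
    have h1 : e * C₁ ≤ θ / 2 := heb.trans (min_le_right _ _)
    have h2 : ε ≤ 1 := by rw [← hee]; exact pow_le_one₀ he0.le he1
    have h3 : ε * (e * C₁) ≤ 1 * (θ / 2) := mul_le_mul h2 h1 (by positivity) zero_le_one
    have h4 : 0 ≤ ε * (α * (κ₁ * X)) := by have := hA2.κ₁_pos; positivity
    linarith

end ExtremumSeeking

namespace ExtremumSeeking

/-! ### Vanishing controls: decrease over one period without error -/

variable {n : ℕ} {J : State n → ℝ} {F : Fin 2 → Fin n → ℝ → ℝ} {k : Fin n → ℕ} {xs : State n}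
  {F₀ : Fin n → ℝ → ℝ} {D : Set (State n)} {γ₁ γ₂ κ₁ κ₂ μ m₁ m₂ α₁ α₂ M H : ℝ}

theorem AssumptionA4.nonneg (h : AssumptionA4 J D xs F₀ F m₁ m₂ α₁ α₂ M H) :
    0 ≤ 1 + m₂ - 1 / m₁ := by
  linarith [h.m₂_ge]

theorem sub_le_of_mem_closedBall (hA2 : AssumptionA2 J D xs γ₁ γ₂ κ₁ κ₂ μ m₁) {x : State n}
    {δ : ℝ} (hx : x ∈ D) (hxδ : ‖x - xs‖ ≤ δ) : J x - J xs ≤ γ₂ * δ ^ (2 * m₁) := by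
  have hm := hA2.one_le_m₁
  have := hA2.γ₂_pos
  refine (hA2.upper x hx).trans ?_
  gcongr

/-- With vanishing controls, the cost function grows at most by the factor `2` over a period when
`ε` is small: along solutions its logarithmic derivative is of order `ε ^ (-1/2)`. -/
theorem sub_le_two_mul_of_vanishing (hJ : ContDiff ℝ 2 J) (hA1 : AssumptionA1 J D xs)
    (hA2 : AssumptionA2 J D xs γ₁ γ₂ κ₁ κ₂ μ m₁)
    (hA4 : AssumptionA4 J D xs F₀ F m₁ m₂ α₁ α₂ M H) {δ₀ : ℝ}
    (hδ₀ : Metric.closedBall xs δ₀ ⊆ D) {ε a : ℝ} (hε : 0 < ε)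
    (hsmall : inputBound k 1 * √ε * (√κ₂ * M *
      (γ₂ * δ₀ ^ (2 * m₁)) ^ ((1 + m₂ - 1 / m₁) / 2)) ≤ Real.log 2)
    {x : ℝ → State n} (hxK : ∀ t ∈ Icc a (a + ε), x t ∈ Metric.closedBall xs δ₀)
    (hx : ∀ t ∈ Icc a (a + ε), HasDerivWithinAt x (esField J F k ε t (x t)) (Icc a (a + ε)) t) :
    ∀ t ∈ Icc a (a + ε), J (x t) - J xs ≤ 2 * (J (x a) - J xs) := by
  have hm1 := hA2.one_le_m₁
  have hM := hA4.M_pos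
  have hγ₂ := hA2.γ₂_pos
  have hmt := hA4.nonneg
  set B := √κ₂ * M * (γ₂ * δ₀ ^ (2 * m₁)) ^ ((1 + m₂ - 1 / m₁) / 2) with hB
  have haa : a ∈ Icc a (a + ε) := ⟨le_rfl, by linarith⟩
  have hδ₀0 : 0 ≤ δ₀ := dist_nonneg.trans (Metric.mem_closedBall.1 (hxK a haa))
  have hB0 : 0 ≤ B := by positivity
  have hν := inputBound_nonneg k hε
  have hd : ∀ t ∈ Icc a (a + ε), HasDerivWithinAt (fun t => J (x t) - J xs)
      (fderiv ℝ J (x t) (esField J F k ε t (x t))) (Icc a (a + ε)) t := fun t ht =>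
    ((hJ.differentiable (by norm_num) (x t)).hasFDerivAt.comp_hasDerivWithinAt t
      (hx t ht)).sub_const _
  have hbound : ∀ t ∈ Icc a (a + ε), ‖fderiv ℝ J (x t) (esField J F k ε t (x t))‖
      ≤ inputBound k ε * B * ‖J (x t) - J xs‖ + 0 := by
    intro t ht
    have hxD := hδ₀ (hxK t ht)
    have hV0 := hA1.sub_nonneg hxD
    set V := J (x t) - J xs with hV
    have hVle : V ≤ γ₂ * δ₀ ^ (2 * m₁) :=
      sub_le_of_mem_closedBall hA2 hxD (mem_closedBall_iff_norm.1 (hxK t ht))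
    have h1 : ‖fderiv ℝ J (x t)‖ = ‖gradient J (x t)‖ :=
      ((InnerProductSpace.toDual ℝ (State n)).symm.norm_map _).symm
    have h2 := norm_esField_le (k := k) hε t (fun s i => hA4.F_bound s i (x t) hxD)
      (by positivity)
    have h3 := hA2.norm_gradient_le hxD hV0
    rw [add_zero, Real.norm_of_nonneg hV0]
    have h4 : V ^ (1 - 1 / (2 * m₁)) * V ^ ((m₂ + 1) / 2)
        ≤ (γ₂ * δ₀ ^ (2 * m₁)) ^ ((1 + m₂ - 1 / m₁) / 2) * V := by
      rcases hV0.eq_or_lt with h0 | hpos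
      · have : (0 : ℝ) ^ (1 - 1 / (2 * m₁)) = 0 := by
          refine Real.zero_rpow (ne_of_gt ?_)
          rw [sub_pos, div_lt_one (by positivity)]; linarith
        rw [← h0, this]; simp
      · have h5 : V ^ (1 - 1 / (2 * m₁)) * V ^ ((m₂ + 1) / 2)
            = V ^ ((1 + m₂ - 1 / m₁) / 2) * V := by
          nth_rw 4 [← Real.rpow_one V]
          rw [← Real.rpow_add hpos, ← Real.rpow_add hpos]
          congr 1
          field_simp
          ring
        rw [h5]
        gcongr
    calc ‖fderiv ℝ J (x t) (esField J F k ε t (x t))‖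
        ≤ ‖fderiv ℝ J (x t)‖ * ‖esField J F k ε t (x t)‖ := ContinuousLinearMap.le_opNorm _ _
      _ ≤ (√κ₂ * V ^ (1 - 1 / (2 * m₁))) * (inputBound k ε * (M * V ^ ((m₂ + 1) / 2))) := by
          rw [h1]; gcongr
      _ = inputBound k ε * (√κ₂ * M) * (V ^ (1 - 1 / (2 * m₁)) * V ^ ((m₂ + 1) / 2)) := by ring
      _ ≤ inputBound k ε * (√κ₂ * M) * ((γ₂ * δ₀ ^ (2 * m₁)) ^ ((1 + m₂ - 1 / m₁) / 2) * V) := by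
          gcongr
      _ = _ := by rw [hB]; ring
  intro t ht
  have h := norm_le_gronwallBound_of_norm_deriv_right_le
    (fun t ht => (hd t ht).continuousWithinAt)
    (fun t ht => (hd t (Ico_subset_Icc_self ht)).mono_of_mem_nhdsWithin
      (Icc_mem_nhdsGE_of_mem ht)) le_rfl (fun t ht => hbound t (Ico_subset_Icc_self ht)) t ht
  rw [gronwallBound_ε0, Real.norm_of_nonneg (hA1.sub_nonneg (hδ₀ (hxK t ht))),
    Real.norm_of_nonneg (hA1.sub_nonneg (hδ₀ (hxK a haa)))] at h
  refine h.trans ?_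
  rw [mul_comm]
  refine mul_le_mul_of_nonneg_right ?_ (hA1.sub_nonneg (hδ₀ (hxK a haa)))
  rw [← Real.exp_log (show (0 : ℝ) < 2 by norm_num)]
  refine Real.exp_le_exp.2 (le_trans ?_ hsmall)
  rw [← inputBound_mul k hε]
  calc inputBound k ε * B * (t - a) ≤ inputBound k ε * B * ε := by
        gcongr; linarith [ht.2]
    _ = _ := by ring

set_option maxHeartbeats 500000 in
/-- With vanishing controls the one-step estimate holds with any rate below `α₁ κ₁` and level `0`: all
terms are bounded by multiples of the same power of `J - J xs`. -/
theorem exists_forall_periodDecrease_vanishing (hD : IsOpen D) (hJ : ContDiff ℝ 2 J)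
    (hF : ∀ s i, ContinuousOn (F s i) (J '' D)) (hA1 : AssumptionA1 J D xs)
    (hA2 : AssumptionA2 J D xs γ₁ γ₂ κ₁ κ₂ μ m₁)
    (hA3 : AssumptionA3 J D xs F) (hk : ∀ i, 0 < k i) (hk_inj : Function.Injective k)
    (hrel : ∀ i, GeneratingRelation (F₀ i) (F 0 i) (F 1 i) (J '' (D \ {xs})))
    (hA4 : AssumptionA4 J D xs F₀ F m₁ m₂ α₁ α₂ M H) {δ₀ : ℝ} (hδ₀0 : 0 ≤ δ₀)
    (hδ₀ : Metric.closedBall xs δ₀ ⊆ D) {lam : ℝ} (hlam : lam < α₁ * κ₁) :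
    ∃ ε₁ > 0, ∀ ε, 0 < ε → ε ≤ ε₁ → PeriodDecrease J F k xs δ₀ ε lam (1 + m₂ - 1 / m₁) 0 := by
  have hm1 := hA2.one_le_m₁
  have hM := hA4.M_pos
  have hγ₁ := hA2.γ₁_pos
  have hγ₂ := hA2.γ₂_pos
  have hκ₂ := hA2.κ₂_pos
  have hμ := hA2.μ_pos
  have hα₁ := hA4.α₁_pos
  have hα₂ := hA4.α₂_pos
  have hH := hA4.H_nonneg
  have hmt := hA4.nonneg
  set mt := 1 + m₂ - 1 / m₁ with hmtdef
  set m4 := 3 / 2 * (1 + m₂) - 1 / m₁ with hm4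
  set q := 1 - 1 / m₁ with hq
  have h1m : 1 / m₁ ≤ 1 := (div_le_one (by linarith)).2 hm1
  have hq0 : 0 ≤ q := by linarith
  set vK := γ₂ * δ₀ ^ (2 * m₁) with hvK
  set P := vK ^ (mt / 2) with hP
  have hP0 : 0 ≤ P := by positivity
  set N := inputBound k 1 with hN
  have hN0 : 0 ≤ N := inputBound_nonneg k one_pos
  set R₀ : ℝ := n * (N ^ 3 * (H * 2 ^ m4)) with hR₀
  have hR₀0 : 0 ≤ R₀ := by positivity
  set Λ₀ := μ * (2 * (γ₂ / γ₁)) ^ q with hΛ₀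
  have hΛ₀0 : 0 ≤ Λ₀ := by positivity
  set c₁ := α₂ * √κ₂ + R₀ * P with hc₁
  have hc₁0 : 0 ≤ c₁ := by positivity
  -- the remainders amount to at most `ε * (√ε * C₂ * V ^ (1 + mt))`
  set C₂ := √κ₂ * (R₀ * P) + Λ₀ * c₁ ^ 2 * P ^ 2 with hC₂
  have hC₂0 : 0 ≤ C₂ := by positivity
  set e₀ : ℝ := min 1 (min ((α₁ * κ₁ - lam) / (C₂ + 1)) (Real.log 2 / (N * (√κ₂ * M * P) + 1)))
    with he₀
  have he₀0 : 0 < e₀ := by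
    have := Real.log_pos one_lt_two
    exact lt_min one_pos (lt_min (div_pos (sub_pos.2 hlam) (by positivity)) (by positivity))
  refine ⟨e₀ ^ 2, by positivity, fun ε hε hεle a x hxK hx => ?_⟩
  set e := √ε with he
  have he0 : 0 < e := Real.sqrt_pos.2 hε
  have hee : e ^ 2 = ε := Real.sq_sqrt hε.le
  have hele : e ≤ e₀ := Real.sqrt_le_iff.2 ⟨he₀0.le, hεle⟩
  have he1 : e ≤ 1 := hele.trans (min_le_left _ _)
  have heC : e * C₂ ≤ α₁ * κ₁ - lam := by
    have h1 : e ≤ (α₁ * κ₁ - lam) / (C₂ + 1) :=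
      hele.trans ((min_le_right _ _).trans (min_le_left _ _))
    rw [le_div_iff₀ (by positivity)] at h1
    linarith
  have helog : N * e * (√κ₂ * M * P) ≤ Real.log 2 := by
    have h1 : e ≤ Real.log 2 / (N * (√κ₂ * M * P) + 1) :=
      hele.trans ((min_le_right _ _).trans (min_le_right _ _))
    rw [le_div_iff₀ (by positivity)] at h1
    linarith
  have haa : a ∈ Icc a (a + ε) := ⟨le_rfl, by linarith⟩
  have hbb : a + ε ∈ Icc a (a + ε) := ⟨by linarith, le_rfl⟩
  have hxD : ∀ t ∈ Icc a (a + ε), x t ∈ D := fun t ht => hδ₀ (hxK t ht)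
  have hxa : x a ∈ D := hxD a haa
  have hgrow := sub_le_two_mul_of_vanishing hJ hA1 hA2 hA4 hδ₀ hε helog hxK hx
  have hVa0 := hA1.sub_nonneg hxa
  -- a solution that is at `xs` at the start of a period stays there
  rcases hVa0.eq_or_lt with hzero | hpos
  · refine le_max_of_le_right ?_
    have := hgrow _ hbb
    rwa [← hzero, mul_zero] at this
  set V := J (x a) - J xs with hV
  refine le_max_of_le_left ?_
  have hne : x a ∈ D \ {xs} := ⟨hxa, fun h => by
    rw [mem_singleton_iff] at h
    rw [hV, h, sub_self] at hpos
    exact lt_irrefl _ hpos⟩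
  have hVle : V ≤ vK := sub_le_of_mem_closedBall hA2 hxa (mem_closedBall_iff_norm.1 (hxK a haa))
  have hm40 : 0 ≤ m4 := by
    have : 0 < 1 / m₁ := by positivity
    rw [hm4]; linarith
  -- third-order terms along the path
  have hQ : ∀ s p q i j l, ∀ t ∈ Icc a (a + ε), |lieDeriv (genField J (F q l) l)
      (lieDeriv (genField J (F p j) j) (fun y => F s i (J y))) (x t)| ≤ H * (2 * V) ^ m4 := by
    intro s p q i j l t ht
    refine (hA4.lie_bound s p q i j l _ (hxD t ht)).trans ?_
    gcongr
    · exact hA1.sub_nonneg (hxD t ht)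
    · exact hgrow t ht
  -- the Hessian on the segment between the two end points
  have hΛ : ∀ z ∈ segment ℝ (x a) (x (a + ε)), ‖fderiv ℝ (gradient J) z‖ ≤ Λ₀ * V ^ q := by
    intro z hz
    have hzD : z ∈ D := hδ₀ ((convex_closedBall xs δ₀).segment_subset (hxK a haa) (hxK _ hbb) hz)
    have hz2 : z ∈ Metric.closedBall xs ((2 * V / γ₁) ^ (1 / (2 * m₁))) := by
      refine (convex_closedBall xs _).segment_subset ?_ ?_ hz <;> rw [mem_closedBall_iff_norm]
      · exact hA2.norm_sub_le hxa (by linarith)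
      · exact hA2.norm_sub_le (hxD _ hbb) (hgrow _ hbb)
    have hVz : J z - J xs ≤ 2 * (γ₂ / γ₁) * V := by
      refine (sub_le_of_mem_closedBall hA2 hzD (mem_closedBall_iff_norm.1 hz2)).trans (le_of_eq ?_)
      rw [← Real.rpow_mul (by positivity), one_div_mul_cancel (by positivity), Real.rpow_one]
      ring
    refine (hA2.hess z hzD).trans ?_
    rw [hΛ₀, mul_assoc, ← Real.mul_rpow (by positivity) hpos.le]
    gcongr
    exact hA1.sub_nonneg hzD
  have hmain := period_decrease hD hJ hF hA3 hk hk_inj hε hxD hx (by positivity) hQ hΛ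
    (A₁ := α₁ * V ^ m₂) (A₂ := α₂ * V ^ m₂) (by positivity)
    (fun i => bracket_bounds hD hJ hA1 hA3 (hrel i) (hA4.F₀_lower i) (hA4.F₀_upper i) hα₁ hne)
  rw [← hN, ← he] at hmain
  set g := ‖gradient J (x a)‖ with hg
  have hg0 : 0 ≤ g := norm_nonneg _
  have hgup : g ≤ √κ₂ * V ^ (1 - 1 / (2 * m₁)) := hA2.norm_gradient_le hxa hpos.le
  have hglow : κ₁ * V ^ (2 - 1 / m₁) ≤ g ^ 2 := hA2.grad_lower (x a) hxa
  have hR : n * ((N * e) ^ 3 * (H * (2 * V) ^ m4)) = e ^ 3 * (R₀ * V ^ m4) := by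
    rw [Real.mul_rpow (by norm_num) hpos.le, hR₀]; ring
  rw [hR] at hmain
  have hPV : V ^ (mt / 2) ≤ P := by rw [hP]; gcongr
  set W := V ^ (1 + mt) with hW
  have hW0 : 0 < W := by positivity
  -- `p` is the order of the displacement over one period
  set p := 1 + m₂ - 1 / (2 * m₁) with hp
  -- the identities between exponents that make all terms multiples of `W`
  have e1 : V ^ m₂ * V ^ (2 - 1 / m₁) = W := by
    rw [← Real.rpow_add hpos, hW]; congr 1; rw [hmtdef]; ring
  have e2 : V ^ (1 - 1 / (2 * m₁)) * V ^ p = W := by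
    rw [← Real.rpow_add hpos, hW]; congr 1; rw [hp, hmtdef]; field_simp; ring
  have e3 : V ^ m4 = V ^ p * V ^ (mt / 2) := by
    rw [← Real.rpow_add hpos]; congr 1; rw [hm4, hp, hmtdef]; field_simp; ring
  have e4 : V ^ q * (V ^ p) ^ 2 = W * (V ^ (mt / 2)) ^ 2 := by
    rw [← Real.rpow_mul_natCast hpos.le, ← Real.rpow_mul_natCast hpos.le, ← Real.rpow_add hpos, hW,
      ← Real.rpow_add hpos]
    congr 1; rw [hq, hp, hmtdef]; push_cast; field_simp; ring
  have e5 : V ^ m₂ * V ^ (1 - 1 / (2 * m₁)) = V ^ p := by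
    rw [← Real.rpow_add hpos]; congr 1; rw [hp]; ring
  have hVm4 : V ^ m4 ≤ V ^ p * P := by rw [e3]; gcongr
  have t0 : ε * (α₁ * κ₁ * W) ≤ ε * (α₁ * V ^ m₂ * g ^ 2) := by
    rw [← e1]
    calc ε * (α₁ * κ₁ * (V ^ m₂ * V ^ (2 - 1 / m₁)))
        = ε * (α₁ * V ^ m₂ * (κ₁ * V ^ (2 - 1 / m₁))) := by ring
      _ ≤ _ := by gcongr
  have t1 : g * (e ^ 3 * (R₀ * V ^ m4)) ≤ ε * (e * (√κ₂ * (R₀ * P)) * W) := by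
    rw [← hee]
    calc g * (e ^ 3 * (R₀ * V ^ m4))
        ≤ (√κ₂ * V ^ (1 - 1 / (2 * m₁))) * (e ^ 3 * (R₀ * (V ^ p * P))) := by gcongr
      _ = e ^ 2 * (e * (√κ₂ * (R₀ * P)) * (V ^ (1 - 1 / (2 * m₁)) * V ^ p)) := by ring
      _ = _ := by rw [e2]
  have t2 : Λ₀ * V ^ q * (ε * (α₂ * V ^ m₂ * g) + e ^ 3 * (R₀ * V ^ m4)) ^ 2
      ≤ ε * (e * (Λ₀ * c₁ ^ 2 * P ^ 2) * W) := by
    have h1 : ε * (α₂ * V ^ m₂ * g) + e ^ 3 * (R₀ * V ^ m4) ≤ e ^ 2 * (c₁ * V ^ p) := by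
      rw [← hee]
      calc e ^ 2 * (α₂ * V ^ m₂ * g) + e ^ 3 * (R₀ * V ^ m4)
          ≤ e ^ 2 * (α₂ * V ^ m₂ * (√κ₂ * V ^ (1 - 1 / (2 * m₁))))
            + e ^ 2 * (R₀ * (V ^ p * P)) := by
              have h2 : e ^ 3 ≤ e ^ 2 := pow_le_pow_of_le_one he0.le he1 (by norm_num)
              gcongr
        _ = e ^ 2 * (α₂ * √κ₂ * (V ^ m₂ * V ^ (1 - 1 / (2 * m₁))) + R₀ * P * V ^ p) := by ring
        _ = _ := by rw [e5, hc₁]; ring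
    calc Λ₀ * V ^ q * (ε * (α₂ * V ^ m₂ * g) + e ^ 3 * (R₀ * V ^ m4)) ^ 2
        ≤ Λ₀ * V ^ q * (e ^ 2 * (c₁ * V ^ p)) ^ 2 := by gcongr
      _ = e ^ 4 * (Λ₀ * c₁ ^ 2 * (V ^ q * (V ^ p) ^ 2)) := by ring
      _ = e ^ 4 * (Λ₀ * c₁ ^ 2 * (W * (V ^ (mt / 2)) ^ 2)) := by rw [e4]
      _ ≤ e ^ 3 * (Λ₀ * c₁ ^ 2 * (W * P ^ 2)) := by
          have h2 : e ^ 4 ≤ e ^ 3 := pow_le_pow_of_le_one he0.le he1 (by norm_num)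
          gcongr
      _ = _ := by rw [← hee]; ring
  have t3 : ε * (e * C₂ * W) ≤ ε * ((α₁ * κ₁ - lam) * W) := by gcongr
  have t4 : ε * (e * C₂ * W)
      = ε * (e * (√κ₂ * (R₀ * P)) * W) + ε * (e * (Λ₀ * c₁ ^ 2 * P ^ 2) * W) := by
    rw [hC₂]; ring
  have : J (x (a + ε)) - J xs ≤ V - ε * (α₁ * κ₁ * W) + ε * (e * C₂ * W) := by
    rw [t4]; linarith
  linarith

/-- Growth of a solution within a period, when the controls are Lipschitz on the ball. -/
theorem norm_sub_le_of_lipschitz {δ₀ : ℝ} {L : ℝ≥0} (hL : 0 < L)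
    (hLip : ∀ s i, LipschitzOnWith L (fun x => F s i (J x)) (Metric.closedBall xs δ₀))
    {ε a b B : ℝ} (hε : 0 < ε) (hab : a ≤ b) (hbε : b ≤ a + ε) (hB0 : 0 ≤ B) {x : ℝ → State n}
    (hB : ∀ s i, |F s i (J (x a))| ≤ B)
    (hxK : ∀ t ∈ Icc a b, x t ∈ Metric.closedBall xs δ₀)
    (hx : ∀ t ∈ Icc a b, HasDerivWithinAt x (esField J F k ε t (x t)) (Icc a b) t) :
    ‖x b - x a‖ ≤ B / L * (Real.exp (inputBound k ε * L * ε) - 1) := by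
  have hν := inputBound_nonneg k hε
  have hL' : (0 : ℝ) < L := by exact_mod_cast hL
  have haa : a ∈ Icc a b := ⟨le_rfl, hab⟩
  have hb := norm_le_gronwallBound_of_norm_deriv_right_le (f := fun t => x t - x a) (δ := 0)
    (K := inputBound k ε * L) (ε := inputBound k ε * B)
    (fun t ht => ((hx t ht).continuousWithinAt).sub continuousWithinAt_const)
    (fun t ht => ((hx t (Ico_subset_Icc_self ht)).sub_const _).mono_of_mem_nhdsWithin
      (Icc_mem_nhdsGE_of_mem ht)) (by simp) (fun t ht => ?_) b ⟨hab, le_rfl⟩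
  · rcases hν.eq_or_lt with h0 | hpos
    · rw [← h0] at hb ⊢
      simpa [gronwallBound_K0] using hb
    · rw [gronwallBound_of_K_ne_0 (by positivity)] at hb
      simp only [zero_mul, zero_add, mul_div_mul_left _ _ hpos.ne'] at hb
      refine hb.trans ?_
      gcongr
      linarith
  · have h1 : ∀ s i, |F s i (J (x t))| ≤ B + L * ‖x t - x a‖ := by
      intro s i
      have h2 := (hLip s i).dist_le_mul _ (hxK t (Ico_subset_Icc_self ht)) _ (hxK a haa)
      rw [Real.dist_eq, dist_eq_norm] at h2
      have h3 := abs_sub_abs_le_abs_sub (F s i (J (x t))) (F s i (J (x a)))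
      linarith [hB s i]
    refine (norm_esField_le hε t h1 (by positivity)).trans (le_of_eq ?_)
    ring

end ExtremumSeeking

namespace ExtremumSeeking

variable {n : ℕ} {J : State n → ℝ} {F : Fin 2 → Fin n → ℝ → ℝ} {k : Fin n → ℕ} {xs : State n}
  {F₀ : Fin n → ℝ → ℝ} {D : Set (State n)} {γ₁ γ₂ κ₁ κ₂ μ m₁ m₂ α₁ α₂ M H : ℝ}

/-! ### Decay estimates, uniform in the initial time -/

theorem mul_rpow_div_rpow {γ r m₁ : ℝ} (hγ : 0 < γ) (hr : 0 ≤ r) (hm : 0 < m₁) :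
    (γ * r ^ (2 * m₁) / γ) ^ (1 / (2 * m₁)) = r := by
  rw [mul_div_cancel_left₀ _ hγ.ne', ← Real.rpow_mul hr, mul_one_div_cancel (by positivity),
    Real.rpow_one]

theorem exists_sq_bound {A b ε₁ : ℝ} (hA : 0 < A) (hb : 0 < b) (hε₁ : 0 < ε₁) :
    ∃ ε₂ > 0, ε₂ ≤ ε₁ ∧ ∀ ε, 0 < ε → ε ≤ ε₂ → A * √ε ≤ b := by
  refine ⟨min ε₁ ((b / A) ^ 2), lt_min hε₁ (by positivity), min_le_left _ _, fun ε _ h => ?_⟩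
  have : √ε ≤ b / A := Real.sqrt_le_iff.2 ⟨by positivity, h.trans (min_le_right _ _)⟩
  rwa [le_div_iff₀ hA, mul_comm] at this

/-- Decay for constant `F₀`, up to an arbitrarily small offset `ρ`. -/
theorem exists_forall_decay_const (hD : IsOpen D) (hJ : ContDiff ℝ 2 J)
    (hF : ∀ s i, ContinuousOn (F s i) (J '' D)) (hA1 : AssumptionA1 J D xs)
    (hA2 : AssumptionA2 J D xs γ₁ γ₂ κ₁ κ₂ μ m₁)
    (hA3 : AssumptionA3 J D xs F) (hk : ∀ i, 0 < k i) (hk_inj : Function.Injective k)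
    (hrel : ∀ i, GeneratingRelation (F₀ i) (F 0 i) (F 1 i) (J '' (D \ {xs}))) {α : ℝ}
    (hα : 0 < α) (hF₀ : ∀ i, ∀ x ∈ D, F₀ i (J x) = α) {δ₀ r lam ρ : ℝ}
    (hδ₀ : Metric.closedBall xs δ₀ ⊆ D) (hr0 : 0 < r) (hr : r < δ₀) (hlam0 : 0 < lam)
    (hlam : lam < α * κ₁) (hρ : 0 < ρ) :
    ∃ ε₁ > 0, ∀ ε, 0 < ε → ε ≤ ε₁ → ∀ t₀, ∀ x₀ ∈ Metric.closedBall xs δ₀,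
      J x₀ - J xs ≤ γ₁ * r ^ (2 * m₁) →
      HasGlobalSolution (esField J F k ε) t₀ x₀ ∧
      ∀ I x, IsSolution (esField J F k ε) t₀ x₀ I x → ∀ t ∈ I,
        ‖x t - xs‖ ≤ (comparison (1 - 1 / m₁) (J x₀ - J xs) (lam * max (t - t₀ - ε) 0) / γ₁)
          ^ (1 / (2 * m₁)) + ρ := by
  have hm1 := hA2.one_le_m₁
  have hm0 : 0 < m₁ := by linarith
  have hγ₁ := hA2.γ₁_pos
  have hmt : 0 ≤ 1 - 1 / m₁ := by
    rw [sub_nonneg, div_le_one hm0]; exact hm1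
  -- the sublevel set of `θ` lies in the ball of radius `ρ / 2`, and `θ` does not exceed the bound
  -- for the initial values of `J - J xs`
  set θ := min (γ₁ * (ρ / 2) ^ (2 * m₁)) (γ₁ * r ^ (2 * m₁)) with hθ
  have hθ0 : 0 < θ := lt_min (by positivity) (by positivity)
  obtain ⟨ε₁, hε₁, hstep⟩ := exists_forall_periodDecrease_const hD hJ hF hA1 hA2 hA3 hk hk_inj hrel
    hα hF₀ hδ₀ hlam hθ0
  have hFc : ∀ s i, ContinuousOn (fun y => F s i (J y)) (Metric.closedBall xs δ₀) := fun s i =>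
    (continuousOn_generator hJ.continuous hF s i).mono hδ₀
  obtain ⟨C, hC0, hC⟩ := exists_forall_abs_le (isCompact_closedBall xs δ₀)
    (f := fun w : Fin 2 × Fin n => fun y => F w.1 w.2 (J y)) (fun w => hFc w.1 w.2)
  have hN := inputBound_nonneg k one_pos
  obtain ⟨ε₂, hε₂, hε₂₁, hsq⟩ := exists_sq_bound (A := inputBound k 1 * C + 1)
    (b := min (δ₀ - r) (ρ / 2)) (by positivity) (lt_min (by linarith) (by linarith)) hε₁
  refine ⟨ε₂, hε₂, fun ε hε hεle t₀ x₀ hx₀ hx₀v => ?_⟩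
  obtain ⟨hglob, hsol⟩ := hasGlobalSolution_and_exists_period_start (r := r) hε hlam0.le hmt hC0 hFc
    (fun s i y hy => hC (s, i) y hy) ((hsq ε hε hεle).trans (min_le_left _ _))
    (hstep ε hε (hεle.trans hε₂₁)) (fun y hy => hA1.sub_nonneg (hδ₀ hy))
    (fun y hy hv => (hA2.norm_sub_le (hδ₀ hy) hv).trans_eq (mul_rpow_div_rpow hγ₁ hr0.le hm0))
    (min_le_right _ _) t₀ hx₀ hx₀v
  refine ⟨hglob, fun I x hx t ht => ?_⟩
  obtain ⟨a, -, -, haK, hVa, -, hclose, -⟩ := hsol I x hx t ht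
  have hcn : 0 ≤ comparison (1 - 1 / m₁) (J x₀ - J xs) (lam * max (t - t₀ - ε) 0) :=
    comparison_nonneg hmt (hA1.sub_nonneg (hδ₀ hx₀)) (by positivity)
  have h1 : ‖x a - xs‖ ≤ (comparison (1 - 1 / m₁) (J x₀ - J xs) (lam * max (t - t₀ - ε) 0) / γ₁)
      ^ (1 / (2 * m₁)) + ρ / 2 := by
    rcases le_max_iff.1 hVa with h | h
    · have := hA2.norm_sub_le (hδ₀ haK) h
      linarith
    · have h2 := hA2.norm_sub_le (hδ₀ haK) (h.trans (min_le_left _ _))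
      rw [mul_rpow_div_rpow hγ₁ (by positivity) hm0] at h2
      have : 0 ≤ (comparison (1 - 1 / m₁) (J x₀ - J xs) (lam * max (t - t₀ - ε) 0) / γ₁)
          ^ (1 / (2 * m₁)) := by positivity
      linarith
  have h2 := hclose.trans ((hsq ε hε hεle).trans (min_le_right _ _))
  have h3 : ‖x t - xs‖ ≤ ‖x t - x a‖ + ‖x a - xs‖ := norm_sub_le_norm_sub_add_norm_sub _ _ _
  linarith

/-- Decay for vanishing controls. The last factor accounts for the oscillation within periods. -/
theorem exists_forall_decay_vanishing (hD : IsOpen D) (hJ : ContDiff ℝ 2 J)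
    (hF : ∀ s i, ContinuousOn (F s i) (J '' D)) (hA1 : AssumptionA1 J D xs)
    (hA2 : AssumptionA2 J D xs γ₁ γ₂ κ₁ κ₂ μ m₁)
    (hA3 : AssumptionA3 J D xs F) (hk : ∀ i, 0 < k i) (hk_inj : Function.Injective k)
    (hrel : ∀ i, GeneratingRelation (F₀ i) (F 0 i) (F 1 i) (J '' (D \ {xs})))
    (hA4 : AssumptionA4 J D xs F₀ F m₁ m₂ α₁ α₂ M H) {δ₀ r lam : ℝ}
    (hδ₀ : Metric.closedBall xs δ₀ ⊆ D) (hr0 : 0 < r) (hr : r < δ₀) (hlam0 : 0 < lam)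
    (hlam : lam < α₁ * κ₁) {L : ℝ≥0} (hL : 0 < L)
    (hLip : ∀ s i, LipschitzOnWith L (fun x => F s i (J x)) (Metric.closedBall xs δ₀)) :
    ∃ ε₁ > 0, ∀ ε, 0 < ε → ε ≤ ε₁ → ∀ t₀, ∀ x₀ ∈ Metric.closedBall xs δ₀,
      J x₀ - J xs ≤ γ₁ * r ^ (2 * m₁) →
      HasGlobalSolution (esField J F k ε) t₀ x₀ ∧
      ∀ I x, IsSolution (esField J F k ε) t₀ x₀ I x → ∀ t ∈ I,
        ‖x t - xs‖ ≤
          (comparison (1 + m₂ - 1 / m₁) (J x₀ - J xs) (lam * max (t - t₀ - ε) 0) / γ₁)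
            ^ (1 / (2 * m₁)) *
          (1 + M * γ₂ ^ ((m₂ + 1) / 2) / L *
            (comparison (1 + m₂ - 1 / m₁) (J x₀ - J xs) (lam * max (t - t₀ - ε) 0) / γ₁)
              ^ ((1 + m₂ - 1 / m₁) / 2) * (Real.exp (inputBound k ε * L * ε) - 1)) := by
  have hm1 := hA2.one_le_m₁
  have hm0 : 0 < m₁ := by linarith
  have hγ₁ := hA2.γ₁_pos
  have hγ₂ := hA2.γ₂_pos
  have hM := hA4.M_pos
  have hmt := hA4.nonneg
  have hL' : (0 : ℝ) < L := by exact_mod_cast hL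
  obtain ⟨ε₁, hε₁, hstep⟩ := exists_forall_periodDecrease_vanishing hD hJ hF hA1 hA2 hA3 hk hk_inj
    hrel hA4 (hr0.le.trans hr.le) hδ₀ hlam
  have hFc : ∀ s i, ContinuousOn (fun y => F s i (J y)) (Metric.closedBall xs δ₀) := fun s i =>
    (continuousOn_generator hJ.continuous hF s i).mono hδ₀
  obtain ⟨C, hC0, hC⟩ := exists_forall_abs_le (isCompact_closedBall xs δ₀)
    (f := fun w : Fin 2 × Fin n => fun y => F w.1 w.2 (J y)) (fun w => hFc w.1 w.2)
  have hN := inputBound_nonneg k one_pos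
  obtain ⟨ε₂, hε₂, hε₂₁, hsq⟩ := exists_sq_bound (A := inputBound k 1 * C + 1)
    (b := δ₀ - r) (by positivity) (by linarith) hε₁
  refine ⟨ε₂, hε₂, fun ε hε hεle t₀ x₀ hx₀ hx₀v => ?_⟩
  obtain ⟨hglob, hsol⟩ := hasGlobalSolution_and_exists_period_start (r := r) hε hlam0.le hmt hC0 hFc
    (fun s i y hy => hC (s, i) y hy) (hsq ε hε hεle)
    (hstep ε hε (hεle.trans hε₂₁)) (fun y hy => hA1.sub_nonneg (hδ₀ hy))
    (fun y hy hv => (hA2.norm_sub_le (hδ₀ hy) hv).trans_eq (mul_rpow_div_rpow hγ₁ hr0.le hm0))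
    (by positivity) t₀ hx₀ hx₀v
  refine ⟨hglob, fun I x hx t ht => ?_⟩
  obtain ⟨a, ha, hta, haK, hVa, hK, -, hsol'⟩ := hsol I x hx t ht
  set mt := 1 + m₂ - 1 / m₁ with hmtdef
  set Φ := comparison mt (J x₀ - J xs) (lam * max (t - t₀ - ε) 0) with hΦ
  have hΦ0 : 0 ≤ Φ := comparison_nonneg hmt (hA1.sub_nonneg (hδ₀ hx₀)) (by positivity)
  rw [max_eq_left hΦ0] at hVa
  have haD := hδ₀ haK
  have hVa0 := hA1.sub_nonneg haD
  set d := ‖x a - xs‖ with hd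
  have hd0 : 0 ≤ d := norm_nonneg _
  have hdle : d ≤ (Φ / γ₁) ^ (1 / (2 * m₁)) := hA2.norm_sub_le haD hVa
  set E := Real.exp (inputBound k ε * L * ε) - 1 with hE
  have hE0 : 0 ≤ E := by
    have := inputBound_nonneg k hε
    have h1 : 0 ≤ inputBound k ε * L * ε := by positivity
    linarith [Real.one_le_exp h1]
  have hmpos : 0 < m₂ + 1 := by
    have : 0 < 1 / m₁ := by positivity
    linarith [hA4.m₂_ge]
  have hosc := norm_sub_le_of_lipschitz hL hLip hε ha.2 hta
    (B := M * (J (x a) - J xs) ^ ((m₂ + 1) / 2)) (by positivity)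
    (fun s i => hA4.F_bound s i _ haD) hK hsol'
  have hpow : (J (x a) - J xs) ^ ((m₂ + 1) / 2) ≤ γ₂ ^ ((m₂ + 1) / 2) * (d * d ^ (m₁ * mt)) := by
    have h1 := Real.rpow_le_rpow hVa0 (hA2.upper _ haD) (by positivity : 0 ≤ (m₂ + 1) / 2)
    refine h1.trans (le_of_eq ?_)
    rw [Real.mul_rpow hγ₂.le (by positivity), ← Real.rpow_mul hd0]
    congr 1
    have h2 : 2 * m₁ * ((m₂ + 1) / 2) = 1 + m₁ * mt := by rw [hmtdef]; field_simp; ring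
    rw [h2, Real.rpow_add_of_nonneg hd0 zero_le_one (by positivity), Real.rpow_one]
  have hdpow : d ^ (m₁ * mt) ≤ (Φ / γ₁) ^ (mt / 2) := by
    have h1 := Real.rpow_le_rpow hd0 hdle (by positivity : 0 ≤ m₁ * mt)
    rwa [← Real.rpow_mul (by positivity),
      show 1 / (2 * m₁) * (m₁ * mt) = mt / 2 by field_simp] at h1
  have h3 : ‖x t - xs‖ ≤ ‖x t - x a‖ + d := norm_sub_le_norm_sub_add_norm_sub _ _ _
  calc ‖x t - xs‖ ≤ M * (J (x a) - J xs) ^ ((m₂ + 1) / 2) / L * E + d := by linarith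
    _ ≤ M * (γ₂ ^ ((m₂ + 1) / 2) * (d * (Φ / γ₁) ^ (mt / 2))) / L * E + d := by
        gcongr
        exact hpow.trans (by gcongr)
    _ = d * (1 + M * γ₂ ^ ((m₂ + 1) / 2) / L * (Φ / γ₁) ^ (mt / 2) * E) := by ring
    _ ≤ _ := by gcongr

/-! ### Auxiliary facts on the decay function and on initial values -/

theorem decayFun_nonneg {m j s : ℝ} (hm : 0 ≤ m) (hj : 0 ≤ j) (hs : 0 ≤ s) :
    0 ≤ decayFun m₁ m j s := by
  unfold decayFun
  split_ifs <;> positivity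

theorem decayFun_antitone {m j s s' : ℝ} (hm₁ : 0 < m₁) (hm : 0 ≤ m) (hj : 0 ≤ j) (hss : s ≤ s')
    (hpos : 0 < 1 + m * s * j ^ m) : decayFun m₁ m j s' ≤ decayFun m₁ m j s := by
  unfold decayFun
  split_ifs with h
  · gcongr
  · refine Real.rpow_le_rpow_of_nonpos hpos (by gcongr) ?_
    exact div_nonpos_of_nonpos_of_nonneg (by norm_num) (by positivity)

theorem decayFun_pos {m j s : ℝ} (hpos : 0 < 1 + m * s * j ^ m) : 0 < decayFun m₁ m j s := by
  unfold decayFun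
  split_ifs <;> positivity

/-- For small `ε` the argument of the decay function stays away from its singularity, also at the
times `t < ε`, where `l * (t - ε)` is negative. -/
theorem one_add_mul_pos {m j jmax l lbar ε t : ℝ} (hm : 0 ≤ m) (hj : 0 ≤ j) (hjm : j ≤ jmax)
    (hl0 : 0 < l) (hl : l ≤ lbar) (hε0 : 0 < ε) (hε : ε * (m * lbar * jmax ^ m + 1) ≤ 1)
    (ht : 0 ≤ t) :
    0 < 1 + m * (l * (t - ε)) * j ^ m := by
  have hlb : 0 < lbar := hl0.trans_le hl
  have h1 : m * l * j ^ m * ε ≤ m * lbar * jmax ^ m * ε := by gcongr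
  have h2 : 0 ≤ m * l * j ^ m * t := by positivity
  linarith

/-- Lower rates and the missing truncation at `t = ε` only increase the decay function. -/
theorem decayFun_le_of_le {m j l lbar ε t : ℝ} (hm₁ : 0 < m₁) (hm : 0 ≤ m)
    (hj : 0 ≤ j) (hl0 : 0 < l) (hl : l ≤ lbar)
    (hpos : 0 < 1 + m * (l * (t - ε)) * j ^ m) :
    decayFun m₁ m j (lbar * max (t - ε) 0) ≤ decayFun m₁ m j (l * (t - ε)) := by
  refine decayFun_antitone hm₁ hm hj ?_ hpos
  have h1 : l * (t - ε) ≤ l * max (t - ε) 0 := by gcongr; exact le_max_left _ _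
  exact h1.trans (by gcongr)

/-- The comparison solution falls below any level within a time that does not depend on its initial
value. -/
theorem exists_time_comparison_le {m lam γ R : ℝ} (hm₁ : 0 < m₁) (hm : 0 < m) (hlam : 0 < lam)
    (hγ : 0 < γ) (hR : 0 < R) :
    ∃ S > 0, ∀ v ≥ 0, ∀ s ≥ S, (comparison m v (lam * s) / γ) ^ (1 / (2 * m₁)) ≤ R := by
  set y := γ * R ^ (2 * m₁) with hy
  have hy0 : 0 < y := by positivity
  set S := y ^ (-m) / (m * lam) with hS
  have hS0 : 0 < S := by positivity
  refine ⟨S, hS0, fun v hv s hs => ?_⟩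
  have hs0 : 0 < s := hS0.trans_le hs
  have h1 : comparison m v (lam * s) ≤ y := by
    refine (comparison_antitone hm.le hv (by positivity)
      (mul_le_mul_of_nonneg_left hs hlam.le)).trans
      ((comparison_le_rpow hm hv (by positivity)).trans (le_of_eq ?_))
    rw [show m * (lam * S) = y ^ (-m) by rw [hS]; field_simp, ← Real.rpow_mul hy0.le,
      show -m * (-1 / m) = 1 by field_simp, Real.rpow_one]
  have h2 := comparison_nonneg hm.le hv (by positivity : 0 ≤ lam * s)
  rw [← mul_rpow_div_rpow hγ hR.le hm₁, ← hy]
  gcongr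

theorem closedBall_subset_eball {δ₀ : ℝ} {Δ : ℝ≥0∞} (h : ENNReal.ofReal δ₀ < Δ) :
    Metric.closedBall xs δ₀ ⊆ Metric.eball xs Δ := by
  intro y hy
  rw [Metric.mem_eball, edist_dist]
  exact (ENNReal.ofReal_le_ofReal (Metric.mem_closedBall.1 hy)).trans_lt h

theorem exists_lt_ofReal_lt {r : ℝ} (hr : 0 ≤ r) {Δ : ℝ≥0∞} (h : ENNReal.ofReal r < Δ) :
    ∃ δ₀, r < δ₀ ∧ ENNReal.ofReal δ₀ < Δ := by
  obtain ⟨s, hs1, hs2⟩ := ENNReal.lt_iff_exists_nnreal_btwn.1 h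
  refine ⟨s, ?_, by rwa [ENNReal.ofReal_coe_nnreal]⟩
  rwa [ENNReal.ofReal_lt_iff_lt_toReal hr ENNReal.coe_ne_top, ENNReal.coe_toReal] at hs1

theorem AssumptionA2.ofReal_mul_lt (h : AssumptionA2 J D xs γ₁ γ₂ κ₁ κ₂ μ m₁) {δ : ℝ} {Δ : ℝ≥0∞}
    (hδ : ENNReal.ofReal δ < ENNReal.ofReal ((γ₁ / γ₂) ^ (1 / (2 * m₁))) * Δ) :
    ENNReal.ofReal ((γ₂ / γ₁) ^ (1 / (2 * m₁)) * δ) < Δ := by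
  have hγ₁ := h.γ₁_pos
  have hγ₂ := h.γ₂_pos
  set c := (γ₂ / γ₁) ^ (1 / (2 * m₁)) with hc
  have hc0 : 0 < c := by positivity
  have hcc : c * (γ₁ / γ₂) ^ (1 / (2 * m₁)) = 1 := by
    rw [hc, ← Real.mul_rpow (by positivity) (by positivity),
      show γ₂ / γ₁ * (γ₁ / γ₂) = 1 by field_simp, Real.one_rpow]
  have h1 := (ENNReal.mul_lt_mul_iff_right (a := ENNReal.ofReal c)
    (by simpa using hc0) ENNReal.ofReal_ne_top).2 hδ
  rwa [← mul_assoc, ← ENNReal.ofReal_mul hc0.le, ← ENNReal.ofReal_mul hc0.le, hcc,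
    ENNReal.ofReal_one, one_mul] at h1

theorem AssumptionA2.mul_rpow_eq (h : AssumptionA2 J D xs γ₁ γ₂ κ₁ κ₂ μ m₁) {δ : ℝ} (hδ : 0 ≤ δ) :
    γ₁ * ((γ₂ / γ₁) ^ (1 / (2 * m₁)) * δ) ^ (2 * m₁) = γ₂ * δ ^ (2 * m₁) := by
  have hγ₁ := h.γ₁_pos
  have hγ₂ := h.γ₂_pos
  have hm := h.one_le_m₁
  rw [Real.mul_rpow (by positivity) hδ, ← Real.rpow_mul (by positivity),
    one_div_mul_cancel (by positivity), Real.rpow_one]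
  field_simp

/-- Initial values in `ball xs δ` belong to the ball `closedBall xs δ₀` in which solutions stay. If
there is a point besides `xs`, then the power bounds force `γ₁ ≤ γ₂`, whence `δ < δ₀`. -/
theorem AssumptionA2.mem_closedBall_and_sub_le (h : AssumptionA2 J D xs γ₁ γ₂ κ₁ κ₂ μ m₁)
    {δ δ₀ : ℝ} (hδ : 0 < δ) (hδ₀ : (γ₂ / γ₁) ^ (1 / (2 * m₁)) * δ < δ₀)
    (hsub : Metric.closedBall xs δ₀ ⊆ D) {x₀ : State n} (hx : x₀ ∈ Metric.ball xs δ) :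
    x₀ ∈ Metric.closedBall xs δ₀ ∧
      J x₀ - J xs ≤ γ₁ * ((γ₂ / γ₁) ^ (1 / (2 * m₁)) * δ) ^ (2 * m₁) := by
  have hγ₁ := h.γ₁_pos
  have hγ₂ := h.γ₂_pos
  have hm := h.one_le_m₁
  rw [mem_ball_iff_norm] at hx
  have hδ₀0 : 0 < δ₀ := lt_trans (by positivity) hδ₀
  have hmem : x₀ ∈ Metric.closedBall xs δ₀ := by
    rcases eq_or_ne x₀ xs with rfl | hne
    · exact Metric.mem_closedBall_self hδ₀0.le
    have hd : 0 < ‖x₀ - xs‖ := norm_pos_iff.2 (sub_ne_zero.2 hne)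
    set y := xs + (δ₀ / ‖x₀ - xs‖) • (x₀ - xs) with hy
    have hyn : ‖y - xs‖ = δ₀ := by
      rw [hy, add_sub_cancel_left, norm_smul, Real.norm_of_nonneg (by positivity)]
      field_simp
    have hyD : y ∈ D := hsub (mem_closedBall_iff_norm.2 hyn.le)
    have h1 := (h.lower y hyD).trans (h.upper y hyD)
    rw [hyn] at h1
    have h2 : γ₁ ≤ γ₂ := le_of_mul_le_mul_right h1 (by positivity)
    have h3 : 1 ≤ (γ₂ / γ₁) ^ (1 / (2 * m₁)) :=
      Real.one_le_rpow ((one_le_div hγ₁).2 h2) (by positivity)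
    rw [mem_closedBall_iff_norm]
    nlinarith
  refine ⟨hmem, ?_⟩
  rw [h.mul_rpow_eq hδ.le]
  exact sub_le_of_mem_closedBall h (hsub hmem) hx.le

end ExtremumSeeking

namespace ExtremumSeeking

/-! ### From decay estimates to stability -/

section Stability

variable {n : ℕ} {xs : State n} {V : State n → ℝ} {m m₁ γ lam c δ : ℝ}

theorem comparison_zero_div_rpow (m₁ : ℝ) (hγ : 0 < γ) {v s : ℝ} (hv : 0 ≤ v) :
    (comparison 0 v s / γ) ^ (1 / (2 * m₁))
      = (v / γ) ^ (1 / (2 * m₁)) * Real.exp (-s / (2 * m₁)) := by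
  rw [comparison, if_pos rfl, mul_div_right_comm,
    Real.mul_rpow (by positivity) (Real.exp_pos _).le, ← Real.exp_mul]
  congr 2
  ring

theorem comparison_rpow_le (hm₁ : 0 < m₁) (hm : 0 ≤ m) (hγ : 0 < γ) {v s : ℝ} (hv : 0 ≤ v)
    (hs : 0 ≤ s) : (comparison m v s / γ) ^ (1 / (2 * m₁)) ≤ (v / γ) ^ (1 / (2 * m₁)) := by
  have := comparison_nonneg hm hv hs
  gcongr
  exact comparison_le hm hv hs

/-- Replacing `max (t - ε) 0` by `t` in an exponential costs a constant factor. -/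
theorem exp_neg_max_le (hm₁ : 0 < m₁) (hlam : 0 < lam) {t ε E : ℝ} (hE : ε ≤ E) :
    Real.exp (-(lam * max (t - ε) 0) / (2 * m₁))
      ≤ Real.exp (lam * E / (2 * m₁)) * Real.exp (-(lam / (2 * m₁)) * t) := by
  rw [← Real.exp_add]
  refine Real.exp_le_exp.2 ?_
  have h1 : t - E ≤ max (t - ε) 0 := le_trans (by linarith) (le_max_left _ _)
  have h2 := mul_le_mul_of_nonneg_left h1 (by positivity : 0 ≤ lam / (2 * m₁))
  calc -(lam * max (t - ε) 0) / (2 * m₁) = -(lam / (2 * m₁) * max (t - ε) 0) := by ring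
    _ ≤ -(lam / (2 * m₁) * (t - E)) := neg_le_neg h2
    _ = _ := by ring

theorem practicallyExponentiallyStable_of_decay {f : ℝ → ℝ → State n → State n} (hm₁ : 0 < m₁)
    (hγ : 0 < γ) (hlam : 0 < lam) (hc : 0 < c) (hδ : 0 < δ)
    (hV : ∀ x₀ ∈ Metric.ball xs δ, 0 ≤ V x₀ ∧ (V x₀ / γ) ^ (1 / (2 * m₁)) ≤ c * ‖x₀ - xs‖)
    (hdec : ∀ ρ > 0, ∃ ε₁ > 0, ∀ ε, 0 < ε → ε ≤ ε₁ → ∀ t₀, ∀ x₀ ∈ Metric.ball xs δ,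
      HasGlobalSolution (f ε) t₀ x₀ ∧ ∀ I x, IsSolution (f ε) t₀ x₀ I x → ∀ t ∈ I,
        ‖x t - xs‖
          ≤ (comparison 0 (V x₀) (lam * max (t - t₀ - ε) 0) / γ) ^ (1 / (2 * m₁)) + ρ) :
    PracticallyExponentiallyStable f xs := by
  refine ⟨δ, hδ, c * Real.exp (lam * 1 / (2 * m₁)), by positivity, lam / (2 * m₁), by positivity,
    fun ρ hρ => ?_⟩
  obtain ⟨ε₁, hε₁, h⟩ := hdec ρ hρ
  refine ⟨min ε₁ 1, lt_min hε₁ one_pos, fun t₀ _ ε hε hεlt x₀ hx₀ => ?_⟩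
  obtain ⟨h1, h2⟩ := h ε hε (hεlt.le.trans (min_le_left _ _)) t₀ x₀ hx₀
  obtain ⟨hV0, hVc⟩ := hV x₀ hx₀
  refine ⟨h1, fun I x hx t ht => (h2 I x hx t ht).trans (add_le_add ?_ le_rfl)⟩
  rw [comparison_zero_div_rpow m₁ hγ hV0]
  have h3 := exp_neg_max_le (t := t - t₀) hm₁ hlam (hεlt.le.trans (min_le_right _ _))
  calc _ ≤ (c * ‖x₀ - xs‖) * (Real.exp (lam * 1 / (2 * m₁)) *
        Real.exp (-(lam / (2 * m₁)) * (t - t₀))) := by gcongr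
    _ = _ := by ring

theorem practicallyAsymptoticallyStable_of_decay {f : ℝ → ℝ → State n → State n} (hm₁ : 0 < m₁)
    (hm : 0 < m) (hγ : 0 < γ) (hlam : 0 < lam) (hc : 0 < c) (hδ : 0 < δ)
    (hV : ∀ x₀ ∈ Metric.ball xs δ, 0 ≤ V x₀ ∧ (V x₀ / γ) ^ (1 / (2 * m₁)) ≤ c * ‖x₀ - xs‖)
    (hdec : ∀ ρ > 0, ∃ ε₁ > 0, ∀ ε, 0 < ε → ε ≤ ε₁ → ∀ t₀, ∀ x₀ ∈ Metric.ball xs δ,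
      HasGlobalSolution (f ε) t₀ x₀ ∧ ∀ I x, IsSolution (f ε) t₀ x₀ I x → ∀ t ∈ I,
        ‖x t - xs‖
          ≤ (comparison m (V x₀) (lam * max (t - t₀ - ε) 0) / γ) ^ (1 / (2 * m₁)) + ρ) :
    PracticallyAsymptoticallyStable f xs := by
  constructor
  · intro r hr
    obtain ⟨ε₁, hε₁, h⟩ := hdec (r / 2) (by positivity)
    refine ⟨min δ (r / (2 * c)), lt_min hδ (by positivity), ε₁, hε₁,
      fun t₀ _ ε hε hεlt x₀ hx₀ => ?_⟩
    have hx₀δ : x₀ ∈ Metric.ball xs δ := Metric.ball_subset_ball (min_le_left _ _) hx₀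
    obtain ⟨h1, h2⟩ := h ε hε hεlt.le t₀ x₀ hx₀δ
    obtain ⟨hV0, hVc⟩ := hV x₀ hx₀δ
    refine ⟨h1, fun I x hx t ht => ?_⟩
    have h3 := h2 I x hx t ht
    have h4 := comparison_rpow_le (s := lam * max (t - t₀ - ε) 0) hm₁ hm.le hγ hV0 (by positivity)
    have h5 : ‖x₀ - xs‖ < r / (2 * c) :=
      (mem_ball_iff_norm.1 hx₀).trans_le (min_le_right _ _)
    have h6 : c * ‖x₀ - xs‖ < r / 2 := by
      calc c * ‖x₀ - xs‖ < c * (r / (2 * c)) := by gcongr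
        _ = r / 2 := by field_simp
    rw [mem_ball_iff_norm]
    linarith
  · refine ⟨δ, hδ, fun r hr => ?_⟩
    obtain ⟨ε₁, hε₁, h⟩ := hdec (r / 2) (by positivity)
    obtain ⟨S, hS0, hS⟩ := exists_time_comparison_le hm₁ hm hlam hγ (by positivity : 0 < r / 4)
    refine ⟨S + 1, by positivity, min ε₁ 1, lt_min hε₁ one_pos, fun t₀ _ ε hε hεlt x₀ hx₀ => ?_⟩
    obtain ⟨h1, h2⟩ := h ε hε (hεlt.le.trans (min_le_left _ _)) t₀ x₀ hx₀
    obtain ⟨hV0, -⟩ := hV x₀ hx₀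
    refine ⟨h1, fun I x hx t ht htS => ?_⟩
    have h3 := h2 I x hx t ht
    have hε1 : ε < 1 := hεlt.trans_le (min_le_right _ _)
    have h4 := hS (V x₀) hV0 (max (t - t₀ - ε) 0) (le_trans (by linarith) (le_max_left _ _))
    rw [mem_ball_iff_norm]
    linarith

theorem exponentiallyStable_of_decay {f : ℝ → State n → State n} {ε σ₀ : ℝ} (hm₁ : 0 < m₁)
    (hγ : 0 < γ) (hlam : 0 < lam) (hc : 0 < c) (hδ : 0 < δ) (hσ₀ : 0 < σ₀)
    (hV : ∀ x₀ ∈ Metric.ball xs δ, 0 ≤ V x₀ ∧ (V x₀ / γ) ^ (1 / (2 * m₁)) ≤ c * ‖x₀ - xs‖)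
    (hdec : ∀ t₀, ∀ x₀ ∈ Metric.ball xs δ,
      HasGlobalSolution f t₀ x₀ ∧ ∀ I x, IsSolution f t₀ x₀ I x → ∀ t ∈ I,
        ‖x t - xs‖
          ≤ (comparison 0 (V x₀) (lam * max (t - t₀ - ε) 0) / γ) ^ (1 / (2 * m₁)) * σ₀) :
    ExponentiallyStable f xs := by
  refine ⟨δ, hδ, c * Real.exp (lam * ε / (2 * m₁)) * σ₀, by positivity, lam / (2 * m₁),
    by positivity, fun t₀ _ x₀ hx₀ => ?_⟩
  obtain ⟨h1, h2⟩ := hdec t₀ x₀ hx₀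
  obtain ⟨hV0, hVc⟩ := hV x₀ hx₀
  refine ⟨h1, fun I x hx t ht => (h2 I x hx t ht).trans ?_⟩
  rw [comparison_zero_div_rpow m₁ hγ hV0]
  have h3 := exp_neg_max_le (t := t - t₀) hm₁ hlam (le_refl ε)
  calc _ ≤ (c * ‖x₀ - xs‖) * (Real.exp (lam * ε / (2 * m₁)) *
        Real.exp (-(lam / (2 * m₁)) * (t - t₀))) * σ₀ := by gcongr
    _ = _ := by ring

theorem asymptoticallyStable_of_decay {f : ℝ → State n → State n} {ε σ₀ : ℝ} (hε : 0 < ε)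
    (hm₁ : 0 < m₁) (hm : 0 < m) (hγ : 0 < γ) (hlam : 0 < lam) (hc : 0 < c) (hδ : 0 < δ)
    (hσ₀ : 0 < σ₀)
    (hV : ∀ x₀ ∈ Metric.ball xs δ, 0 ≤ V x₀ ∧ (V x₀ / γ) ^ (1 / (2 * m₁)) ≤ c * ‖x₀ - xs‖)
    (hdec : ∀ t₀, ∀ x₀ ∈ Metric.ball xs δ,
      HasGlobalSolution f t₀ x₀ ∧ ∀ I x, IsSolution f t₀ x₀ I x → ∀ t ∈ I,
        ‖x t - xs‖
          ≤ (comparison m (V x₀) (lam * max (t - t₀ - ε) 0) / γ) ^ (1 / (2 * m₁)) * σ₀) :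
    AsymptoticallyStable f xs := by
  constructor
  · intro r hr
    refine ⟨min δ (r / (c * σ₀)), lt_min hδ (by positivity), fun t₀ _ x₀ hx₀ => ?_⟩
    have hx₀δ : x₀ ∈ Metric.ball xs δ := Metric.ball_subset_ball (min_le_left _ _) hx₀
    obtain ⟨h1, h2⟩ := hdec t₀ x₀ hx₀δ
    obtain ⟨hV0, hVc⟩ := hV x₀ hx₀δ
    refine ⟨h1, fun I x hx t ht => ?_⟩
    have h4 := comparison_rpow_le (s := lam * max (t - t₀ - ε) 0) hm₁ hm.le hγ hV0 (by positivity)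
    have h5 : ‖x₀ - xs‖ < r / (c * σ₀) :=
      (mem_ball_iff_norm.1 hx₀).trans_le (min_le_right _ _)
    rw [mem_ball_iff_norm]
    calc ‖x t - xs‖ ≤ _ := h2 I x hx t ht
      _ ≤ (c * ‖x₀ - xs‖) * σ₀ := by gcongr; exact h4.trans hVc
      _ < (c * (r / (c * σ₀))) * σ₀ := by gcongr
      _ = r := by field_simp
  · refine ⟨δ, hδ, fun r hr => ?_⟩
    obtain ⟨S, hS0, hS⟩ := exists_time_comparison_le hm₁ hm hlam hγ
      (by positivity : 0 < r / (2 * σ₀))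
    refine ⟨S + ε, by positivity, fun t₀ _ x₀ hx₀ I x hx t ht htS => ?_⟩
    obtain ⟨-, h2⟩ := hdec t₀ x₀ hx₀
    obtain ⟨hV0, -⟩ := hV x₀ hx₀
    have h4 := hS (V x₀) hV0 (max (t - t₀ - ε) 0) (le_trans (by linarith) (le_max_left _ _))
    rw [mem_ball_iff_norm]
    calc ‖x t - xs‖ ≤ _ := h2 I x hx t ht
      _ ≤ (r / (2 * σ₀)) * σ₀ := by gcongr
      _ = r / 2 := by field_simp
      _ < r := by linarith

/-- The relative oscillation within periods vanishes as time tends to infinity if `m > 0`. -/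
theorem tendsto_comparison_rpow (hm : 0 < m) (hγ : 0 < γ) (hlam : 0 < lam)
    {v : ℝ} (hv : 0 ≤ v) (ε : ℝ) :
    Tendsto (fun t => (comparison m v (lam * max (t - ε) 0) / γ) ^ (m / 2)) atTop (𝓝 0) := by
  rw [Metric.tendsto_atTop]
  intro R hR
  obtain ⟨S, -, hS⟩ := exists_time_comparison_le (m₁ := 1 / m) (by positivity) hm hlam hγ
    (by positivity : 0 < R / 2)
  refine ⟨S + ε, fun t ht => ?_⟩
  have h1 := hS v hv (max (t - ε) 0) (le_trans (by linarith) (le_max_left _ _))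
  rw [show 1 / (2 * (1 / m)) = m / 2 by field_simp] at h1
  have h2 := comparison_nonneg hm.le hv (by positivity : 0 ≤ lam * max (t - ε) 0)
  rw [Real.dist_eq, sub_zero, abs_of_nonneg (by positivity)]
  linarith

/-- If `N ≤ w * B` on `I`, and `N ≤ w * (1 + b)` at late times with `b → 0`, then the smallest
`σ ≥ 1` with `N ≤ σ * w` on `I` is bounded by `B` and tends to `1`. -/
theorem exists_amplitude {N w b : ℝ → ℝ} {I : Set ℝ} {B : ℝ} (hB1 : 1 ≤ B)
    (hw : ∀ t ∈ I, 0 ≤ w t) (hB : ∀ t ∈ I, N t ≤ w t * B) (hb : Tendsto b atTop (𝓝 0))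
    (hb0 : ∀ t, 0 ≤ b t) (hNb : ∀ᶠ t in atTop, t ∈ I → N t ≤ w t * (1 + b t)) :
    ∃ σ : ℝ → ℝ, (∀ t ∈ I, N t ≤ σ t * w t) ∧ (∀ t, σ t ≤ B) ∧ Tendsto σ atTop (𝓝 1) := by
  classical
  have hdiv : ∀ t ∈ I, ∀ C, 0 ≤ C → N t ≤ w t * C → N t / w t ≤ C := by
    intro t ht C hC h
    rcases (hw t ht).eq_or_lt with h0 | h0
    · rw [← h0, div_zero]; exact hC
    · rw [div_le_iff₀ h0]; linarith
  refine ⟨fun t => max 1 (if t ∈ I then N t / w t else 0), fun t ht => ?_, fun t => ?_, ?_⟩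
  · rcases (hw t ht).eq_or_lt with h0 | h0
    · have := hB t ht
      rw [← h0] at this ⊢
      simpa using this
    · beta_reduce
      rw [if_pos ht]
      calc N t = N t / w t * w t := by field_simp
        _ ≤ _ := by gcongr; exact le_max_right _ _
  · refine max_le hB1 ?_
    split_ifs with ht
    · exact hdiv t ht B (by linarith) (hB t ht)
    · linarith
  · refine tendsto_of_tendsto_of_tendsto_of_le_of_le' (h := fun t => 1 + b t) tendsto_const_nhds
      (by simpa using hb.const_add 1)
      (Eventually.of_forall fun t => le_max_left _ _) ?_
    filter_upwards [hNb] with t ht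
    have h0 := hb0 t
    refine max_le (by linarith) ?_
    split_ifs with htI
    · exact hdiv t htI _ (by linarith) (ht htI)
    · linarith

end Stability

end ExtremumSeeking

namespace ExtremumSeeking

variable {n : ℕ} {J : State n → ℝ} {F : Fin 2 → Fin n → ℝ → ℝ} {k : Fin n → ℕ} {xs : State n}
  {F₀ : Fin n → ℝ → ℝ} {D : Set (State n)} {γ₁ γ₂ κ₁ κ₂ μ m₁ m₂ α₁ α₂ M H : ℝ}

/-! ### Decay estimates and stability on balls of initial values -/

/-- The decay estimate for constant `F₀` on a ball of initial values. -/
theorem exists_forall_decay_const_ball (hD : IsOpen D) (hJ : ContDiff ℝ 2 J)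
    (hF : ∀ s i, ContinuousOn (F s i) (J '' D)) (hA1 : AssumptionA1 J D xs)
    (hA2 : AssumptionA2 J D xs γ₁ γ₂ κ₁ κ₂ μ m₁)
    (hA3 : AssumptionA3 J D xs F) (hk : ∀ i, 0 < k i) (hk_inj : Function.Injective k)
    (hrel : ∀ i, GeneratingRelation (F₀ i) (F 0 i) (F 1 i) (J '' (D \ {xs}))) {α : ℝ}
    (hα : 0 < α) (hF₀ : ∀ i, ∀ x ∈ D, F₀ i (J x) = α) {δ δ₀ lam ρ : ℝ} (hδ : 0 < δ)
    (hδ₀ : Metric.closedBall xs δ₀ ⊆ D) (hr : (γ₂ / γ₁) ^ (1 / (2 * m₁)) * δ < δ₀)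
    (hlam0 : 0 < lam) (hlam : lam < α * κ₁) (hρ : 0 < ρ) :
    ∃ ε₁ > 0, ∀ ε, 0 < ε → ε ≤ ε₁ → ∀ t₀, ∀ x₀ ∈ Metric.ball xs δ,
      HasGlobalSolution (esField J F k ε) t₀ x₀ ∧
      ∀ I x, IsSolution (esField J F k ε) t₀ x₀ I x → ∀ t ∈ I,
        ‖x t - xs‖ ≤ (comparison (1 - 1 / m₁) (J x₀ - J xs) (lam * max (t - t₀ - ε) 0) / γ₁)
          ^ (1 / (2 * m₁)) + ρ := by
  have hγ₁ := hA2.γ₁_pos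
  have hγ₂ := hA2.γ₂_pos
  obtain ⟨ε₁, hε₁, h⟩ := exists_forall_decay_const hD hJ hF hA1 hA2 hA3 hk hk_inj hrel hα hF₀ hδ₀
    (r := (γ₂ / γ₁) ^ (1 / (2 * m₁)) * δ) (by positivity) hr hlam0 hlam hρ
  refine ⟨ε₁, hε₁, fun ε hε hεle t₀ x₀ hx₀ => ?_⟩
  obtain ⟨h1, h2⟩ := hA2.mem_closedBall_and_sub_le hδ hr hδ₀ hx₀
  exact h ε hε hεle t₀ x₀ h1 h2

/-- The bounds on initial values under which decay estimates imply stability. -/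
theorem initial_bounds (hA1 : AssumptionA1 J D xs) (hA2 : AssumptionA2 J D xs γ₁ γ₂ κ₁ κ₂ μ m₁)
    {δ δ₀ : ℝ} (hδ : 0 < δ) (hδ₀ : Metric.closedBall xs δ₀ ⊆ D)
    (hr : (γ₂ / γ₁) ^ (1 / (2 * m₁)) * δ < δ₀) :
    ∀ x₀ ∈ Metric.ball xs δ, 0 ≤ J x₀ - J xs ∧
      ((J x₀ - J xs) / γ₁) ^ (1 / (2 * m₁)) ≤ (γ₂ / γ₁) ^ (1 / (2 * m₁)) * ‖x₀ - xs‖ := by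
  intro x₀ hx₀
  have hD := hδ₀ (hA2.mem_closedBall_and_sub_le hδ hr hδ₀ hx₀).1
  have hV := hA1.sub_nonneg hD
  exact ⟨hV, hA2.rpow_le hD hV⟩

/-- The decay estimate for vanishing controls on a ball of initial values. -/
theorem exists_forall_decay_vanishing_ball (hD : IsOpen D) (hJ : ContDiff ℝ 2 J)
    (hF : ∀ s i, ContinuousOn (F s i) (J '' D)) (hA1 : AssumptionA1 J D xs)
    (hA2 : AssumptionA2 J D xs γ₁ γ₂ κ₁ κ₂ μ m₁)
    (hA3 : AssumptionA3 J D xs F) (hk : ∀ i, 0 < k i) (hk_inj : Function.Injective k)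
    (hrel : ∀ i, GeneratingRelation (F₀ i) (F 0 i) (F 1 i) (J '' (D \ {xs})))
    (hA4 : AssumptionA4 J D xs F₀ F m₁ m₂ α₁ α₂ M H) {δ δ₀ lam : ℝ} (hδ : 0 < δ)
    (hδ₀ : Metric.closedBall xs δ₀ ⊆ D) (hr : (γ₂ / γ₁) ^ (1 / (2 * m₁)) * δ < δ₀)
    (hlam0 : 0 < lam) (hlam : lam < α₁ * κ₁) {L : ℝ≥0} (hL : 0 < L)
    (hLip : ∀ s i, LipschitzOnWith L (fun x => F s i (J x)) (Metric.closedBall xs δ₀)) :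
    ∃ ε₁ > 0, ∀ ε, 0 < ε → ε ≤ ε₁ → ∀ t₀, ∀ x₀ ∈ Metric.ball xs δ,
      HasGlobalSolution (esField J F k ε) t₀ x₀ ∧
      ∀ I x, IsSolution (esField J F k ε) t₀ x₀ I x → ∀ t ∈ I,
        ‖x t - xs‖ ≤
          (comparison (1 + m₂ - 1 / m₁) (J x₀ - J xs) (lam * max (t - t₀ - ε) 0) / γ₁)
            ^ (1 / (2 * m₁)) *
          (1 + M * γ₂ ^ ((m₂ + 1) / 2) / L *
            (comparison (1 + m₂ - 1 / m₁) (J x₀ - J xs) (lam * max (t - t₀ - ε) 0) / γ₁)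
              ^ ((1 + m₂ - 1 / m₁) / 2) * (Real.exp (inputBound k ε * L * ε) - 1)) := by
  have hγ₁ := hA2.γ₁_pos
  have hγ₂ := hA2.γ₂_pos
  obtain ⟨ε₁, hε₁, h⟩ := exists_forall_decay_vanishing hD hJ hF hA1 hA2 hA3 hk hk_inj hrel hA4 hδ₀
    (r := (γ₂ / γ₁) ^ (1 / (2 * m₁)) * δ) (by positivity) hr hlam0 hlam hL hLip
  refine ⟨ε₁, hε₁, fun ε hε hεle t₀ x₀ hx₀ => ?_⟩
  obtain ⟨h1, h2⟩ := hA2.mem_closedBall_and_sub_le hδ hr hδ₀ hx₀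
  exact h ε hε hεle t₀ x₀ h1 h2

/-- The factor of the oscillation within periods is bounded in terms of the radius `δ` of the ball
of initial values. -/
theorem oscillation_le (hA1 : AssumptionA1 J D xs) (hA2 : AssumptionA2 J D xs γ₁ γ₂ κ₁ κ₂ μ m₁)
    {m δ δ₀ s : ℝ} (hm : 0 ≤ m) (hs : 0 ≤ s) (hδ : 0 < δ) (hδ₀ : Metric.closedBall xs δ₀ ⊆ D)
    (hr : (γ₂ / γ₁) ^ (1 / (2 * m₁)) * δ < δ₀) {x₀ : State n} (hx₀ : x₀ ∈ Metric.ball xs δ) :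
    (comparison m (J x₀ - J xs) s / γ₁) ^ (m / 2) ≤ (γ₂ / γ₁) ^ (m / 2) * δ ^ (m₁ * m) := by
  have hγ₁ := hA2.γ₁_pos
  have hγ₂ := hA2.γ₂_pos
  obtain ⟨h1, h2⟩ := hA2.mem_closedBall_and_sub_le hδ hr hδ₀ hx₀
  have hV0 := hA1.sub_nonneg (hδ₀ h1)
  rw [hA2.mul_rpow_eq hδ.le] at h2
  have h3 := (comparison_le hm hV0 hs).trans h2
  have h4 := comparison_nonneg hm hV0 hs
  calc (comparison m (J x₀ - J xs) s / γ₁) ^ (m / 2)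
      ≤ (γ₂ / γ₁ * δ ^ (2 * m₁)) ^ (m / 2) := by
        rw [div_mul_eq_mul_div]; gcongr
    _ = _ := by
        rw [Real.mul_rpow (by positivity) (by positivity), ← Real.rpow_mul hδ.le]
        congr 2
        ring

theorem exp_inputBound_sub_one_nonneg (k : Fin n → ℕ) {ε : ℝ} (hε : 0 < ε) (L : ℝ≥0) :
    0 ≤ Real.exp (inputBound k ε * L * ε) - 1 := by
  have := inputBound_nonneg k hε
  have h1 : 0 ≤ inputBound k ε * L * ε := by positivity
  linarith [Real.one_le_exp h1]

/-- The decay estimate for constant `F₀` in terms of the decay function, for all rates `l ≤ lbar`. -/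
theorem exists_forall_bound_const (hD : IsOpen D) (hJ : ContDiff ℝ 2 J)
    (hF : ∀ s i, ContinuousOn (F s i) (J '' D)) (hA1 : AssumptionA1 J D xs)
    (hA2 : AssumptionA2 J D xs γ₁ γ₂ κ₁ κ₂ μ m₁)
    (hA3 : AssumptionA3 J D xs F) (hk : ∀ i, 0 < k i) (hk_inj : Function.Injective k)
    (hrel : ∀ i, GeneratingRelation (F₀ i) (F 0 i) (F 1 i) (J '' (D \ {xs}))) {α : ℝ}
    (hα : 0 < α) (hF₀ : ∀ i, ∀ x ∈ D, F₀ i (J x) = α) {δ δ₀ lbar ρ : ℝ} (hδ : 0 < δ)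
    (hδ₀ : Metric.closedBall xs δ₀ ⊆ D) (hr : (γ₂ / γ₁) ^ (1 / (2 * m₁)) * δ < δ₀)
    (hlbar0 : 0 < lbar) (hlbar : lbar < α * κ₁) (hρ : 0 < ρ) :
    ∃ εbar > 0, ∀ ε, 0 < ε → ε ≤ εbar → ∀ l, 0 < l → l ≤ lbar → ∀ x₀ ∈ Metric.ball xs δ,
      HasGlobalSolution (esField J F k ε) 0 x₀ ∧
      ∀ I x, IsSolution (esField J F k ε) 0 x₀ I x → ∀ t ∈ I,
        ‖x t - xs‖ ≤ (γ₂ / γ₁) ^ (1 / (2 * m₁)) * ‖x₀ - xs‖ *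
          decayFun m₁ (1 - 1 / m₁) (J x₀ - J xs) (l * (t - ε)) + ρ := by
  have hm1 := hA2.one_le_m₁
  have hm0 : 0 < m₁ := by linarith
  have hγ₁ := hA2.γ₁_pos
  have hγ₂ := hA2.γ₂_pos
  have hmt : 0 ≤ 1 - 1 / m₁ := by
    rw [sub_nonneg, div_le_one hm0]; exact hm1
  obtain ⟨ε₁, hε₁, h⟩ := exists_forall_decay_const_ball hD hJ hF hA1 hA2 hA3 hk hk_inj hrel hα hF₀
    hδ hδ₀ hr hlbar0 hlbar hρ
  set A := (1 - 1 / m₁) * lbar * (γ₂ * δ ^ (2 * m₁)) ^ (1 - 1 / m₁) + 1 with hA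
  have hA0 : 0 < A := by positivity
  -- `ε ≤ 1 / A` keeps the decay function away from its singularity for `t < ε`
  refine ⟨min ε₁ (1 / A), lt_min hε₁ (by positivity), fun ε hε hεle l hl0 hl x₀ hx₀ => ?_⟩
  obtain ⟨h1, h2⟩ := h ε hε (hεle.trans (min_le_left _ _)) 0 x₀ hx₀
  obtain ⟨hV0, hVc⟩ := initial_bounds hA1 hA2 hδ hδ₀ hr x₀ hx₀
  have hVle := (hA2.mem_closedBall_and_sub_le hδ hr hδ₀ hx₀).2
  rw [hA2.mul_rpow_eq hδ.le] at hVle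
  refine ⟨h1, fun I x hx t ht => (h2 I x hx t ht).trans (add_le_add ?_ le_rfl)⟩
  have hεA : ε * A ≤ 1 := (le_div_iff₀ hA0).1 (hεle.trans (min_le_right _ _))
  rw [sub_zero, comparison_div_rpow hm0 hγ₁ hmt hV0 (by positivity)]
  have h3 := decayFun_le_of_le hm0 hmt hV0 hl0 hl
    (one_add_mul_pos hmt hV0 hVle hl0 hl hε hεA (hx.subset ht))
  exact mul_le_mul hVc h3 (decayFun_nonneg hmt hV0 (by positivity)) (by positivity)

/-- The decay estimate for vanishing controls in terms of the decay function, for all rates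
`l ≤ lbar`, with an amplitude `σ` that tends to `1`. -/
theorem exists_forall_bound_vanishing (hD : IsOpen D) (hJ : ContDiff ℝ 2 J)
    (hF : ∀ s i, ContinuousOn (F s i) (J '' D)) (hA1 : AssumptionA1 J D xs)
    (hA2 : AssumptionA2 J D xs γ₁ γ₂ κ₁ κ₂ μ m₁)
    (hA3 : AssumptionA3 J D xs F) (hk : ∀ i, 0 < k i) (hk_inj : Function.Injective k)
    (hrel : ∀ i, GeneratingRelation (F₀ i) (F 0 i) (F 1 i) (J '' (D \ {xs})))
    (hA4 : AssumptionA4 J D xs F₀ F m₁ m₂ α₁ α₂ M H) {δ δ₀ lbar : ℝ} (hδ : 0 < δ)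
    (hδ₀ : Metric.closedBall xs δ₀ ⊆ D) (hr : (γ₂ / γ₁) ^ (1 / (2 * m₁)) * δ < δ₀)
    (hlbar0 : 0 < lbar) (hlbar : lbar < α₁ * κ₁) {L : ℝ≥0} (hL : 0 < L)
    (hLip : ∀ s i, LipschitzOnWith L (fun x => F s i (J x)) (Metric.closedBall xs δ₀)) :
    ∃ εbar > 0, ∀ ε, 0 < ε → ε ≤ εbar → ∀ l, 0 < l → l ≤ lbar → ∀ x₀ ∈ Metric.ball xs δ,
      HasGlobalSolution (esField J F k ε) 0 x₀ ∧
      ∀ I x, IsSolution (esField J F k ε) 0 x₀ I x →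
        ∃ σ : ℝ → ℝ,
          (∀ t ∈ I, ‖x t - xs‖ ≤ σ t * (γ₂ / γ₁) ^ (1 / (2 * m₁)) * ‖x₀ - xs‖ *
            decayFun m₁ (1 + m₂ - 1 / m₁) (J x₀ - J xs) (l * (t - ε))) ∧
          (∀ t ≥ 0, σ t ≤ 1 + M * γ₂ ^ ((m₂ + 1) / 2) / L *
            (γ₂ / γ₁) ^ ((1 + m₂ - 1 / m₁) / 2) * δ ^ (m₁ * (1 + m₂ - 1 / m₁)) *
            (Real.exp (inputBound k ε * L * ε) - 1)) ∧
          Tendsto σ atTop (𝓝 1) := by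
  have hm1 := hA2.one_le_m₁
  have hm0 : 0 < m₁ := by linarith
  have hγ₁ := hA2.γ₁_pos
  have hγ₂ := hA2.γ₂_pos
  have hM := hA4.M_pos
  have hmt := hA4.nonneg
  have hL' : (0 : ℝ) < L := by exact_mod_cast hL
  -- a rate above `lbar`, so that the oscillations are absorbed as time tends to infinity
  obtain ⟨lam, hlam1, hlam2⟩ := exists_between hlbar
  have hlam0 : 0 < lam := hlbar0.trans hlam1
  obtain ⟨ε₁, hε₁, h⟩ := exists_forall_decay_vanishing_ball hD hJ hF hA1 hA2 hA3 hk hk_inj hrel hA4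
    hδ hδ₀ hr hlam0 hlam2 hL hLip
  set mt := 1 + m₂ - 1 / m₁ with hmtdef
  set A := mt * lbar * (γ₂ * δ ^ (2 * m₁)) ^ mt + 1 with hA
  have hA0 : 0 < A := by positivity
  -- `ε ≤ 1 / A` keeps the decay function away from its singularity for `t < ε`
  refine ⟨min ε₁ (1 / A), lt_min hε₁ (by positivity), fun ε hε hεle l hl0 hl x₀ hx₀ => ?_⟩
  obtain ⟨h1, h2⟩ := h ε hε (hεle.trans (min_le_left _ _)) 0 x₀ hx₀
  obtain ⟨hV0, hVc⟩ := initial_bounds hA1 hA2 hδ hδ₀ hr x₀ hx₀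
  have hVle := (hA2.mem_closedBall_and_sub_le hδ hr hδ₀ hx₀).2
  rw [hA2.mul_rpow_eq hδ.le] at hVle
  refine ⟨h1, fun I x hx => ?_⟩
  have hεA : ε * A ≤ 1 := (le_div_iff₀ hA0).1 (hεle.trans (min_le_right _ _))
  have hpos : ∀ t ≥ 0, 0 < 1 + mt * (l * (t - ε)) * (J x₀ - J xs) ^ mt := fun t ht =>
    one_add_mul_pos hmt hV0 hVle hl0 hl hε hεA ht
  have hE := exp_inputBound_sub_one_nonneg k hε L
  set E := Real.exp (inputBound k ε * L * ε) - 1 with hEdef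
  set K := M * γ₂ ^ ((m₂ + 1) / 2) / L with hK
  have hK0 : 0 ≤ K := by positivity
  set c := (γ₂ / γ₁) ^ (1 / (2 * m₁)) with hc
  have hc0 : 0 ≤ c := by positivity
  set V₀ := J x₀ - J xs with hV₀
  set Φ : ℝ → ℝ := fun t => comparison mt V₀ (lam * max (t - ε) 0) with hΦ
  have hΦ0 : ∀ t, 0 ≤ Φ t := fun t => comparison_nonneg hmt hV0 (by positivity)
  set w : ℝ → ℝ := fun t => c * ‖x₀ - xs‖ * decayFun m₁ mt V₀ (l * (t - ε)) with hw
  have hw0 : ∀ t ∈ I, 0 ≤ w t := fun t ht => by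
    have := (decayFun_pos (m₁ := m₁) (hpos t (hx.subset ht))).le
    positivity
  have hest : ∀ t ∈ I, ‖x t - xs‖ ≤ (Φ t / γ₁) ^ (1 / (2 * m₁)) *
      (1 + K * (Φ t / γ₁) ^ (mt / 2) * E) := fun t ht => by
    have := h2 I x hx t ht
    rwa [sub_zero] at this
  have hΦw : ∀ t ∈ I, (Φ t / γ₁) ^ (1 / (2 * m₁)) ≤ w t := by
    intro t ht
    rw [hΦ, comparison_div_rpow hm0 hγ₁ hmt hV0 (by positivity)]
    refine mul_le_mul hVc ?_ (decayFun_nonneg hmt hV0 (by positivity)) (by positivity)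
    exact decayFun_le_of_le hm0 hmt hV0 hl0 (hl.trans hlam1.le) (hpos t (hx.subset ht))
  have hosc : ∀ t, (Φ t / γ₁) ^ (mt / 2) ≤ (γ₂ / γ₁) ^ (mt / 2) * δ ^ (m₁ * mt) := fun t =>
    oscillation_le hA1 hA2 hmt (by positivity) hδ hδ₀ hr hx₀
  set B := 1 + K * (γ₂ / γ₁) ^ (mt / 2) * δ ^ (m₁ * mt) * E with hB
  have hB1 : 1 ≤ B := by
    have : 0 ≤ K * (γ₂ / γ₁) ^ (mt / 2) * δ ^ (m₁ * mt) * E := by positivity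
    linarith
  have hfac : ∀ t, 1 + K * (Φ t / γ₁) ^ (mt / 2) * E ≤ B := fun t => by
    rw [hB, mul_assoc K ((γ₂ / γ₁) ^ (mt / 2))]
    gcongr
    exact hosc t
  have hfac0 : ∀ t, 0 ≤ K * (Φ t / γ₁) ^ (mt / 2) * E := fun t => by
    have := hΦ0 t
    positivity
  have hNB : ∀ t ∈ I, ‖x t - xs‖ ≤ w t * B := fun t ht =>
    (hest t ht).trans (mul_le_mul (hΦw t ht) (hfac t) (by linarith [hfac0 t]) (hw0 t ht))
  obtain ⟨b, hb, hb0, hNb⟩ : ∃ b : ℝ → ℝ, Tendsto b atTop (𝓝 0) ∧ (∀ t, 0 ≤ b t) ∧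
      ∀ᶠ t in atTop, t ∈ I → ‖x t - xs‖ ≤ w t * (1 + b t) := by
    rcases hmt.eq_or_lt with hmt0 | hmtpos
    · -- exponential decay: the gap between the rates `lam` and `l` absorbs the constant `B`
      set η := (lam - l) / (2 * m₁) with hη
      have hη0 : 0 < η := div_pos (by linarith) (by positivity)
      refine ⟨fun t => B * Real.exp (-(η * (t - ε))), ?_, fun t => by positivity, ?_⟩
      · have h3 : Tendsto (fun t => η * (t - ε)) atTop atTop :=
          (tendsto_atTop_add_const_right atTop (-ε) tendsto_id).const_mul_atTop hη0
        simpa using (Real.tendsto_exp_neg_atTop_nhds_zero.comp h3).const_mul B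
      · filter_upwards [eventually_ge_atTop ε] with t htε ht
        have h4 : (Φ t / γ₁) ^ (1 / (2 * m₁)) ≤ w t * Real.exp (-(η * (t - ε))) := by
          simp only [hΦ, hw]
          rw [← hmt0, comparison_zero_div_rpow m₁ hγ₁ hV0, decayFun, if_pos rfl,
            max_eq_left (by linarith), mul_assoc (c * _), ← Real.exp_add]
          have : -(lam * (t - ε)) / (2 * m₁) = -(l * (t - ε)) / (2 * m₁) + -(η * (t - ε)) := by
            rw [hη]; ring
          rw [this]
          gcongr
        calc ‖x t - xs‖ ≤ w t * Real.exp (-(η * (t - ε))) * B :=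
              (hest t ht).trans (mul_le_mul h4 (hfac t) (by linarith [hfac0 t])
                (mul_nonneg (hw0 t ht) (Real.exp_pos _).le))
          _ = w t * (B * Real.exp (-(η * (t - ε)))) := by ring
          _ ≤ _ := mul_le_mul_of_nonneg_left (by linarith) (hw0 t ht)
    · refine ⟨fun t => K * (Φ t / γ₁) ^ (mt / 2) * E, ?_, hfac0, ?_⟩
      · have := ((tendsto_comparison_rpow hmtpos hγ₁ hlam0 hV0 ε).const_mul K).mul_const E
        simpa using this
      · exact Eventually.of_forall fun t ht => (hest t ht).trans
          (mul_le_mul_of_nonneg_right (hΦw t ht) (by linarith [hfac0 t]))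
  obtain ⟨σ, hσ1, hσ2, hσ3⟩ := exists_amplitude hB1 hw0 hNB hb hb0 hNb
  refine ⟨σ, fun t ht => (hσ1 t ht).trans (le_of_eq ?_), fun t _ => hσ2 t, hσ3⟩
  simp only [hw]
  ring

/-- There are radii `δ`, `δ₀` that satisfy the requirements of the decay estimates. -/
theorem exists_radii (hA2 : AssumptionA2 J D xs γ₁ γ₂ κ₁ κ₂ μ m₁) (hD : IsOpen D) (hxs : xs ∈ D) :
    ∃ δ > 0, ∃ δ₀ > 0, Metric.closedBall xs δ₀ ⊆ D ∧ (γ₂ / γ₁) ^ (1 / (2 * m₁)) * δ < δ₀ := by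
  have hγ₁ := hA2.γ₁_pos
  have hγ₂ := hA2.γ₂_pos
  obtain ⟨δ₀, hδ₀, hsub⟩ := Metric.nhds_basis_closedBall.mem_iff.1 (hD.mem_nhds hxs)
  have hc : 0 < (γ₂ / γ₁) ^ (1 / (2 * m₁)) := by positivity
  refine ⟨δ₀ / (2 * (γ₂ / γ₁) ^ (1 / (2 * m₁))), by positivity, δ₀, hδ₀, hsub, ?_⟩
  rw [show (γ₂ / γ₁) ^ (1 / (2 * m₁)) * (δ₀ / (2 * (γ₂ / γ₁) ^ (1 / (2 * m₁)))) = δ₀ / 2 by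
    field_simp]
  linarith

theorem practical_stability_const (hD : IsOpen D) (hJ : ContDiff ℝ 2 J)
    (hF : ∀ s i, ContinuousOn (F s i) (J '' D)) (hA1 : AssumptionA1 J D xs)
    (hA2 : AssumptionA2 J D xs γ₁ γ₂ κ₁ κ₂ μ m₁)
    (hA3 : AssumptionA3 J D xs F) (hk : ∀ i, 0 < k i) (hk_inj : Function.Injective k)
    (hrel : ∀ i, GeneratingRelation (F₀ i) (F 0 i) (F 1 i) (J '' (D \ {xs}))) {α : ℝ}
    (hα : 0 < α) (hF₀ : ∀ i, ∀ x ∈ D, F₀ i (J x) = α) :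
    (m₁ = 1 → PracticallyExponentiallyStable (esField J F k) xs) ∧
      (1 < m₁ → PracticallyAsymptoticallyStable (esField J F k) xs) := by
  have hm0 : 0 < m₁ := by linarith [hA2.one_le_m₁]
  have hγ₁ := hA2.γ₁_pos
  have hγ₂ := hA2.γ₂_pos
  have hκ₁ := hA2.κ₁_pos
  obtain ⟨δ, hδ, δ₀, -, hδ₀, hr⟩ := exists_radii hA2 hD hA1.mem
  have hdec := fun ρ (hρ : 0 < ρ) => exists_forall_decay_const_ball hD hJ hF hA1 hA2 hA3 hk hk_inj
    hrel hα hF₀ hδ hδ₀ hr (lam := α * κ₁ / 2) (by positivity)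
    (half_lt_self (by positivity)) hρ
  have hV := initial_bounds hA1 hA2 hδ hδ₀ hr
  constructor
  · intro h1
    have hmt : 1 - 1 / m₁ = 0 := by rw [h1]; norm_num
    rw [hmt] at hdec
    exact practicallyExponentiallyStable_of_decay (V := fun y => J y - J xs) hm0 hγ₁ (by positivity)
      (by positivity) hδ hV hdec
  · intro h1
    exact practicallyAsymptoticallyStable_of_decay (V := fun y => J y - J xs) hm0
      (by rw [sub_pos, div_lt_one hm0]; exact h1) hγ₁ (by positivity) (by positivity) hδ hV hdec

theorem stability_vanishing (hD : IsOpen D) (hJ : ContDiff ℝ 2 J)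
    (hF : ∀ s i, ContinuousOn (F s i) (J '' D)) (hA1 : AssumptionA1 J D xs)
    (hA2 : AssumptionA2 J D xs γ₁ γ₂ κ₁ κ₂ μ m₁)
    (hA3 : AssumptionA3 J D xs F) (hk : ∀ i, 0 < k i) (hk_inj : Function.Injective k)
    (hrel : ∀ i, GeneratingRelation (F₀ i) (F 0 i) (F 1 i) (J '' (D \ {xs})))
    (hA4 : AssumptionA4 J D xs F₀ F m₁ m₂ α₁ α₂ M H) :
    ∃ εbar > 0, ∀ ε, 0 < ε → ε ≤ εbar →
      (1 + m₂ - 1 / m₁ = 0 → ExponentiallyStable (esField J F k ε) xs) ∧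
      (0 < 1 + m₂ - 1 / m₁ → AsymptoticallyStable (esField J F k ε) xs) := by
  have hm0 : 0 < m₁ := by linarith [hA2.one_le_m₁]
  have hγ₁ := hA2.γ₁_pos
  have hγ₂ := hA2.γ₂_pos
  have hκ₁ := hA2.κ₁_pos
  have hα₁ := hA4.α₁_pos
  have hM := hA4.M_pos
  have hmt := hA4.nonneg
  obtain ⟨δ, hδ, δ₀, -, hδ₀, hr⟩ := exists_radii hA2 hD hA1.mem
  choose L₀ hL₀ using fun s i => hA4.lipschitz s i _ (isCompact_closedBall xs δ₀) hδ₀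
  set L : ℝ≥0 := ∑ s, ∑ i, L₀ s i + 1 with hLdef
  have hL : 0 < L := by positivity
  have hLip : ∀ s i, LipschitzOnWith L (fun x => F s i (J x)) (Metric.closedBall xs δ₀) := by
    refine fun s i => (hL₀ s i).weaken ?_
    calc L₀ s i ≤ ∑ i, L₀ s i :=
          Finset.single_le_sum (f := fun i => L₀ s i) (fun _ _ => zero_le) (Finset.mem_univ i)
      _ ≤ ∑ s, ∑ i, L₀ s i :=
          Finset.single_le_sum (f := fun s => ∑ i, L₀ s i) (fun _ _ => zero_le)
            (Finset.mem_univ s)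
      _ ≤ L := le_self_add
  have hL' : (0 : ℝ) < L := by exact_mod_cast hL
  set lam := α₁ * κ₁ / 2 with hlam
  have hlam0 : 0 < lam := by positivity
  obtain ⟨ε₁, hε₁, h⟩ := exists_forall_decay_vanishing_ball hD hJ hF hA1 hA2 hA3 hk hk_inj hrel hA4
    hδ hδ₀ hr hlam0 (half_lt_self (by positivity)) hL hLip
  refine ⟨ε₁, hε₁, fun ε hε hεle => ?_⟩
  have hE := exp_inputBound_sub_one_nonneg k hε L
  set E := Real.exp (inputBound k ε * L * ε) - 1 with hEdef
  set σ₀ := 1 + M * γ₂ ^ ((m₂ + 1) / 2) / L * ((γ₂ / γ₁) ^ ((1 + m₂ - 1 / m₁) / 2) *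
    δ ^ (m₁ * (1 + m₂ - 1 / m₁))) * E with hσ₀
  have hσ₀0 : 0 < σ₀ := by positivity
  have hV := initial_bounds hA1 hA2 hδ hδ₀ hr
  have hdec : ∀ t₀, ∀ x₀ ∈ Metric.ball xs δ,
      HasGlobalSolution (esField J F k ε) t₀ x₀ ∧
      ∀ I x, IsSolution (esField J F k ε) t₀ x₀ I x → ∀ t ∈ I, ‖x t - xs‖
        ≤ (comparison (1 + m₂ - 1 / m₁) (J x₀ - J xs) (lam * max (t - t₀ - ε) 0) / γ₁)
            ^ (1 / (2 * m₁)) * σ₀ := by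
    intro t₀ x₀ hx₀
    obtain ⟨h1, h2⟩ := h ε hε hεle t₀ x₀ hx₀
    refine ⟨h1, fun I x hx t ht => (h2 I x hx t ht).trans ?_⟩
    have hcn := comparison_nonneg hmt (hV x₀ hx₀).1
      (by positivity : 0 ≤ lam * max (t - t₀ - ε) 0)
    rw [hσ₀]
    gcongr
    exact oscillation_le hA1 hA2 hmt (by positivity) hδ hδ₀ hr hx₀
  constructor
  · intro h0
    rw [h0] at hdec
    exact exponentiallyStable_of_decay (V := fun y => J y - J xs) hm0 hγ₁ hlam0 (by positivity) hδ
      hσ₀0 hV hdec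
  · intro h0
    exact asymptoticallyStable_of_decay (V := fun y => J y - J xs) hε hm0 h0 hγ₁ hlam0
      (by positivity) hδ hσ₀0 hV hdec

end ExtremumSeeking

theorem theorem3 {n : ℕ} (J : ExtremumSeeking.State n → ℝ) (hJ : ContDiff ℝ 2 J)
    (xs : ExtremumSeeking.State n) (Δ : ℝ≥0∞) (hΔ : 0 < Δ)
    (γ₁ γ₂ κ₁ κ₂ μ m₁ : ℝ)
    (F₀ : Fin n → ℝ → ℝ) (F : Fin 2 → Fin n → ℝ → ℝ)
    (k : Fin n → ℕ) (hk : ∀ i, 0 < k i) (hk_inj : Function.Injective k)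
    (hA1 : ExtremumSeeking.AssumptionA1 J (Metric.eball xs Δ) xs)
    (hA2 : ExtremumSeeking.AssumptionA2 J (Metric.eball xs Δ) xs γ₁ γ₂ κ₁ κ₂ μ m₁)
    (hA3 : ExtremumSeeking.AssumptionA3 J (Metric.eball xs Δ) xs F)
    (hF : ∀ s i, ContinuousOn (F s i) (J '' Metric.eball xs Δ))
    (hclass : ∀ i, ExtremumSeeking.GeneratingRelation (F₀ i) (F 0 i) (F 1 i)
      (J '' (Metric.eball xs Δ \ {xs}))) :
    -- I. constant `F₀`: practical stability
    (∀ α : ℝ, 0 < α → (∀ i, ∀ x ∈ Metric.eball xs Δ, F₀ i (J x) = α) →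
      (m₁ = 1 → ExtremumSeeking.PracticallyExponentiallyStable
        (ExtremumSeeking.esField J F k) xs) ∧
      (1 < m₁ → ExtremumSeeking.PracticallyAsymptoticallyStable
        (ExtremumSeeking.esField J F k) xs) ∧
      ∀ δ : ℝ, 0 < δ → ENNReal.ofReal δ < ENNReal.ofReal ((γ₁ / γ₂) ^ (1 / (2 * m₁))) * Δ →
      ∀ lbar : ℝ, 0 < lbar → lbar < α * κ₁ →
      ∀ ρ : ℝ, 0 < ρ → ρ < δ →
      ∃ εbar > 0, ∀ ε, 0 < ε → ε ≤ εbar → ∀ l, 0 < l → l ≤ lbar →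
      ∀ x₀ ∈ Metric.ball xs δ,
        ExtremumSeeking.HasGlobalSolution (ExtremumSeeking.esField J F k ε) 0 x₀ ∧
        ∀ I x, ExtremumSeeking.IsSolution (ExtremumSeeking.esField J F k ε) 0 x₀ I x →
          ∀ t ∈ I, ‖x t - xs‖ ≤ (γ₂ / γ₁) ^ (1 / (2 * m₁)) * ‖x₀ - xs‖ *
            ExtremumSeeking.decayFun m₁ (1 - 1 / m₁) (J x₀ - J xs) (l * (t - ε)) + ρ) ∧
    -- II. vanishing controls: stability in the sense of Lyapunov
    (∀ m₂ α₁ α₂ M H : ℝ,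
      ExtremumSeeking.AssumptionA4 J (Metric.eball xs Δ) xs F₀ F m₁ m₂ α₁ α₂ M H →
      (1 + m₂ - 1 / m₁ = 0 → ∃ εbar > 0, ∀ ε, 0 < ε → ε ≤ εbar →
        ExtremumSeeking.ExponentiallyStable (ExtremumSeeking.esField J F k ε) xs) ∧
      (0 < 1 + m₂ - 1 / m₁ → ∃ εbar > 0, ∀ ε, 0 < ε → ε ≤ εbar →
        ExtremumSeeking.AsymptoticallyStable (ExtremumSeeking.esField J F k ε) xs) ∧
      ∀ δ : ℝ, 0 < δ → ENNReal.ofReal δ < ENNReal.ofReal ((γ₁ / γ₂) ^ (1 / (2 * m₁))) * Δ →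
      ∀ lbar : ℝ, 0 < lbar → lbar < α₁ * κ₁ →
      ∀ δ₀ : ℝ, (γ₂ / γ₁) ^ (1 / (2 * m₁)) * δ < δ₀ → ENNReal.ofReal δ₀ < Δ →
      ∀ L : ℝ≥0, 0 < L →
        (∀ s i, LipschitzOnWith L (fun x => F s i (J x)) (Metric.closedBall xs δ₀)) →
      ∃ εbar > 0, ∀ ε, 0 < ε → ε ≤ εbar → ∀ l, 0 < l → l ≤ lbar →
      ∀ x₀ ∈ Metric.ball xs δ,
        ExtremumSeeking.HasGlobalSolution (ExtremumSeeking.esField J F k ε) 0 x₀ ∧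
        ∀ I x, ExtremumSeeking.IsSolution (ExtremumSeeking.esField J F k ε) 0 x₀ I x →
          ∃ σ : ℝ → ℝ,
            (∀ t ∈ I, ‖x t - xs‖ ≤ σ t * (γ₂ / γ₁) ^ (1 / (2 * m₁)) * ‖x₀ - xs‖ *
              ExtremumSeeking.decayFun m₁ (1 + m₂ - 1 / m₁) (J x₀ - J xs) (l * (t - ε))) ∧
            (∀ t ≥ 0, σ t ≤ 1 + M * γ₂ ^ ((m₂ + 1) / 2) / L *
              (γ₂ / γ₁) ^ ((1 + m₂ - 1 / m₁) / 2) * δ ^ (m₁ * (1 + m₂ - 1 / m₁)) *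
              (Real.exp (ExtremumSeeking.inputBound k ε * L * ε) - 1)) ∧
            Tendsto σ atTop (𝓝 1)) := by
  have hD : IsOpen (Metric.eball xs Δ) := Metric.isOpen_eball
  have hγ₁ := hA2.γ₁_pos
  have hγ₂ := hA2.γ₂_pos
  refine ⟨fun α hα hF₀ => ?_, fun m₂ α₁ α₂ M H hA4 => ?_⟩
  · obtain ⟨h1, h2⟩ := ExtremumSeeking.practical_stability_const hD hJ hF hA1 hA2 hA3 hk hk_inj
      hclass hα hF₀
    refine ⟨h1, h2, fun δ hδ hδΔ lbar hlbar0 hlbar ρ hρ _ => ?_⟩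
    obtain ⟨δ₀, hr, hδ₀⟩ := ExtremumSeeking.exists_lt_ofReal_lt (by positivity)
      (hA2.ofReal_mul_lt hδΔ)
    exact ExtremumSeeking.exists_forall_bound_const hD hJ hF hA1 hA2 hA3 hk hk_inj hclass hα hF₀ hδ
      (ExtremumSeeking.closedBall_subset_eball hδ₀) hr hlbar0 hlbar hρ
  · obtain ⟨ε₁, hε₁, h⟩ := ExtremumSeeking.stability_vanishing hD hJ hF hA1 hA2 hA3 hk hk_inj
      hclass hA4
    refine ⟨fun h0 => ⟨ε₁, hε₁, fun ε hε hεle => (h ε hε hεle).1 h0⟩,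
      fun h0 => ⟨ε₁, hε₁, fun ε hε hεle => (h ε hε hεle).2 h0⟩, ?_⟩
    intro δ hδ _ lbar hlbar0 hlbar δ₀ hr hδ₀ L hL hLip
    exact ExtremumSeeking.exists_forall_bound_vanishing hD hJ hF hA1 hA2 hA3 hk hk_inj hclass hA4 hδ
      (ExtremumSeeking.closedBall_subset_eball hδ₀) hr hlbar0 hlbar hL hLip
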